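/- **Setting.** Let $P$ be a self-adjoint operator on a complex Hilbert space $\mathcal H$, let $R(\lambda)=(P-\lambda^2)^{-1}$, and for $s\ge 0$ let $\mathcal D^s=(P+i)^{-s}\mathcal H$ with norm $\|(P+i)^{-s}v\|_{\mathcal D^s}=\|v\|_{\mathcal H}$. Assume: 1. The spectrum of $P$ is $[0,\infty)\cup\{E_1,\dots,E_N\}$, where $N\ge 0$ and $E_1<\dots<E_N<0$ are eigenvalues with orthogonal eigenprojections $\Pi_1,\dots,\Pi_N$. 2. $\chi\colon\mathcal H\to\mathcal H$ is a bounded operator and $c_0>0$ is such that $\lambda\mapsto\chi R(\lambda)\chi$ continues holomorphically (with values in the bounded operators on $\mathcal H$) from $\{\operatorname{Im}\lambda>0,\ \operatorname{Re}\lambda\ne0\}$ to $\{\operatorname{Im}\lambda>-c_0,\ \operatorname{Re}\lambda\neq 0\}$; the continuation is still written $\chi R(\lambda)\chi$. 3. There are $p,q\ge 0$ such that $\|\chi R(\lambda)\chi\|_{\mathcal D^p\to\mathcal D^q}\to 0$ as $|\operatorname{Re}\lambda|\to\infty$, uniformly for $-c_0<\operatorname{Im}\lambda\le c_0$, and such that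 for every real $s>-c_0$ with $s\ne 0$ and $s\neq\sqrt{-E_\ell}$ for all $\ell$, $$\sup_{\varepsilon>0}\int_{\{x\in\mathbb R:\ |x|>\varepsilon\}}\|\chi R(x+is)\chi\|_{\mathcal D^p\to\mathcal D^q}\,dx<\infty .$$ 4. There are bounded operators $\chi A_{j,k}\chi\colon\mathcal D^p\to\mathcal D^q$ and numbers $\nu_j\in\mathbb R$, $b_{j,k}\in\mathbb C\setminus i[0,\infty)$ $(j\in\mathbb N,\ k\in\mathbb Z)$ such that $$\chi R(\lambda)\chi=\sum_{j,k}\chi A_{j,k}\chi\,\lambda^{\nu_j}\log^k(b_{j,k}\lambda)$$ on the part with $\operatorname{Re}\lambda\ne 0$ of $W=\{\arg\lambda\in(-\tfrac\pi2,\tfrac{3\pi}2),\ |\operatorname{Re}\lambda|<c_0,\ |\operatorname{Im}\lambda|<c_0\}$. The sum converges in the norm of operators $\mathcal D^p\to\mathcal D^q$, absolutely at each of these points, and (as an unordered sum) uniformly on $\{\operatorname{Re}\lambda\ne0,\ |\operatorname{Re}\lambda|\le c',\ |\operatorname{Im}\lambda|\le c'\}$ for every $c'<c_0$. Here $\log(b\lambda)=\log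 b+\log\lambda$ with $\arg\lambda\in(-\frac\pi2,\frac{3\pi}2)$ and $\arg b\in(-\frac{3\pi}2,\frac\pi2)$, $\lambda^\nu=e^{\nu\log\lambda}$, and $\log (b_{j,k}\lambda)$ has no zero in $W$ when $k<0$ and $\chi A_{j,k}\chi\ne0$. For $0<\delta,c$ let $\gamma(\delta,c)$ be the contour that runs straight up from $-\delta-ic$ to $-\delta$, then along the upper half of the circle $|\lambda|=\delta$ from $-\delta$ to $\delta$, then straight down from $\delta$ to $\delta-ic$. **Theorem.** Let $0<c<c_0$. For all $j,k$ and $t\ge 0$ the limit $$J_{j,k}(t)=\lim_{\delta\to0^+}\int_{\gamma(\delta,c)}e^{-it\lambda}\lambda^{\nu_j}\log^k(b_{j,k}\lambda)\,d\lambda$$ exists, and there is a constant $C$ such that for every $f\in\mathcal D^p$ with $\chi f=f$ the function $u(t)=\frac{\sin (t\sqrt P)}{\sqrt P}f$ satisfies, for all $t\ge 0$, $$\chi u(t)=\chi u_d(t)+w_z(t)+w_r(t),$$ where 1. $u_d(t)=\sum_{\ell=1}^{N}\frac{\sinh(\sqrt{-E_\ell}\,t)}{\sqrt{-E_\ell}}\,\Pi_\ell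 f$; 2. $w_z(t)=\frac1{2\pi}\sum_{j,k}J_{j,k}(t)\,\chi A_{j,k}\chi f$, where the (unordered) sum converges in $\mathcal D^q$, uniformly for $t\in[0,\infty)$; 3. $\|w_r(t)\|_{\mathcal D^q}\le C e^{-ct}\|f\|_{\mathcal D^p}$ for all $t\ge0$. (The functions $w_z$ and $w_r$ are the cut-off zero-energy part $\chi u_z$ and the cut-off remainder $\chi u_r$.) -/

import Mathlib

open scoped ENNReal

namespace WaveExpansion

noncomputable section

variable {H : Type*} [NormedAddCommGroup H] [InnerProductSpace ℂ H]

/-! ### Unbounded operators: resolvent, spectrum, eigenspaces -/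

/-- The bounded operator `T` is a two-sided inverse `(P - z)⁻¹` of `P - z : dom P → H`. -/
def IsResolventAt (P : H →ₗ.[ℂ] H) (z : ℂ) (T : H →L[ℂ] H) : Prop :=
  (∀ x : H, ∃ h : T x ∈ P.domain, P ⟨T x, h⟩ - z • T x = x) ∧
    ∀ y : P.domain, T (P y - z • (y : H)) = y

/-- The spectrum of an unbounded operator: all `z` such that `P - z` has no bounded inverse. -/
def unboundedSpectrum (P : H →ₗ.[ℂ] H) : Set ℂ :=
  {z | ¬ ∃ T : H →L[ℂ] H, IsResolventAt P z T}

open Classical in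
/-- The operator `(P - z)⁻¹` (by convention `0` if `z` lies in the spectrum). -/
def resolventOp (P : H →ₗ.[ℂ] H) (z : ℂ) : H →L[ℂ] H :=
  if h : ∃ T : H →L[ℂ] H, IsResolventAt P z T then h.choose else 0

/-- The inverse of `P - z` is unique. -/
theorem IsResolventAt.unique {P : H →ₗ.[ℂ] H} {z : ℂ} {S T : H →L[ℂ] H}
    (hS : IsResolventAt P z S) (hT : IsResolventAt P z T) : S = T := by
  ext x
  obtain ⟨h, hx⟩ := hT.1 x
  have := hS.2 ⟨T x, h⟩
  simpa [hx] using this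

theorem resolventOp_eq {P : H →ₗ.[ℂ] H} {z : ℂ} {T : H →L[ℂ] H}
    (hT : IsResolventAt P z T) : resolventOp P z = T := by
  have h : ∃ T : H →L[ℂ] H, IsResolventAt P z T := ⟨T, hT⟩
  unfold resolventOp
  rw [dif_pos h]
  exact h.choose_spec.unique hT

/-- The spectral parameter is `λ²`: `R(λ) = (P - λ²)⁻¹`. -/
def waveResolvent (P : H →ₗ.[ℂ] H) (l : ℂ) : H →L[ℂ] H :=
  resolventOp P (l ^ 2)

/-- The eigenspace `ker (P - E)`. -/
def eigenspaceOf (P : H →ₗ.[ℂ] H) (E : ℝ) : Submodule ℂ H where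
  carrier := {x | ∃ h : x ∈ P.domain, P ⟨x, h⟩ = (E : ℂ) • x}
  zero_mem' := by
    refine ⟨P.domain.zero_mem, ?_⟩
    rw [smul_zero]
    exact P.map_zero
  add_mem' := by
    rintro x y ⟨hx, ex⟩ ⟨hy, ey⟩
    refine ⟨P.domain.add_mem hx hy, ?_⟩
    have := P.map_add ⟨x, hx⟩ ⟨y, hy⟩
    rw [ex, ey, ← smul_add] at this
    exact this
  smul_mem' := by
    rintro a x ⟨hx, ex⟩
    refine ⟨P.domain.smul_mem a hx, ?_⟩
    have := P.map_smul a ⟨x, hx⟩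
    rw [ex, smul_comm] at this
    exact this

variable [CompleteSpace H]

/-- The orthogonal projection onto the eigenspace `ker (P - E)`.  (For a closed operator, in
particular for a self-adjoint one, the eigenspace is closed, and the closure changes nothing.) -/
def eigenProjection (P : H →ₗ.[ℂ] H) (E : ℝ) : H →L[ℂ] H :=
  (eigenspaceOf P E).topologicalClosure.starProjection

/-! ### Functional calculus -/

/-- `g(P)` for a self-adjoint `P` and a function `g` that is continuous on the spectrum of `P` and
tends to `0` at infinity along it: the continuous functional calculus of the bounded normal
operator `(P + i)⁻¹` is applied to the function which sends `(x + i)⁻¹` to `g x` and `0` to `0`. -/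
def funcCalc (P : H →ₗ.[ℂ] H) (g : ℝ → ℝ) : H →L[ℂ] H :=
  cfc (fun z : ℂ => if z = 0 then 0 else ((g (z⁻¹).re : ℝ) : ℂ)) (resolventOp P (-Complex.I))

/-- The continuous function `x ↦ sin (t √x) / √x` on the real line: it is `t` at `x = 0` and
`sinh (t √(-x)) / √(-x)` for `x < 0`. -/
def waveSymbol (t x : ℝ) : ℝ :=
  if 0 < x then Real.sin (t * √x) / √x
  else if x = 0 then t
  else Real.sinh (t * √(-x)) / √(-x)

/-- The wave propagator `sin (t √P) / √P` of a self-adjoint operator that is bounded below. -/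
def wavePropagator (P : H →ₗ.[ℂ] H) (t : ℝ) : H →L[ℂ] H :=
  funcCalc P (waveSymbol t)

/-- `(P + i)⁻ˢ`, for `s ≥ 0` and `P` self-adjoint. -/
def negPow (P : H →ₗ.[ℂ] H) (s : ℝ) : H →L[ℂ] H :=
  cfc (fun z : ℂ => z ^ (s : ℂ)) (resolventOp P (-Complex.I))

/-- The space `𝒟ˢ = (P + i)⁻ˢ H`. -/
def domPow (P : H →ₗ.[ℂ] H) (s : ℝ) : Submodule ℂ H :=
  LinearMap.range (negPow P s : H →ₗ[ℂ] H)

/-- The norm of `𝒟ˢ`: it is `‖v‖` if `u = (P + i)⁻ˢ v`, and `∞` if `u` is not in `𝒟ˢ`. (The `v` is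
unique, since `(P + i)⁻ˢ` is injective.) -/
def domNorm (P : H →ₗ.[ℂ] H) (s : ℝ) (u : H) : ℝ≥0∞ :=
  ⨅ (v : H) (_ : negPow P s v = u), ‖v‖ₑ

/-- The norm of a linear map as an operator `𝒟ᵖ → 𝒟^q`; it is `∞` if the map is unbounded or does
not take values in `𝒟^q`. -/
def domOpNorm (P : H →ₗ.[ℂ] H) (p q : ℝ) (T : domPow P p →ₗ[ℂ] H) : ℝ≥0∞ :=
  ⨆ (f : domPow P p) (_ : domNorm P p f ≤ 1), domNorm P q (T f)

/-- Restriction of a bounded operator on `H` to `𝒟ᵖ`. -/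
def restrictDom (P : H →ₗ.[ℂ] H) (p : ℝ) (T : H →L[ℂ] H) : domPow P p →ₗ[ℂ] H :=
  (T : H →ₗ[ℂ] H) ∘ₗ (domPow P p).subtype

/-! ### Branches and contours -/

/-- The branch of `log λ` with `arg λ ∈ (-π/2, 3π/2)`, i.e. with a cut along `-i[0,∞)`. -/
def logCutDown (l : ℂ) : ℂ :=
  Complex.log (-Complex.I * l) + (Real.pi / 2 : ℝ) * Complex.I

/-- The branch of `log b` with `arg b ∈ (-3π/2, π/2)`, i.e. with a cut along `i[0,∞)`. -/
def logCutUp (b : ℂ) : ℂ :=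
  Complex.log (Complex.I * b) - (Real.pi / 2 : ℝ) * Complex.I

/-- `log (b λ) = log b + log λ`; it can vanish only at `λ = 1 / b`, which is not on the cut. -/
def logProd (b l : ℂ) : ℂ := logCutUp b + logCutDown l

/-- The function `λ^ν (log (b λ))^k` on `arg λ ∈ (-π/2, 3π/2)`. -/
def powLog (ν : ℝ) (b : ℂ) (k : ℤ) (l : ℂ) : ℂ :=
  Complex.exp ((ν : ℂ) * logCutDown l) * logProd b l ^ k

/-- The square `|Re λ|, |Im λ| < c₀` without the cut `-i[0,∞)`. -/
def cutSquare (c₀ : ℝ) : Set ℂ :=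
  {l | |l.re| < c₀ ∧ |l.im| < c₀ ∧ ¬ (l.re = 0 ∧ l.im ≤ 0)}

/-- The integral of `g` over the contour `γ(δ, c)`, which goes around the cut from left to right:
up from `-δ - ic` to `-δ`, along the upper half of the circle `|λ| = δ` from `-δ` to `δ`, and down
from `δ` to `δ - ic`. -/
def contourIntegral (δ c : ℝ) (g : ℂ → ℂ) : ℂ :=
  (∫ y in (-c)..0, g (-(δ : ℂ) + y * Complex.I) * Complex.I) +
  (∫ θ in Real.pi..0, g (δ * Complex.exp (θ * Complex.I)) *
      (Complex.I * (δ * Complex.exp (θ * Complex.I)))) +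
  ∫ y in (0 : ℝ)..(-c), g ((δ : ℂ) + y * Complex.I) * Complex.I

/-- The contribution of the negative eigenvalues to the solution of the wave equation. -/
def discretePart (P : H →ₗ.[ℂ] H) {N : ℕ} (E : Fin N → ℝ) (t : ℝ) (f : H) : H :=
  ∑ l : Fin N, ((Real.sinh (√(-E l) * t) / √(-E l) : ℝ) : ℂ) • eigenProjection P (E l) f

end

end WaveExpansion

open WaveExpansion

/-!
The resolvent `R(λ) = (P - λ²)⁻¹` is the Fourier-Laplace transform of the wave propagator, so the
propagator is recovered from `χ R(λ) χ` by inverting that transform along a horizontal line and then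
moving the line.

*Inversion.* By the functional calculus of `(P + i)⁻¹`, the propagator is
`S₊(t) = sin (t √P₊) / √P₊` up to multiples of the projections `Π_ℓ`, which are themselves the
functional calculus of indicator functions of isolated points (`SpectralData.cfc_pointInd`).
Integrating `∫₀^∞ e^{iλt} sin (at) / a dt = (a² - λ²)⁻¹` over the spectrum writes `R(λ)`, on each
line `Im λ = s > 0` that avoids the `√(-E_ℓ)`, as the transform of an explicit continuous
`lineTransform P E s`, in which an eigenvalue above the line enters through the Green function
`-e^{-κ|t|} / (2κ)` and one below it through `sinh (κ t₊) / κ`, `κ = √(-E_ℓ)`. Fourier inversion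
(`SpectralData.integral_line_eq`) gives
`(2π)⁻¹ ∫_{Im λ = s} e^{-itλ} χ R(λ) f dλ = χ (lineTransform P E s t) f`.

*Decomposition.* Compare the line integrals at height `δ`, below all `√(-E_ℓ)`, with the propagator:
for `t ≥ 0` they differ by `Σ e^{κt} / (2κ) χ Π_ℓ f`, which is `χ u_d` plus
`Σ e^{-κt} / (2κ) χ Π_ℓ f`. The last sum is, up to sign, the line integral at time `-t` over
`Im λ = s` with `c < s < c₀`: only the eigenvalues with `κ > s` contribute to that integral, and
those with `κ < c₀` do not occur at all, because the low energy expansion keeps `χ R(λ) f` bounded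
near `iκ` and so forces the residue `χ Π_ℓ f` to vanish
(`CutoffResolvent.apply_eigenProjection_eq_zero`). Since `e^{-ts} ≤ e^{-ct}`, it belongs to the
remainder. This is `CutoffResolvent.apply_wavePropagator_eq`.

*Contour shift.* By Cauchy's theorem and the decay at high energy, the integral over `Im λ = δ` is
the integral over `Im λ = -c`, which is `O(e^{-ct})`, plus the limit of the integrals over `γ(δ, c)`
(`CutoffResolvent.tendsto_contourIntegral_matrixElement`). On `γ(δ, c)` the expansion converges
uniformly and the contours have bounded length, so that the limit may be taken term by term. The
integrals converge for each term because `γ(δ, c)` can be replaced by a contour in which only the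
part on `Im λ = -c` depends on `δ` (`exists_tendsto_contourIntegral`).

*Norms.* The norm of `𝒟^q` takes values in `[0, ∞]` and comes with no measurability in `λ`. All
estimates in it are therefore made by duality: `‖u‖ ≤ K` in `𝒟^q` if and only if
`|⟪g, u⟫| ≤ K ‖A* g‖` for all `g`, where `A = (P + i)^{-q}` (`domNorm_le_of_inner_le`,
`norm_inner_le_of_domNorm`). This reduces every limit and every contour deformation to scalar
functions.
-/

namespace WaveExpansion

/-! ### The norms of `𝒟ˢ` by duality -/

section DomainNorms
open ContinuousLinearMap
open scoped InnerProductSpace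

variable {H : Type*} [NormedAddCommGroup H] [InnerProductSpace ℂ H] [CompleteSpace H]

/-- Solvability of `A v = u` with a bound on `v` (Douglas): the functional `A* g ↦ ⟪u, g⟫` is
bounded by `K` on the range of `A*`, and `v` represents a norm-preserving extension of it. -/
theorem exists_preimage_of_inner_le (A : H →L[ℂ] H) {u : H} {K : ℝ} (hK : 0 ≤ K)
    (h : ∀ g : H, ‖⟪g, u⟫_ℂ‖ ≤ K * ‖adjoint A g‖) : ∃ v : H, ‖v‖ ≤ K ∧ A v = u := by
  have hwd : ∀ g g' : H, adjoint A g = adjoint A g' → ⟪u, g⟫_ℂ = ⟪u, g'⟫_ℂ := by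
    intro g g' hg
    have h1 := h (g - g')
    rw [map_sub, hg, sub_self, norm_zero, mul_zero, norm_le_zero_iff] at h1
    rw [← sub_eq_zero, ← inner_sub_right, inner_eq_zero_symm, h1]
  let S : Submodule ℂ H := LinearMap.range (adjoint A : H →ₗ[ℂ] H)
  choose r hr using fun x : S => LinearMap.mem_range.1 x.2
  let φ : S →ₗ[ℂ] ℂ :=
    { toFun := fun x => ⟪u, r x⟫_ℂ
      map_add' := fun x y => by
        rw [← inner_add_right]
        refine hwd _ _ ?_
        have h1 := hr x
        have h2 := hr y
        have h3 := hr (x + y)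
        simp only [coe_coe] at h1 h2 h3
        rw [map_add, h1, h2, h3, Submodule.coe_add]
      map_smul' := fun a x => by
        rw [RingHom.id_apply, smul_eq_mul, ← inner_smul_right]
        refine hwd _ _ ?_
        have h1 := hr x
        have h3 := hr (a • x)
        simp only [coe_coe] at h1 h3
        rw [map_smul, h1, h3, Submodule.coe_smul] }
  have hφ : ∀ x : S, ‖φ x‖ ≤ K * ‖x‖ := fun x => by
    have h1 := hr x
    simp only [coe_coe] at h1
    have h2 := h (r x)
    rw [h1, norm_inner_symm] at h2
    exact h2
  -- Hahn-Banach extends the functional to `H`, and the Riesz theorem turns it into a vector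
  obtain ⟨ψ, hψ, hψn⟩ := exists_extension_norm_eq S (φ.mkContinuous K hφ)
  refine ⟨(InnerProductSpace.toDual ℂ H).symm ψ, ?_, ?_⟩
  · rw [LinearIsometryEquiv.norm_map, hψn]
    exact LinearMap.mkContinuous_norm_le _ hK _
  · refine ext_inner_right ℂ fun g => ?_
    rw [← adjoint_inner_right, InnerProductSpace.toDual_symm_apply]
    have h1 := hψ ⟨adjoint A g, g, rfl⟩
    rw [h1]
    exact hwd _ _ (hr ⟨adjoint A g, g, rfl⟩)

/-- Together with `norm_inner_le_of_domNorm`, the dual description of the norm of `𝒟ˢ`. -/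
theorem domNorm_le_of_inner_le {P : H →ₗ.[ℂ] H} {s : ℝ} {u : H} {K : ℝ} (hK : 0 ≤ K)
    (h : ∀ g : H, ‖⟪g, u⟫_ℂ‖ ≤ K * ‖adjoint (negPow P s) g‖) :
    domNorm P s u ≤ ENNReal.ofReal K := by
  obtain ⟨v, hv, hvu⟩ := exists_preimage_of_inner_le (negPow P s) hK h
  refine (iInf₂_le v hvu).trans ?_
  rw [← ofReal_norm]
  exact ENNReal.ofReal_le_ofReal hv

theorem norm_inner_le_of_domNorm {P : H →ₗ.[ℂ] H} {s : ℝ} {u : H} {K : ℝ}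
    (h : domNorm P s u ≤ ENNReal.ofReal K) (g : H) (hK : 0 ≤ K) :
    ‖⟪g, u⟫_ℂ‖ ≤ K * ‖adjoint (negPow P s) g‖ := by
  have key : ∀ ε : ℝ, 0 < ε → ‖⟪g, u⟫_ℂ‖ ≤ (K + ε) * ‖adjoint (negPow P s) g‖ := by
    intro ε hε
    have h1 : domNorm P s u < ENNReal.ofReal (K + ε) :=
      h.trans_lt ((ENNReal.ofReal_lt_ofReal_iff (by linarith)).2 (by linarith))
    obtain ⟨v, hv⟩ := iInf_lt_iff.1 h1
    obtain ⟨hvu, hv⟩ := iInf_lt_iff.1 hv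
    rw [← ofReal_norm, ENNReal.ofReal_lt_ofReal_iff (by linarith)] at hv
    rw [← hvu, ← adjoint_inner_left, mul_comm]
    exact (norm_inner_le_norm _ _).trans (mul_le_mul_of_nonneg_left hv.le (norm_nonneg _))
  refine le_of_forall_pos_le_add fun ε hε => ?_
  have h0 : 0 ≤ ‖adjoint (negPow P s) g‖ := norm_nonneg _
  refine (key (ε / (‖adjoint (negPow P s) g‖ + 1)) (by positivity)).trans ?_
  rw [add_mul, div_mul_eq_mul_div]
  gcongr
  rw [div_le_iff₀ (by positivity)]
  nlinarith

/-- The dual bound in `ℝ≥0∞`. The summand `η` excludes the product `∞ * 0`, which is `0`, when `u`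
is not in `𝒟ˢ` and `adjoint (negPow P s) g = 0`. -/
theorem enorm_inner_le_domNorm {P : H →ₗ.[ℂ] H} {s : ℝ} (u g : H) {η : ℝ≥0∞} (hη : η ≠ 0) :
    ‖⟪g, u⟫_ℂ‖ₑ ≤ domNorm P s u * (‖adjoint (negPow P s) g‖ₑ + η) := by
  by_cases h : domNorm P s u = ⊤
  · rw [h, ENNReal.top_mul (by simp [hη])]
    exact le_top
  have := norm_inner_le_of_domNorm (K := (domNorm P s u).toReal)
    (by rw [ENNReal.ofReal_toReal h]) g ENNReal.toReal_nonneg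
  refine le_trans ?_ (mul_le_mul_right le_self_add _)
  rw [← ofReal_norm, ← ofReal_norm]
  refine (ENNReal.ofReal_le_ofReal this).trans_eq ?_
  rw [ENNReal.ofReal_mul ENNReal.toReal_nonneg, ENNReal.ofReal_toReal h]

theorem domNorm_ne_top_of_mem {P : H →ₗ.[ℂ] H} {s : ℝ} (f : domPow P s) :
    domNorm P s (f : H) ≠ ⊤ := by
  obtain ⟨v, hv⟩ := f.2
  exact ((iInf₂_le v hv).trans_lt enorm_lt_top).ne

theorem norm_le_of_domNorm {P : H →ₗ.[ℂ] H} {s : ℝ} {u : H} {K : ℝ} (hK : 0 ≤ K)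
    (h : domNorm P s u ≤ ENNReal.ofReal K) : ‖u‖ ≤ ‖negPow P s‖ * K := by
  rcases (norm_nonneg u).eq_or_lt with h0 | h0
  · rw [← h0]; positivity
  have h1 := norm_inner_le_of_domNorm h u hK
  have h2 := (adjoint (negPow P s)).le_opNorm u
  rw [LinearIsometryEquiv.norm_map] at h2
  rw [inner_self_eq_norm_sq_to_K, norm_pow, RCLike.norm_ofReal, abs_norm] at h1
  have h3 : K * ‖adjoint (negPow P s) u‖ ≤ K * (‖negPow P s‖ * ‖u‖) := by gcongr
  nlinarith

theorem enorm_le_domNorm (P : H →ₗ.[ℂ] H) (s : ℝ) (u : H) :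
    ‖u‖ₑ ≤ (‖negPow P s‖ₑ + 1) * domNorm P s u := by
  by_cases h : domNorm P s u = ⊤
  · rw [h, ENNReal.mul_top (by simp)]
    exact le_top
  have h1 := norm_le_of_domNorm ENNReal.toReal_nonneg (ENNReal.ofReal_toReal h).ge
  refine le_trans ?_ (mul_le_mul_left le_self_add _)
  rw [← ofReal_norm, ← ofReal_norm]
  refine (ENNReal.ofReal_le_ofReal h1).trans_eq ?_
  rw [ENNReal.ofReal_mul (norm_nonneg _), ENNReal.ofReal_toReal h]

theorem eq_zero_of_domNorm_eq_zero {P : H →ₗ.[ℂ] H} {s : ℝ} {u : H} (h : domNorm P s u = 0) :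
    u = 0 := by
  have := norm_inner_le_of_domNorm (K := 0) (h.le.trans zero_le) u le_rfl
  simpa using this

theorem domNorm_smul_le (P : H →ₗ.[ℂ] H) (s : ℝ) {a : ℂ} (ha : a ≠ 0) (u : H) :
    domNorm P s (a • u) ≤ ‖a‖ₑ * domNorm P s u := by
  by_cases h : domNorm P s u = ⊤
  · rw [h, ENNReal.mul_top (by simpa using ha)]
    exact le_top
  have h1 : domNorm P s (a • u) ≤ ENNReal.ofReal (‖a‖ * (domNorm P s u).toReal) := by
    refine domNorm_le_of_inner_le (by positivity) fun g => ?_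
    rw [inner_smul_right, norm_mul, mul_assoc]
    gcongr
    exact norm_inner_le_of_domNorm (by rw [ENNReal.ofReal_toReal h]) g ENNReal.toReal_nonneg
  rwa [ENNReal.ofReal_mul (norm_nonneg _), ofReal_norm, ENNReal.ofReal_toReal h] at h1

theorem domNorm_apply_le (P : H →ₗ.[ℂ] H) (p q : ℝ) (T : domPow P p →ₗ[ℂ] H) (f : domPow P p) :
    domNorm P q (T f) ≤ domOpNorm P p q T * domNorm P p f := by
  have hf := domNorm_ne_top_of_mem f
  by_cases h0 : domNorm P p (f : H) = 0
  · have : f = 0 := Subtype.ext (eq_zero_of_domNorm_eq_zero h0)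
    have h2 : domNorm P q (T f) ≤ 0 := by
      rw [this, map_zero]
      exact (iInf₂_le (f := fun (v : H) (_ : negPow P q v = 0) => ‖v‖ₑ) 0
        (map_zero _)).trans_eq enorm_zero
    exact h2.trans zero_le
  by_cases hT : domOpNorm P p q T = ⊤
  · rw [hT, ENNReal.top_mul h0]
    exact le_top
  set r := (domNorm P p (f : H)).toReal with hr
  have hr0 : 0 < r := ENNReal.toReal_pos h0 hf
  have hrf : domNorm P p (f : H) = ENNReal.ofReal r := (ENNReal.ofReal_toReal hf).symm
  have h1 : domNorm P p (((r⁻¹ : ℂ) • f : domPow P p) : H) ≤ 1 := by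
    refine (domNorm_smul_le P p (by simpa using hr0.ne') _).trans ?_
    rw [hrf, ← ofReal_norm, ← ENNReal.ofReal_mul (norm_nonneg _), norm_inv, Complex.norm_real,
      Real.norm_of_nonneg hr0.le, inv_mul_cancel₀ hr0.ne', ENNReal.ofReal_one]
  have h2 : domNorm P q (T ((r⁻¹ : ℂ) • f)) ≤ domOpNorm P p q T :=
    le_iSup₂ (f := fun (f : domPow P p) (_ : domNorm P p f ≤ 1) => domNorm P q (T f)) _ h1
  have h3 : T f = (r : ℂ) • T ((r⁻¹ : ℂ) • f) := by
    rw [← map_smul, smul_smul, mul_inv_cancel₀ (by exact_mod_cast hr0.ne'), one_smul]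
  rw [h3]
  refine (domNorm_smul_le P q (by exact_mod_cast hr0.ne') _).trans ?_
  rw [mul_comm, hrf, ← ofReal_norm]
  refine mul_le_mul' h2 (ENNReal.ofReal_le_ofReal ?_)
  simp [abs_of_pos hr0]

open MeasureTheory in
/-- Minkowski's inequality for the norm of `𝒟ˢ`, the integral being taken in `H`. The function
`x ↦ domNorm P s (φ x)` need not be measurable. -/
theorem domNorm_integral_le {P : H →ₗ.[ℂ] H} {s : ℝ} {φ : ℝ → H} (hφ : Integrable φ) {M : ℝ}
    (hM : 0 ≤ M) (h : ∫⁻ x, domNorm P s (φ x) ≤ ENNReal.ofReal M) :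
    domNorm P s (∫ x, φ x) ≤ ENNReal.ofReal M := by
  refine domNorm_le_of_inner_le hM fun g => ?_
  have key : ∀ η : ℝ, 0 < η → ‖⟪g, ∫ x, φ x⟫_ℂ‖ ≤ M * (‖adjoint (negPow P s) g‖ + η) := by
    intro η hη
    have h1 : ‖⟪g, ∫ x, φ x⟫_ℂ‖ₑ ≤
        ENNReal.ofReal M * (‖adjoint (negPow P s) g‖ₑ + ENNReal.ofReal η) := by
      rw [← integral_inner hφ]
      refine (enorm_integral_le_lintegral_enorm _).trans ?_
      refine (lintegral_mono fun x => enorm_inner_le_domNorm (P := P) (s := s) (φ x) g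
        (ENNReal.ofReal_pos.2 hη).ne').trans ?_
      rw [lintegral_mul_const' _ _ (by simp)]
      gcongr
    rw [← ofReal_norm, ← ofReal_norm, ← ENNReal.ofReal_add (norm_nonneg _) hη.le,
      ← ENNReal.ofReal_mul hM] at h1
    exact (ENNReal.ofReal_le_ofReal_iff (by positivity)).1 h1
  refine le_of_forall_pos_le_add fun ε hε => ?_
  refine (key (ε / (M + 1)) (by positivity)).trans ?_
  rw [mul_add, mul_div_assoc']
  gcongr
  rw [div_le_iff₀ (by positivity)]
  nlinarith

open MeasureTheory Set in
/-- Removing a neighbourhood of `0` and letting it shrink loses nothing. The function is arbitrary: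
monotone convergence in the domain of integration needs no measurability of the integrand. -/
theorem lintegral_le_iSup_setLIntegral (φ : ℝ → ℝ≥0∞) :
    ∫⁻ x, φ x ≤ ⨆ (ε : ℝ) (_ : 0 < ε), ∫⁻ x in {x : ℝ | ε < |x|}, φ x := by
  have hU : (⋃ n : ℕ, {x : ℝ | 1 / ((n : ℝ) + 1) < |x|}) = {0}ᶜ := by
    ext x
    simp only [mem_iUnion, mem_ofPred_eq, mem_compl_iff, mem_singleton_iff]
    constructor
    · rintro ⟨n, hn⟩ rfl
      rw [abs_zero] at hn
      exact absurd hn (not_lt.2 (by positivity))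
    · intro h
      exact exists_nat_one_div_lt (abs_pos.2 h)
  have hd : Directed (· ⊆ ·) fun n : ℕ => {x : ℝ | 1 / ((n : ℝ) + 1) < |x|} := by
    refine Monotone.directed_le fun m n hmn x hx => ?_
    rw [mem_ofPred_eq] at hx ⊢
    refine lt_of_le_of_lt ?_ hx
    have : (m : ℝ) ≤ n := by exact_mod_cast hmn
    gcongr
  have h1 : ∫⁻ x, φ x = ∫⁻ x in ({0}ᶜ : Set ℝ), φ x := by
    rw [restrict_compl_singleton]
  rw [h1, ← hU, setLIntegral_iUnion_of_directed _ hd]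
  refine iSup_le fun n => ?_
  exact le_iSup₂ (f := fun (ε : ℝ) (_ : 0 < ε) => ∫⁻ x in {x : ℝ | ε < |x|}, φ x)
    (1 / ((n : ℝ) + 1)) (by positivity)

end DomainNorms

/-! ### Scalar Fourier-Laplace transforms -/

section Transforms
open Complex MeasureTheory Filter Topology Set

theorem hasDerivAt_mul_sinc (a t : ℝ) :
    HasDerivAt (fun t : ℝ => t * Real.sinc (t * a)) (Real.cos (t * a)) t := by
  by_cases ha : a = 0
  · subst ha
    simpa using hasDerivAt_id' t
  · have h : (fun t : ℝ => t * Real.sinc (t * a)) = fun t => Real.sin (t * a) / a := by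
      funext t
      by_cases ht : t = 0
      · simp [ht]
      · rw [Real.sinc_of_ne_zero (mul_ne_zero ht ha)]; field_simp
    rw [h]
    have := (((hasDerivAt_id t).mul_const a).sin).div_const a
    simpa [ha] using this

theorem mul_sq_mul_sinc (a t : ℝ) : a ^ 2 * (t * Real.sinc (t * a)) = a * Real.sin (t * a) := by
  by_cases ha : a = 0
  · simp [ha]
  by_cases ht : t = 0
  · simp [ht]
  rw [Real.sinc_of_ne_zero (mul_ne_zero ht ha)]; field_simp

theorem norm_exp_I_mul (l : ℂ) (t : ℝ) : ‖exp (I * l * t)‖ = Real.exp (-l.im * t) := by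
  rw [norm_exp]; simp

theorem abs_mul_sinc_le (a t : ℝ) : |t * Real.sinc (t * a)| ≤ |t| := by
  rw [abs_mul]
  exact mul_le_of_le_one_right (abs_nonneg _) (Real.abs_sinc_le_one _)

theorem integrableOn_mul_exp_neg {s : ℝ} (hs : 0 < s) :
    IntegrableOn (fun t : ℝ => t * Real.exp (-s * t)) (Ioi 0) := by
  have := integrableOn_rpow_mul_exp_neg_mul_rpow (s := 1) (p := 1) (by norm_num) one_pos hs
  simpa using this

theorem integrableOn_exp_mul_sinc {l : ℂ} (hl : 0 < l.im) (a : ℝ) :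
    IntegrableOn (fun t : ℝ => exp (I * l * t) * ((t * Real.sinc (t * a) : ℝ) : ℂ)) (Ioi 0) := by
  refine Integrable.mono' (integrableOn_mul_exp_neg hl) ?_ ?_
  · have : Continuous fun t : ℝ => t * Real.sinc (t * a) :=
      continuous_id.mul (Real.continuous_sinc.comp (continuous_mul_const a))
    exact Continuous.aestronglyMeasurable (by fun_prop)
  · refine ae_restrict_of_forall_mem measurableSet_Ioi fun t ht => ?_
    rw [norm_mul, norm_exp_I_mul, mul_comm, Complex.norm_real]
    gcongr
    exact (abs_mul_sinc_le a t).trans_eq (abs_of_pos ht)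

theorem sq_ofReal_sub_sq_ne_zero {l : ℂ} (hl : 0 < l.im) (a : ℝ) : ((a : ℂ) ^ 2 - l ^ 2) ≠ 0 := by
  intro h
  have h1 : ((a : ℂ) - l) * (a + l) = 0 := by linear_combination h
  rcases mul_eq_zero.1 h1 with h2 | h2
  all_goals
    have := congrArg Complex.im h2
    simp at this
    exact hl.ne' this

/-- The Laplace transform of `sin (at) / a`, written with `sinc` to include `a = 0`. -/
theorem integral_exp_mul_sinc {l : ℂ} (hl : 0 < l.im) (a : ℝ) :
    ∫ t in Ioi (0 : ℝ), exp (I * l * t) * ((t * Real.sinc (t * a) : ℝ) : ℂ) =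
      ((a : ℂ) ^ 2 - l ^ 2)⁻¹ := by
  have hne := sq_ofReal_sub_sq_ne_zero hl a
  have hne' : l ^ 2 - (a : ℂ) ^ 2 ≠ 0 := by rw [← neg_sub]; exact neg_ne_zero.2 hne
  -- an explicit primitive of the integrand
  set Φ : ℝ → ℂ := fun t => exp (I * l * t) *
    (-(I * l) * ((t * Real.sinc (t * a) : ℝ) : ℂ) + ((Real.cos (t * a) : ℝ) : ℂ)) /
      (l ^ 2 - (a : ℂ) ^ 2) with hΦ
  have hexp : ∀ t : ℝ, HasDerivAt (fun t : ℝ => exp (I * l * t)) (exp (I * l * t) * (I * l)) t := by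
    intro t
    have := (((hasDerivAt_id (t : ℂ)).const_mul (I * l)).cexp).comp_ofReal
    simpa using this
  have hder : ∀ t : ℝ, HasDerivAt Φ
      (exp (I * l * t) * ((t * Real.sinc (t * a) : ℝ) : ℂ)) t := by
    intro t
    have h1 := (hasDerivAt_mul_sinc a t).ofReal_comp
    have h2 : HasDerivAt (fun t : ℝ => ((Real.cos (t * a) : ℝ) : ℂ))
        (((-(a * Real.sin (t * a)) : ℝ)) : ℂ) t := by
      refine HasDerivAt.ofReal_comp ?_
      refine (((hasDerivAt_id t).mul_const a).cos).congr_deriv ?_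
      simp; ring
    have h3 := (((hexp t).mul ((h1.const_mul (-(I * l))).add h2)).div_const (l ^ 2 - (a : ℂ) ^ 2))
    refine h3.congr_deriv ?_
    rw [← mul_sq_mul_sinc, div_eq_iff hne']
    simp only [Pi.add_apply, ofReal_neg, ofReal_mul, ofReal_pow]
    linear_combination (-exp (I * l * t) * l ^ 2 * t * (Real.sinc (t * a) : ℝ)) * I_sq
  have hlim : Tendsto Φ atTop (𝓝 0) := by
    have hb : Tendsto (fun t : ℝ => (‖l‖ * (t * Real.exp (-l.im * t)) + Real.exp (-l.im * t)) /
        ‖l ^ 2 - (a : ℂ) ^ 2‖) atTop (𝓝 0) := by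
      have e1 : Tendsto (fun t : ℝ => t * Real.exp (-l.im * t)) atTop (𝓝 0) := by
        have := tendsto_rpow_mul_exp_neg_mul_atTop_nhds_zero 1 l.im hl
        simpa using this
      have e2 : Tendsto (fun t : ℝ => Real.exp (-l.im * t)) atTop (𝓝 0) := by
        have := tendsto_rpow_mul_exp_neg_mul_atTop_nhds_zero 0 l.im hl
        simpa using this
      simpa using ((e1.const_mul ‖l‖).add e2).div_const ‖l ^ 2 - (a : ℂ) ^ 2‖
    refine squeeze_zero_norm' ?_ hb
    filter_upwards [eventually_ge_atTop 0] with t ht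
    rw [hΦ]
    simp only [norm_div, norm_mul, norm_exp_I_mul]
    gcongr
    have h1 : ‖-(I * l) * ((t * Real.sinc (t * a) : ℝ) : ℂ) + ((Real.cos (t * a) : ℝ) : ℂ)‖ ≤
        ‖l‖ * t + 1 := by
      refine (norm_add_le _ _).trans (add_le_add ?_ ?_)
      · rw [norm_mul, norm_neg, norm_mul, norm_I, one_mul, Complex.norm_real]
        gcongr
        exact (abs_mul_sinc_le a t).trans_eq (abs_of_nonneg ht)
      · rw [Complex.norm_real]; exact Real.abs_cos_le_one _
    calc _ ≤ Real.exp (-l.im * t) * (‖l‖ * t + 1) := by gcongr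
      _ = _ := by ring
  have h := integral_Ioi_of_hasDerivAt_of_tendsto' (a := 0) (fun t _ => hder t)
    (integrableOn_exp_mul_sinc hl a) hlim
  rw [h, hΦ]
  simp
  rw [← inv_neg, neg_sub]

/-- The function `G` with `∫ e^{iλt} G(t) dt = (-κ² - λ²)⁻¹` on the line `Im λ = s`, `s > 0`,
`s ≠ κ`: the solution of `G'' = κ² G + δ₀` that decays in both directions if the line is below the
pole `iκ`, and that vanishes for `t < 0` if it is above. -/
noncomputable def greenFn (κ s t : ℝ) : ℝ :=
  if s < κ then -(Real.exp (-κ * |t|) / (2 * κ)) else Real.sinh (κ * max t 0) / κ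

theorem continuous_greenFn (κ s : ℝ) : Continuous (greenFn κ s) := by
  unfold greenFn
  split_ifs
  · fun_prop
  · exact (Real.continuous_sinh.comp (by fun_prop)).div_const _

theorem integrable_and_integral_exp_mul_greenFn {κ : ℝ} (hκ : 0 < κ) {l : ℂ} (hl : 0 < l.im)
    (hne : l.im ≠ κ) :
    Integrable (fun t : ℝ => exp (I * l * t) * (greenFn κ l.im t : ℂ)) ∧
      ∫ t : ℝ, exp (I * l * t) * (greenFn κ l.im t : ℂ) = (-(κ : ℂ) ^ 2 - l ^ 2)⁻¹ := by
  have hκ' : (κ : ℂ) ≠ 0 := by exact_mod_cast hκ.ne'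
  have hp : I * l + κ ≠ 0 := by
    intro h; have := congrArg Complex.re h; simp at this; apply hne; linarith
  have hm : I * l - κ ≠ 0 := by
    intro h; have := congrArg Complex.re h; simp at this; linarith
  have hden : -(κ : ℂ) ^ 2 - l ^ 2 = (I * l + κ) * (I * l - κ) := by
    linear_combination (-l ^ 2) * I_sq
  have rm : (I * l - κ).re < 0 := by simp; linarith
  have im := integrableOn_exp_mul_complex_Ioi rm 0
  have vm := integral_exp_mul_complex_Ioi rm 0
  simp only [ofReal_zero, mul_zero, exp_zero] at vm
  rw [hden]
  by_cases hs : l.im < κ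
  · have rp : 0 < (I * l + κ).re := by simp; linarith
    have ip := integrableOn_exp_mul_complex_Iic rp 0
    have vp := integral_exp_mul_complex_Iic rp 0
    simp only [ofReal_zero, mul_zero, exp_zero] at vp
    have e1 : EqOn (fun t : ℝ => (-(2 * κ : ℂ)⁻¹) * exp ((I * l + κ) * t))
        (fun t : ℝ => exp (I * l * t) * (greenFn κ l.im t : ℂ)) (Iic 0) := by
      intro t ht
      simp only [greenFn, if_pos hs, abs_of_nonpos (mem_Iic.1 ht)]
      push_cast
      rw [show (I * l + κ) * t = I * l * t + (-κ * -t) by ring, exp_add]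
      field_simp
    have e2 : EqOn (fun t : ℝ => (-(2 * κ : ℂ)⁻¹) * exp ((I * l - κ) * t))
        (fun t : ℝ => exp (I * l * t) * (greenFn κ l.im t : ℂ)) (Ioi 0) := by
      intro t ht
      simp only [greenFn, if_pos hs, abs_of_pos (mem_Ioi.1 ht)]
      push_cast
      rw [show (I * l - κ) * t = I * l * t + (-κ * t) by ring, exp_add]
      field_simp
    have i1 : IntegrableOn (fun t : ℝ => exp (I * l * t) * (greenFn κ l.im t : ℂ)) (Iic 0) :=
      IntegrableOn.congr_fun (ip.const_mul _) e1 measurableSet_Iic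
    have i2 : IntegrableOn (fun t : ℝ => exp (I * l * t) * (greenFn κ l.im t : ℂ)) (Ioi 0) :=
      IntegrableOn.congr_fun (im.const_mul _) e2 measurableSet_Ioi
    refine ⟨?_, ?_⟩
    · rw [← integrableOn_univ, ← Iic_union_Ioi (a := (0 : ℝ))]
      exact i1.union i2
    · rw [← intervalIntegral.integral_Iic_add_Ioi i1 i2,
        ← setIntegral_congr_fun measurableSet_Iic e1, ← setIntegral_congr_fun measurableSet_Ioi e2,
        integral_const_mul, integral_const_mul, vp, vm]
      field_simp
      ring
  · have rp : (I * l + κ).re < 0 := by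
      have := lt_of_le_of_ne (not_lt.1 hs) hne.symm
      simp; linarith
    have ip := integrableOn_exp_mul_complex_Ioi rp 0
    have vp := integral_exp_mul_complex_Ioi rp 0
    simp only [ofReal_zero, mul_zero, exp_zero] at vp
    have e2 : EqOn (fun t : ℝ => (2 * κ : ℂ)⁻¹ * (exp ((I * l + κ) * t) - exp ((I * l - κ) * t)))
        (fun t : ℝ => exp (I * l * t) * (greenFn κ l.im t : ℂ)) (Ioi 0) := by
      intro t ht
      simp only [greenFn, if_neg hs, max_eq_left (mem_Ioi.1 ht).le, Real.sinh_eq]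
      push_cast
      rw [show (I * l + κ) * t = I * l * t + (κ * t) by ring, exp_add,
        show (I * l - κ) * t = I * l * t + -(κ * t) by ring, exp_add]
      field_simp
    have e0 : ∀ t : ℝ, t ∉ Ioi (0 : ℝ) → exp (I * l * t) * (greenFn κ l.im t : ℂ) = 0 := by
      intro t ht
      simp only [greenFn, if_neg hs, max_eq_right (not_lt.1 (mt mem_Ioi.2 ht))]
      simp
    have i2 : IntegrableOn (fun t : ℝ => exp (I * l * t) * (greenFn κ l.im t : ℂ)) (Ioi 0) :=
      IntegrableOn.congr_fun ((ip.sub im).const_mul _) e2 measurableSet_Ioi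
    refine ⟨(integrableOn_iff_integrable_of_support_subset fun t ht => ?_).1 i2, ?_⟩
    · by_contra h; exact ht (e0 t h)
    · rw [← setIntegral_eq_integral_of_forall_compl_eq_zero e0,
        ← setIntegral_congr_fun measurableSet_Ioi e2, integral_const_mul, integral_sub ip im, vp, vm]
      field_simp
      ring

/-- Fourier inversion on the line, in the normalization `ĝ(y) = ∫ e^{iyt} g(t) dt`. -/
theorem eq_integral_of_fourier {g : ℝ → ℂ} {h : ℝ → ℂ} (hg : Continuous g) (hgi : Integrable g)
    (hh : Integrable h) (hgh : ∀ᵐ y : ℝ, ∫ t : ℝ, exp (I * y * t) * g t = h y) (t : ℝ) :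
    ∫ y : ℝ, exp (-I * t * y) * h y = 2 * Real.pi * g t := by
  set h' : ℝ → ℂ := fun y => ∫ t : ℝ, exp (I * y * t) * g t with hh'
  have hae : h' =ᵐ[volume] h := hgh
  have hF : FourierTransform.fourier g = fun ξ : ℝ => h' (ξ * (-(2 * Real.pi))) := by
    funext ξ
    rw [Real.fourier_real_eq_integral_exp_smul]
    congr 1; funext v
    rw [smul_eq_mul]
    congr 2; push_cast; ring
  have hpi : (-(2 * Real.pi)) ≠ 0 := by simp [Real.pi_ne_zero]
  have hi' : Integrable h' := hh.congr hae.symm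
  have hFi : Integrable (FourierTransform.fourier g) := by
    rw [hF]
    exact hi'.comp_mul_right' hpi
  have hinv := congrFun (hg.fourierInv_fourier_eq hgi hFi) t
  rw [Real.fourierInv_eq', hF] at hinv
  have hsub := Measure.integral_comp_mul_right (fun y : ℝ => exp (-I * t * y) * h' y)
    (-(2 * Real.pi))
  have e : (fun x : ℝ => exp (-I * t * ((x * (-(2 * Real.pi)) : ℝ) : ℂ)) * h' (x * (-(2 * Real.pi))))
      = fun v : ℝ => exp (((2 * Real.pi * inner ℝ v t : ℝ) : ℂ) * I) • h' (v * (-(2 * Real.pi))) := by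
    funext v
    rw [smul_eq_mul]
    congr 2
    simp
    ring
  rw [e, hinv] at hsub
  have h2 : ∫ y : ℝ, exp (-I * t * y) * h y = ∫ y : ℝ, exp (-I * t * y) * h' y := by
    refine integral_congr_ae ?_
    filter_upwards [hae] with y hy
    rw [hy]
  rw [h2, hsub, abs_inv, abs_neg, abs_of_pos Real.two_pi_pos, real_smul]
  push_cast
  have : (Real.pi : ℂ) ≠ 0 := by exact_mod_cast Real.pi_ne_zero
  field_simp

end Transforms

/-! ### Resolvent identities -/

section Spectral
open Complex Filter Topology Set
open scoped InnerProductSpace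

variable {H : Type*} [NormedAddCommGroup H] [InnerProductSpace ℂ H]

theorem resolventOp_spec {P : H →ₗ.[ℂ] H} {z : ℂ} (hz : z ∉ unboundedSpectrum P) :
    IsResolventAt P z (resolventOp P z) := by
  have h : ∃ T : H →L[ℂ] H, IsResolventAt P z T := by
    by_contra h; exact hz h
  obtain ⟨T, hT⟩ := h
  rwa [resolventOp_eq hT]

theorem IsResolventAt.sub_eq {P : H →ₗ.[ℂ] H} {z w : ℂ} {S T : H →L[ℂ] H}
    (hS : IsResolventAt P z S) (hT : IsResolventAt P w T) : S - T = (z - w) • (S * T) := by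
  ext x
  obtain ⟨h, hx⟩ := hT.1 x
  have h1 := hS.2 ⟨T x, h⟩
  have h2 : P ⟨T x, h⟩ - z • T x = x - (z - w) • T x := by
    rw [sub_eq_iff_eq_add.1 hx]
    module
  rw [h2, map_sub, map_smul] at h1
  change S x - T x = (z - w) • S (T x)
  change S x - (z - w) • S (T x) = T x at h1
  rw [sub_eq_iff_eq_add.1 h1, add_sub_cancel_left]

theorem IsResolventAt.mul_comm {P : H →ₗ.[ℂ] H} {z w : ℂ} {S T : H →L[ℂ] H}
    (hS : IsResolventAt P z S) (hT : IsResolventAt P w T) : S * T = T * S := by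
  by_cases h : z = w
  · subst h; rw [hS.unique hT]
  · have h1 := hS.sub_eq hT
    have h2 := hT.sub_eq hS
    have h3 : (z - w) • (S * T) = (z - w) • (T * S) := by
      rw [← h1, ← neg_sub T S, h2, ← neg_smul, neg_sub]
    exact smul_right_injective _ (sub_ne_zero.2 h) h3

/-- The bounded operator `1 - (z + i)(P + i)⁻¹ = (P - z)(P + i)⁻¹` has inverse
`1 + (z + i)(P - z)⁻¹`. -/
theorem one_sub_mul_one_add {P : H →ₗ.[ℂ] H} {z : ℂ} {R T : H →L[ℂ] H}
    (hR : IsResolventAt P z R) (hT : IsResolventAt P (-I) T) :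
    (1 - (z + I) • T) * (1 + (z + I) • R) = 1 ∧ (1 + (z + I) • R) * (1 - (z + I) • T) = 1 := by
  have h1 := hR.sub_eq hT
  have h2 := hR.mul_comm hT
  rw [sub_neg_eq_add] at h1
  have h3 : R = T + (z + I) • (R * T) := by rw [← h1]; abel
  constructor
  · have : (1 - (z + I) • T) * (1 + (z + I) • R) =
      1 + (z + I) • (R - T - (z + I) • (T * R)) := by
      simp only [sub_mul, mul_add, one_mul, mul_one, smul_mul_assoc, mul_smul_comm, smul_sub]
      abel
    rw [this, ← h2, h1]; simp
  · have : (1 + (z + I) • R) * (1 - (z + I) • T) =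
      1 + (z + I) • (R - T - (z + I) • (R * T)) := by
      simp only [mul_sub, add_mul, one_mul, mul_one, smul_mul_assoc, mul_smul_comm, smul_sub,
        smul_add]
      abel
    rw [this, h1]; simp

/-- The relation `R (P - z)(P + i)⁻¹ = (P + i)⁻¹`, stated for bounded operators. -/
theorem mul_one_sub_eq {P : H →ₗ.[ℂ] H} {z : ℂ} {R T : H →L[ℂ] H}
    (hR : IsResolventAt P z R) (hT : IsResolventAt P (-I) T) : R * (1 - (z + I) • T) = T := by
  have h1 := hR.sub_eq hT
  rw [sub_neg_eq_add] at h1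
  rw [mul_sub, mul_one, mul_smul_comm, ← h1, sub_sub_cancel]

/-- Spectral mapping for `x ↦ (x + i)⁻¹`: nonzero spectrum of `(P + i)⁻¹` comes from the
spectrum of `P`. -/
theorem inv_sub_I_mem_of_mem_spectrum {P : H →ₗ.[ℂ] H} (hI : -I ∉ unboundedSpectrum P) {w : ℂ}
    (hw : w ∈ spectrum ℂ (resolventOp P (-I))) (hw0 : w ≠ 0) : w⁻¹ - I ∈ unboundedSpectrum P := by
  by_contra h
  obtain ⟨h1, h2⟩ := one_sub_mul_one_add (resolventOp_spec h) (resolventOp_spec hI)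
  rw [sub_add_cancel] at h1 h2
  refine hw ?_
  have hu : IsUnit (1 - w⁻¹ • resolventOp P (-I)) := ⟨⟨_, _, h1, h2⟩, rfl⟩
  have h3 : algebraMap ℂ (H →L[ℂ] H) w - resolventOp P (-I) =
      w • (1 - w⁻¹ • resolventOp P (-I)) := by
    rw [smul_sub, smul_smul, mul_inv_cancel₀ hw0, one_smul, Algebra.algebraMap_eq_smul_one]
  rw [spectrum.mem_resolventSet_iff, h3]
  exact hu.smul (Units.mk0 w hw0)

variable [CompleteSpace H]

theorem inner_apply_eq_of_isSelfAdjoint {P : H →ₗ.[ℂ] H} (hP : IsSelfAdjoint P) (a b : P.domain) :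
    ⟪P a, (b : H)⟫_ℂ = ⟪(a : H), P b⟫_ℂ := by
  have h := LinearPMap.adjoint_isFormalAdjoint hP.dense_domain
  have h2 : LinearPMap.adjoint P = P := hP
  rw [h2] at h
  exact h a b

theorem IsResolventAt.adjoint_eq {P : H →ₗ.[ℂ] H} (hP : IsSelfAdjoint P) {z : ℂ}
    {S T : H →L[ℂ] H} (hS : IsResolventAt P z S) (hT : IsResolventAt P (starRingEnd ℂ z) T) :
    star S = T := by
  rw [ContinuousLinearMap.star_eq_adjoint, eq_comm, ContinuousLinearMap.eq_adjoint_iff]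
  intro y x
  obtain ⟨ha, hx⟩ := hS.1 x
  obtain ⟨hb, hy⟩ := hT.1 y
  have h := inner_apply_eq_of_isSelfAdjoint hP ⟨T y, hb⟩ ⟨S x, ha⟩
  simp only at h
  nth_rw 1 [← hx]
  nth_rw 2 [← hy]
  rw [inner_sub_right, inner_sub_left, inner_smul_right, inner_smul_left, h]
  simp

theorem isStarNormal_resolventOp {P : H →ₗ.[ℂ] H} (hP : IsSelfAdjoint P)
    (hI : -I ∉ unboundedSpectrum P) (hI' : I ∉ unboundedSpectrum P) :
    IsStarNormal (resolventOp P (-I)) := by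
  have h1 := resolventOp_spec hI
  have h2 := resolventOp_spec hI'
  have h3 := h1.adjoint_eq hP (T := resolventOp P I) (by simpa using h2)
  refine ⟨?_⟩
  rw [h3]
  exact h2.mul_comm h1

end Spectral

/-! ### Spectral projections and resolvents in the functional calculus -/

section Spectral
open Complex Filter Topology Set MeasureTheory
open scoped InnerProductSpace

/-- At an isolated point `e` of `σ`, continuity on `σ` is automatic. -/
theorem continuousOn_of_eventually_eq {σ : Set ℂ} {e : ℂ} (he : ∀ᶠ w in 𝓝[σ] e, w = e) {f : ℂ → ℂ}
    (hf : ∀ w ∈ σ, w ≠ e → ContinuousWithinAt f σ w) : ContinuousOn f σ := by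
  intro w hw
  by_cases h : w = e
  · subst h
    refine (continuousWithinAt_const (b := f w)).congr_of_eventuallyEq ?_ rfl
    filter_upwards [he] with x hx
    rw [hx]
  · exact hf w hw h

/-- The indicator function of the point `(x + i)⁻¹`. -/
noncomputable def pointInd (x : ℝ) (w : ℂ) : ℂ := if w = ((x : ℂ) + I)⁻¹ then 1 else 0

theorem pointInd_eventuallyEq {x : ℝ} {w : ℂ} (hw : w ≠ ((x : ℂ) + I)⁻¹) :
    pointInd x =ᶠ[𝓝 w] fun _ => 0 := by
  filter_upwards [isOpen_ne.mem_nhds hw] with z hz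
  exact if_neg hz

theorem ofReal_add_I_ne_zero (x : ℝ) : (x : ℂ) + I ≠ 0 := by
  intro h; simpa using congrArg Complex.im h

variable {H : Type*} [NormedAddCommGroup H] [InnerProductSpace ℂ H] [CompleteSpace H]

/-- Standing assumptions on the operator: it is self-adjoint, and its spectrum consists of the
half-line and the negative numbers `E l`. -/
structure SpectralData (P : H →ₗ.[ℂ] H) {N : ℕ} (E : Fin N → ℝ) : Prop where
  selfAdjoint : IsSelfAdjoint P
  injective : Function.Injective E
  neg : ∀ l, E l < 0
  spec : unboundedSpectrum P = (fun x : ℝ => (x : ℂ)) '' (Set.Ici 0 ∪ Set.range E)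

namespace SpectralData

variable {P : H →ₗ.[ℂ] H} {N : ℕ} {E : Fin N → ℝ} (D : SpectralData P E)
include D

theorem notMem_of_im_ne_zero {z : ℂ} (hz : z.im ≠ 0) : z ∉ unboundedSpectrum P := by
  rw [D.spec]
  rintro ⟨x, -, rfl⟩
  simp at hz

theorem isResolventAt_neg_I : IsResolventAt P (-I) (resolventOp P (-I)) :=
  resolventOp_spec (D.notMem_of_im_ne_zero (by simp))

theorem isStarNormal : IsStarNormal (resolventOp P (-I)) :=
  isStarNormal_resolventOp D.selfAdjoint (D.notMem_of_im_ne_zero (by simp))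
    (D.notMem_of_im_ne_zero (by simp))

theorem exists_of_mem_spectrum {w : ℂ} (hw : w ∈ spectrum ℂ (resolventOp P (-I))) (hw0 : w ≠ 0) :
    ∃ x ∈ Set.Ici 0 ∪ Set.range E, w = ((x : ℂ) + I)⁻¹ := by
  have h := inv_sub_I_mem_of_mem_spectrum (D.notMem_of_im_ne_zero (by simp)) hw hw0
  rw [D.spec] at h
  obtain ⟨x, hx, hxw⟩ := h
  refine ⟨x, hx, ?_⟩
  simp only at hxw
  rw [hxw, sub_add_cancel, inv_inv]

/-- The point `(E_ℓ + i)⁻¹` is isolated in the spectrum of `(P + i)⁻¹`. -/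
theorem eventually_eq (l : Fin N) :
    ∀ᶠ w in 𝓝[spectrum ℂ (resolventOp P (-I))] ((E l : ℂ) + I)⁻¹, w = ((E l : ℂ) + I)⁻¹ := by
  have hne := ofReal_add_I_ne_zero (E l)
  have hclosed : IsClosed (Set.Ici (0 : ℝ) ∪ (Set.range E \ {E l})) :=
    isClosed_Ici.union ((Set.finite_range E).subset Set.sdiff_subset).isClosed
  have hmem : E l ∈ (Set.Ici (0 : ℝ) ∪ (Set.range E \ {E l}))ᶜ := by
    simp [D.neg l]
  have hcont : ContinuousAt (fun w : ℂ => (w⁻¹).re) ((E l : ℂ) + I)⁻¹ :=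
    Complex.continuous_re.continuousAt.comp (continuousAt_inv₀ (inv_ne_zero hne))
  have hev : ∀ᶠ w in 𝓝 ((E l : ℂ) + I)⁻¹,
      (w⁻¹).re ∈ (Set.Ici (0 : ℝ) ∪ (Set.range E \ {E l}))ᶜ :=
    hcont.eventually_mem (hclosed.isOpen_compl.mem_nhds (by simpa using hmem))
  have hev0 : ∀ᶠ w in 𝓝 ((E l : ℂ) + I)⁻¹, w ≠ 0 := isOpen_ne.mem_nhds (inv_ne_zero hne)
  filter_upwards [nhdsWithin_le_nhds hev, nhdsWithin_le_nhds hev0, self_mem_nhdsWithin]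
    with w h1 h2 h3
  obtain ⟨x, hx, rfl⟩ := D.exists_of_mem_spectrum h3 h2
  have h4 : ((((x : ℂ) + I)⁻¹)⁻¹).re = x := by simp
  rw [h4] at h1
  rcases hx with hx | hx
  · exact absurd (Or.inl hx) h1
  · by_cases h5 : x = E l
    · rw [h5]
    · exact absurd (Or.inr ⟨hx, h5⟩) h1

theorem continuousOn_pointInd (l : Fin N) :
    ContinuousOn (pointInd (E l)) (spectrum ℂ (resolventOp P (-I))) :=
  continuousOn_of_eventually_eq (D.eventually_eq l) fun _ _ hne =>
    ((continuousAt_const (y := (0 : ℂ))).congr (pointInd_eventuallyEq hne).symm).continuousWithinAt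

/-- The eigenprojection is the functional calculus of the indicator function of an isolated point.
Its value `Q` is self-adjoint and has eigenvectors as range; the factorization of `1 - Q` through
`(P + i)⁻¹ - e` shows that `Q` fixes the eigenvectors. -/
theorem cfc_pointInd (l : Fin N) :
    cfc (pointInd (E l)) (resolventOp P (-I)) = eigenProjection P (E l) := by
  have hn := D.isStarNormal
  have hT := D.isResolventAt_neg_I
  have hcont := D.continuousOn_pointInd l
  set T := resolventOp P (-I) with hTdef
  set e : ℂ := ((E l : ℂ) + I)⁻¹ with he
  have he0 : (E l : ℂ) + I ≠ 0 := ofReal_add_I_ne_zero (E l)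
  set Q := cfc (pointInd (E l)) T with hQ
  -- the range of `Q` consists of eigenvectors
  have hTQ : T * Q = e • Q := by
    have h1 : T * Q = cfc (fun w => w * pointInd (E l) w) T := by
      rw [cfc_mul (fun w => w) (pointInd (E l)) T continuousOn_id hcont, cfc_id' ℂ T]
    rw [h1, hQ, ← cfc_const_mul e _ T hcont]
    refine cfc_congr fun w _ => ?_
    simp only [pointInd, ← he]
    split_ifs with h
    · rw [h]
    · simp
  have hQstar : star Q = Q := by
    rw [hQ, ← cfc_star]
    refine cfc_congr fun w _ => ?_
    simp only [pointInd]
    split_ifs <;> simp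
  -- `1 - Q` is a multiple of `T - e`
  have hQ1 : ∀ v, T v = e • v → Q v = v := by
    set h : ℂ → ℂ := fun w => (1 - pointInd (E l) w) / (w - e) with hh
    have hhc : ContinuousOn h (spectrum ℂ T) := by
      refine continuousOn_of_eventually_eq (D.eventually_eq l) fun w hw hne => ?_
      refine ContinuousWithinAt.div (continuousWithinAt_const.sub (hcont w hw))
        (by fun_prop) (sub_ne_zero.2 hne)
    have h1 : cfc (fun w => h w * (w - e)) T = cfc h T * (T - algebraMap ℂ _ e) := by
      rw [cfc_mul h (fun w => w - e) T hhc (by fun_prop),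
        cfc_sub (fun w => w) (fun _ => e) T, cfc_id' ℂ T, cfc_const e T]
    have h2 : cfc (fun w => h w * (w - e)) T = 1 - Q := by
      rw [hQ, ← cfc_one ℂ T, ← cfc_sub (1 : ℂ → ℂ) (pointInd (E l)) T continuousOn_const hcont]
      refine cfc_congr fun w _ => ?_
      simp only [hh, Pi.one_apply]
      by_cases hw : w = e
      · simp [pointInd, hw, he]
      · field_simp [sub_ne_zero.2 hw]
    intro v hv
    have h3 : (1 - Q) v = cfc h T ((T - algebraMap ℂ _ e) v) := by
      rw [← h2, h1]; rfl
    have h4 : (T - algebraMap ℂ (H →L[ℂ] H) e) v = 0 := by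
      rw [Algebra.algebraMap_eq_smul_one]
      change T v - e • v = 0
      rw [hv, sub_self]
    rw [h4, map_zero] at h3
    exact (sub_eq_zero.1 h3).symm
  have hmemV : ∀ x, Q x ∈ eigenspaceOf P (E l) := by
    intro x
    have h1 : T (Q x) = e • Q x := congrArg (fun A : H →L[ℂ] H => A x) hTQ
    obtain ⟨hd, hP⟩ := hT.1 (Q x)
    have hd' : Q x ∈ P.domain := by
      have := P.domain.smul_mem e⁻¹ hd
      rwa [h1, smul_smul, inv_mul_cancel₀ (inv_ne_zero he0), one_smul] at this
    refine ⟨hd', ?_⟩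
    have h2 : (⟨T (Q x), hd⟩ : P.domain) = e • ⟨Q x, hd'⟩ := Subtype.ext h1
    rw [h2, P.map_smul, h1, ← smul_assoc, smul_eq_mul] at hP
    have h3 : P ⟨Q x, hd'⟩ = e⁻¹ • (e • P ⟨Q x, hd'⟩ - (-I * e) • Q x) + (-I) • Q x := by
      rw [smul_sub, smul_smul, smul_smul, inv_mul_cancel₀ (inv_ne_zero he0), one_smul,
        mul_comm (-I), ← mul_assoc, inv_mul_cancel₀ (inv_ne_zero he0), one_mul, sub_add_cancel]
    rw [h3, hP, ← add_smul, he, inv_inv]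
    congr 1; ring
  ext x
  rw [eigenProjection]
  refine (Submodule.eq_starProjection_of_mem_orthogonal
    (Submodule.le_topologicalClosure _ (hmemV x)) ?_).symm
  rw [Submodule.orthogonal_closure]
  intro v hv
  obtain ⟨hd, hPv⟩ := hv
  have hTv : T v = e • v := by
    have := hT.2 ⟨v, hd⟩
    rw [hPv] at this
    simp only at this
    rw [← sub_smul, map_smul, sub_neg_eq_add] at this
    rw [← this, smul_smul, he, inv_mul_cancel₀ he0, one_smul, this]
  have h5 : ⟪v, Q x⟫_ℂ = ⟪v, x⟫_ℂ := by
    rw [← ContinuousLinearMap.adjoint_inner_left, ← ContinuousLinearMap.star_eq_adjoint, hQstar,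
      hQ1 v hTv]
  rw [inner_sub_right, h5, sub_self]

/-- The resolvent at `z` as a function of `(P + i)⁻¹`. -/
theorem resolventOp_eq_cfc {z : ℂ} (hz : z ∉ unboundedSpectrum P) :
    ContinuousOn (fun w : ℂ => w / (1 - (z + I) * w)) (spectrum ℂ (resolventOp P (-I))) ∧
    resolventOp P z = cfc (fun w : ℂ => w / (1 - (z + I) * w)) (resolventOp P (-I)) := by
  have hn := D.isStarNormal
  have hT := D.isResolventAt_neg_I
  have hR := resolventOp_spec hz
  set T := resolventOp P (-I) with hTdef
  have hne : ∀ w ∈ spectrum ℂ T, 1 - (z + I) * w ≠ 0 := by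
    intro w hw h
    have hw0 : w ≠ 0 := by rintro rfl; simp at h
    have h2 := inv_sub_I_mem_of_mem_spectrum (D.notMem_of_im_ne_zero (by simp)) hw hw0
    have h3 : w⁻¹ = z + I := by
      field_simp
      linear_combination h
    rw [h3, add_sub_cancel_right] at h2
    exact hz h2
  have hc : ContinuousOn (fun w : ℂ => w / (1 - (z + I) * w)) (spectrum ℂ T) :=
    ContinuousOn.div (by fun_prop) (by fun_prop) hne
  refine ⟨hc, ?_⟩
  set A := cfc (fun w : ℂ => w / (1 - (z + I) * w)) T with hA
  have h1 : A * (1 - (z + I) • T) = T := by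
    have : (1 - (z + I) • T) = cfc (fun w : ℂ => 1 - (z + I) * w) T := by
      rw [cfc_sub (fun _ => (1 : ℂ)) (fun w => (z + I) * w) T, cfc_const_mul (z + I) (fun w => w) T,
        cfc_id' ℂ T, cfc_const (1 : ℂ) T, map_one]
    rw [this, hA, ← cfc_mul _ _ T hc (by fun_prop)]
    conv_rhs => rw [← cfc_id' ℂ T]
    refine cfc_congr fun w hw => ?_
    exact div_mul_cancel₀ _ (hne w hw)
  have h2 := mul_one_sub_eq hR hT
  have h3 := (one_sub_mul_one_add hR hT).1
  calc resolventOp P z = (resolventOp P z * (1 - (z + I) • T)) * (1 + (z + I) • resolventOp P z) := by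
        rw [mul_assoc, h3, mul_one]
    _ = A * (1 - (z + I) • T) * (1 + (z + I) • resolventOp P z) := by rw [h1, h2]
    _ = A := by rw [mul_assoc, h3, mul_one]

end SpectralData
end Spectral

/-! ### The wave propagator and its Laplace transform -/

section Spectral
open Complex Filter Topology Set MeasureTheory
open scoped InnerProductSpace

theorem abs_mul_sinc_sub_le (a t t' : ℝ) :
    |t * Real.sinc (t * a) - t' * Real.sinc (t' * a)| ≤ |t - t'| := by
  have := Convex.norm_image_sub_le_of_norm_hasDerivWithin_le (s := univ)
    (f := fun t : ℝ => t * Real.sinc (t * a)) (f' := fun t => Real.cos (t * a)) (C := 1)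
    (fun x _ => (hasDerivAt_mul_sinc a x).hasDerivWithinAt) (fun x _ => Real.abs_cos_le_one _)
    convex_univ (mem_univ t') (mem_univ t)
  simpa using this

/-- The function `w ↦ sin (t √x) / √x`, `w = (x + i)⁻¹`, with `x` replaced by `max x 0`: since
`√x = 0` for `x ≤ 0`, its value there is `t`. The value at `w = 0` is the limit `x → ∞`. -/
noncomputable def waveLift (t : ℝ) (w : ℂ) : ℂ :=
  if w = 0 then 0 else ((t * Real.sinc (t * √(w⁻¹).re) : ℝ) : ℂ)

theorem norm_waveLift_sub_le (t t' : ℝ) (w : ℂ) : ‖waveLift t w - waveLift t' w‖ ≤ |t - t'| := by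
  unfold waveLift
  split_ifs
  · simp
  · rw [← ofReal_sub, norm_real]
    exact abs_mul_sinc_sub_le _ _ _

theorem waveLift_zero (w : ℂ) : waveLift 0 w = 0 := by simp [waveLift]

theorem norm_waveLift_le (t : ℝ) (w : ℂ) : ‖waveLift t w‖ ≤ |t| := by
  simpa [waveLift_zero] using norm_waveLift_sub_le t 0 w

theorem waveLift_inv (t x : ℝ) :
    waveLift t ((x : ℂ) + I)⁻¹ = ((t * Real.sinc (t * √x) : ℝ) : ℂ) := by
  rw [waveLift, if_neg (inv_ne_zero (ofReal_add_I_ne_zero x))]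
  simp

theorem inv_ofReal_add_I_injective {x y : ℝ} (h : ((x : ℂ) + I)⁻¹ = ((y : ℂ) + I)⁻¹) : x = y := by
  have := inv_injective h
  simpa using this

theorem waveSymbol_of_nonneg (t : ℝ) {x : ℝ} (hx : 0 ≤ x) :
    waveSymbol t x = t * Real.sinc (t * √x) := by
  unfold waveSymbol
  rcases hx.eq_or_lt with rfl | hx
  · simp
  · rw [if_pos hx]
    have hs : √x ≠ 0 := (Real.sqrt_pos.2 hx).ne'
    by_cases ht : t = 0
    · simp [ht]
    · rw [Real.sinc_of_ne_zero (mul_ne_zero ht hs)]; field_simp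

theorem waveSymbol_of_neg (t : ℝ) {x : ℝ} (hx : x < 0) :
    waveSymbol t x = Real.sinh (√(-x) * t) / √(-x) := by
  unfold waveSymbol
  rw [if_neg (not_lt.2 hx.le), if_neg hx.ne, mul_comm]

variable {H : Type*} [NormedAddCommGroup H] [InnerProductSpace ℂ H] [CompleteSpace H]

/-- The wave propagator `sin (t √P₊) / √P₊` of the positive part of `P`; on the eigenvectors with
negative eigenvalues it is multiplication by `t`. -/
noncomputable def wavePlus (P : H →ₗ.[ℂ] H) (t : ℝ) : H →L[ℂ] H :=
  cfc (waveLift t) (resolventOp P (-I))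

namespace SpectralData

variable {P : H →ₗ.[ℂ] H} {N : ℕ} {E : Fin N → ℝ} (D : SpectralData P E)
include D

/-- A bound which tends to `0` at `w = 0`, so that `waveLift t` is continuous there. -/
theorem exists_norm_waveLift_le : ∃ m : ℝ, ∀ w ∈ spectrum ℂ (resolventOp P (-I)), ∀ t : ℝ,
    ‖waveLift t w‖ ≤ (1 + |t|) * √(m * ‖w‖) := by
  obtain ⟨m, hm0, hm⟩ : ∃ m : ℝ, 0 ≤ m ∧ ∀ l, -m ≤ E l := by
    refine ⟨∑ l, |E l|, Finset.sum_nonneg fun _ _ => abs_nonneg _, fun l => ?_⟩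
    have := Finset.single_le_sum (f := fun l => |E l|) (fun i _ => abs_nonneg _) (Finset.mem_univ l)
    linarith [neg_abs_le (E l)]
  refine ⟨m + 2, fun w hw t => ?_⟩
  by_cases hw0 : w = 0
  · simp [hw0, waveLift]
  obtain ⟨x, hx, rfl⟩ := D.exists_of_mem_spectrum hw hw0
  have hxm : -m ≤ x := by
    rcases hx with hx | ⟨l, rfl⟩
    · exact (neg_nonpos.2 hm0).trans hx
    · exact hm l
  have hpos : 0 < ‖(x : ℂ) + I‖ := norm_pos_iff.2 (ofReal_add_I_ne_zero x)
  have hle : ‖(x : ℂ) + I‖ ≤ |x| + 1 := by simpa using norm_add_le (x : ℂ) I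
  rw [norm_inv]
  have ht := abs_nonneg t
  by_cases hx1 : x < 1
  · have h1 : 1 ≤ (m + 2) * ‖(x : ℂ) + I‖⁻¹ := by
      rw [← div_eq_mul_inv, le_div_iff₀ hpos, one_mul]
      have : |x| ≤ m + 1 := abs_le.2 ⟨by linarith, by linarith⟩
      linarith
    calc ‖waveLift t ((x : ℂ) + I)⁻¹‖ ≤ |t| := norm_waveLift_le _ _
      _ ≤ (1 + |t|) * 1 := by linarith
      _ ≤ _ := by gcongr; exact Real.one_le_sqrt.2 h1
  · have hx1 := not_lt.1 hx1
    have hs : 0 < √x := Real.sqrt_pos.2 (by linarith)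
    rw [waveLift_inv, norm_real]
    have h1 : |t * Real.sinc (t * √x)| ≤ 1 / √x := by
      by_cases h0 : t = 0
      · simp [h0]
      rw [Real.sinc_of_ne_zero (mul_ne_zero h0 hs.ne'),
        show t * (Real.sin (t * √x) / (t * √x)) = Real.sin (t * √x) / √x by field_simp,
        abs_div, abs_of_pos hs]
      gcongr
      exact Real.abs_sin_le_one _
    have h2 : 1 / √x ≤ √((m + 2) * ‖(x : ℂ) + I‖⁻¹) := by
      rw [one_div, ← Real.sqrt_inv]
      apply Real.sqrt_le_sqrt
      rw [abs_of_pos (by linarith)] at hle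
      rw [← div_eq_mul_inv, le_div_iff₀ hpos, inv_mul_eq_div, div_le_iff₀ (by linarith)]
      nlinarith
    rw [Real.norm_eq_abs]
    calc _ ≤ 1 * √((m + 2) * ‖(x : ℂ) + I‖⁻¹) := by rw [one_mul]; exact h1.trans h2
      _ ≤ _ := by gcongr; linarith

theorem continuousOn_waveLift (t : ℝ) :
    ContinuousOn (waveLift t) (spectrum ℂ (resolventOp P (-I))) := by
  intro w hw
  by_cases hw0 : w = 0
  · subst hw0
    obtain ⟨m, hm⟩ := D.exists_norm_waveLift_le
    have h0 : waveLift t 0 = 0 := by simp [waveLift]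
    rw [ContinuousWithinAt, h0]
    refine squeeze_zero_norm' (a := fun w => (1 + |t|) * √(m * ‖w‖)) ?_ ?_
    · filter_upwards [self_mem_nhdsWithin] with z hz using hm z hz t
    · have : Continuous fun w : ℂ => (1 + |t|) * √(m * ‖w‖) := by fun_prop
      have := this.tendsto 0
      simp only [norm_zero, mul_zero, Real.sqrt_zero] at this
      exact this.mono_left nhdsWithin_le_nhds
  · refine ContinuousAt.continuousWithinAt ?_
    have h1 : ContinuousAt (fun w : ℂ => ((t * Real.sinc (t * √(w⁻¹).re) : ℝ) : ℂ)) w := by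
      have h2 : Continuous fun z : ℂ => ((t * Real.sinc (t * √z.re) : ℝ) : ℂ) :=
        Complex.continuous_ofReal.comp (continuous_const.mul
          (Real.continuous_sinc.comp (by fun_prop)))
      exact ContinuousAt.comp (f := fun w : ℂ => w⁻¹) h2.continuousAt (continuousAt_inv₀ hw0)
    refine h1.congr ?_
    filter_upwards [isOpen_ne.mem_nhds hw0] with z hz
    rw [waveLift, if_neg hz]

theorem norm_wavePlus_sub_le (t t' : ℝ) : ‖wavePlus P t - wavePlus P t'‖ ≤ |t - t'| := by
  have hn := D.isStarNormal
  rw [wavePlus, wavePlus, ← cfc_sub _ _ _ (D.continuousOn_waveLift t) (D.continuousOn_waveLift t')]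
  exact norm_cfc_le (abs_nonneg _) fun w _ => norm_waveLift_sub_le t t' w

theorem continuous_wavePlus : Continuous (wavePlus P) :=
  (LipschitzWith.of_dist_le_mul (K := 1) fun t t' => by
    rw [dist_eq_norm, Real.dist_eq, NNReal.coe_one, one_mul]
    exact D.norm_wavePlus_sub_le t t').continuous

omit D in
theorem wavePlus_zero : wavePlus P 0 = 0 := by
  have : waveLift 0 = fun _ => 0 := funext waveLift_zero
  rw [wavePlus, this]
  exact cfc_const_zero ℂ _

/-- Changing a function at the points `(E_ℓ + i)⁻¹` adds multiples of the eigenprojections. -/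
theorem cfc_add_sum_pointInd {g : ℂ → ℂ} (hg : ContinuousOn g (spectrum ℂ (resolventOp P (-I))))
    (a : Fin N → ℂ) : cfc (fun w => g w + ∑ l, a l * pointInd (E l) w) (resolventOp P (-I)) =
      cfc g (resolventOp P (-I)) + ∑ l, a l • eigenProjection P (E l) := by
  have hn := D.isStarNormal
  have hi : ∀ l ∈ Finset.univ, ContinuousOn (fun w => a l * pointInd (E l) w)
      (spectrum ℂ (resolventOp P (-I))) :=
    fun l _ => continuousOn_const.mul (D.continuousOn_pointInd l)
  have h := cfc_sum (fun l w => a l * pointInd (E l) w) (resolventOp P (-I)) Finset.univ hi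
  have h2 : (∑ l, fun w => a l * pointInd (E l) w) = fun w => ∑ l, a l * pointInd (E l) w := by
    ext w; simp
  rw [h2] at h
  rw [cfc_add (resolventOp P (-I)) g (fun w => ∑ l, a l * pointInd (E l) w) hg
    (continuousOn_finsetSum _ hi), h]
  congr 1
  refine Finset.sum_congr rfl fun l _ => ?_
  rw [cfc_const_mul (a l) _ _ (D.continuousOn_pointInd l), D.cfc_pointInd]

theorem sum_pointInd_inv (a : Fin N → ℂ) (l : Fin N) :
    ∑ j, a j * pointInd (E j) ((E l : ℂ) + I)⁻¹ = a l := by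
  rw [Finset.sum_eq_single l]
  · simp [pointInd]
  · intro j _ hj
    rw [pointInd, if_neg fun h => hj (D.injective (inv_ofReal_add_I_injective h).symm), mul_zero]
  · simp

theorem sum_pointInd_of_nonneg (a : Fin N → ℂ) {x : ℝ} (hx : 0 ≤ x) :
    ∑ j, a j * pointInd (E j) ((x : ℂ) + I)⁻¹ = 0 := by
  refine Finset.sum_eq_zero fun j _ => ?_
  rw [pointInd, if_neg fun h => ?_, mul_zero]
  have := inv_ofReal_add_I_injective h
  linarith [D.neg j]

omit D in
theorem sum_pointInd_zero (a : Fin N → ℂ) : ∑ j, a j * pointInd (E j) 0 = 0 := by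
  refine Finset.sum_eq_zero fun j _ => ?_
  rw [pointInd, if_neg (inv_ne_zero (ofReal_add_I_ne_zero _)).symm, mul_zero]

/-- The propagator and `wavePlus` differ on the eigenspaces only, by `sinh (κt) / κ - t`. -/
theorem wavePropagator_eq (t : ℝ) : wavePropagator P t = wavePlus P t +
    ∑ l, ((Real.sinh (√(-E l) * t) / √(-E l) - t : ℝ) : ℂ) • eigenProjection P (E l) := by
  rw [wavePropagator, funcCalc, wavePlus, ← D.cfc_add_sum_pointInd (D.continuousOn_waveLift t)]
  refine cfc_congr fun w hw => ?_
  split_ifs with hw0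
  · rw [hw0, sum_pointInd_zero]; simp [waveLift]
  · obtain ⟨x, hx, rfl⟩ := D.exists_of_mem_spectrum hw hw0
    rw [waveLift_inv]
    have hre : ((((x : ℂ) + I)⁻¹)⁻¹).re = x := by simp
    rw [hre]
    rcases hx with hx | ⟨l, rfl⟩
    · rw [D.sum_pointInd_of_nonneg _ hx, waveSymbol_of_nonneg t hx, add_zero]
    · rw [D.sum_pointInd_inv, waveSymbol_of_neg t (D.neg l),
        Real.sqrt_eq_zero_of_nonpos (D.neg l).le]
      simp

theorem continuousOn_exp_mul_waveLift (l : ℂ) :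
    ContinuousOn (Function.uncurry fun (t : ℝ) (w : ℂ) => exp (I * l * t) * waveLift t w)
      (Set.Ioi (0 : ℝ) ×ˢ spectrum ℂ (resolventOp P (-I))) := by
  refine ContinuousOn.mul (by fun_prop) ?_
  rintro ⟨t, w⟩ ⟨-, hw⟩
  have h1 := (D.continuousOn_waveLift t) w hw
  rw [ContinuousWithinAt, tendsto_iff_norm_sub_tendsto_zero]
  have h2 : Tendsto (fun p : ℝ × ℂ => |p.1 - t| + ‖waveLift t p.2 - waveLift t w‖)
      (𝓝[Set.Ioi (0 : ℝ) ×ˢ spectrum ℂ (resolventOp P (-I))] (t, w)) (𝓝 0) := by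
    rw [← add_zero (0 : ℝ)]
    refine Tendsto.add ?_ ?_
    · have : Continuous fun p : ℝ × ℂ => |p.1 - t| := by fun_prop
      have := this.tendsto (t, w)
      simp only [sub_self, abs_zero] at this
      exact this.mono_left nhdsWithin_le_nhds
    · refine (tendsto_iff_norm_sub_tendsto_zero.1 h1).comp ?_
      rw [nhdsWithin_prod_eq]
      exact tendsto_snd
  refine squeeze_zero (fun _ => norm_nonneg _) (fun p => ?_) h2
  calc _ = ‖(waveLift p.1 p.2 - waveLift t p.2) + (waveLift t p.2 - waveLift t w)‖ := by
        rw [sub_add_sub_cancel]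
    _ ≤ _ := (norm_add_le _ _).trans (by gcongr; exact norm_waveLift_sub_le _ _ _)

theorem exp_smul_wavePlus (l : ℂ) (t : ℝ) : exp (I * l * t) • wavePlus P t =
    cfc (fun w => exp (I * l * t) * waveLift t w) (resolventOp P (-I)) := by
  rw [cfc_const_mul _ _ _ (D.continuousOn_waveLift t), wavePlus]

theorem integrableOn_exp_smul_wavePlus {l : ℂ} (hl : 0 < l.im) :
    IntegrableOn (fun t : ℝ => exp (I * l * t) • wavePlus P t) (Ioi 0) := by
  refine Integrable.mono' (integrableOn_mul_exp_neg hl) ?_ ?_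
  · have := D.continuous_wavePlus
    exact Continuous.aestronglyMeasurable (by fun_prop)
  · refine ae_restrict_of_forall_mem measurableSet_Ioi fun t ht => ?_
    rw [norm_smul, norm_exp_I_mul, mul_comm]
    gcongr
    have := D.norm_wavePlus_sub_le t 0
    rwa [wavePlus_zero, sub_zero, sub_zero, abs_of_pos ht] at this

/-- The resolvent as the Laplace transform of `wavePlus`, corrected on the eigenspaces, where that
transform is `-λ⁻²` in place of `(E_ℓ - λ²)⁻¹`. -/
theorem resolventOp_sq_eq {l : ℂ} (hl : 0 < l.im) (hspec : l ^ 2 ∉ unboundedSpectrum P) :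
    resolventOp P (l ^ 2) = (∫ t in Ioi (0 : ℝ), exp (I * l * t) • wavePlus P t) +
      ∑ j, (((E j : ℂ) - l ^ 2)⁻¹ + (l ^ 2)⁻¹) • eigenProjection P (E j) := by
  have hn := D.isStarNormal
  have hl0 : l ^ 2 ≠ 0 := by
    have := sq_ofReal_sub_sq_ne_zero hl 0
    simpa using this
  have h1 : ∫ t in Ioi (0 : ℝ), exp (I * l * t) • wavePlus P t =
      cfc (fun w => ∫ t in Ioi (0 : ℝ), exp (I * l * t) * waveLift t w) (resolventOp P (-I)) := by
    simp only [D.exp_smul_wavePlus]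
    symm
    refine cfc_setIntegral measurableSet_Ioi _ (fun t => t * Real.exp (-l.im * t)) _
      (D.continuousOn_exp_mul_waveLift l) ?_ (integrableOn_mul_exp_neg hl).2
    refine ae_restrict_of_forall_mem measurableSet_Ioi fun t ht w _ => ?_
    rw [norm_mul, norm_exp_I_mul, mul_comm]
    gcongr
    exact (norm_waveLift_le t w).trans_eq (abs_of_pos ht)
  have hL : ∀ x : ℝ, ∫ t in Ioi (0 : ℝ), exp (I * l * t) * waveLift t ((x : ℂ) + I)⁻¹ =
      (((√x : ℝ) : ℂ) ^ 2 - l ^ 2)⁻¹ := by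
    intro x
    simp only [waveLift_inv]
    exact integral_exp_mul_sinc hl _
  obtain ⟨hc, hR⟩ := D.resolventOp_eq_cfc hspec
  have h2 := D.cfc_add_sum_pointInd hc (fun j => -((((E j : ℂ) - l ^ 2)⁻¹ + (l ^ 2)⁻¹)))
  rw [← hR] at h2
  have h3 : ∫ t in Ioi (0 : ℝ), exp (I * l * t) • wavePlus P t = resolventOp P (l ^ 2) +
      ∑ j, (-((((E j : ℂ) - l ^ 2)⁻¹ + (l ^ 2)⁻¹))) • eigenProjection P (E j) := by
    rw [h1, ← h2]
    refine cfc_congr fun w hw => ?_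
    by_cases hw0 : w = 0
    · rw [hw0, sum_pointInd_zero]; simp [waveLift]
    obtain ⟨x, hx, rfl⟩ := D.exists_of_mem_spectrum hw hw0
    have hxne : (x : ℂ) - l ^ 2 ≠ 0 := by
      intro h
      refine hspec ?_
      rw [D.spec]
      exact ⟨x, hx, sub_eq_zero.1 h⟩
    have hr : ((x : ℂ) + I)⁻¹ / (1 - (l ^ 2 + I) * ((x : ℂ) + I)⁻¹) = ((x : ℂ) - l ^ 2)⁻¹ := by
      have h1 := ofReal_add_I_ne_zero x
      have h2 : 1 - (l ^ 2 + I) * ((x : ℂ) + I)⁻¹ = ((x : ℂ) - l ^ 2) * ((x : ℂ) + I)⁻¹ := by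
        field_simp; ring
      rw [h2]
      field_simp
    rw [hL, hr]
    rcases hx with hx | ⟨j, rfl⟩
    · rw [D.sum_pointInd_of_nonneg _ hx, add_zero, ← ofReal_pow, Real.sq_sqrt hx]
    · rw [D.sum_pointInd_inv, Real.sqrt_eq_zero_of_nonpos (D.neg j).le]
      simp [inv_neg]
  rw [h3, add_assoc, ← Finset.sum_add_distrib]
  simp [← add_smul]

end SpectralData
end Spectral

/-! ### Inversion along horizontal lines -/

section Spectral
open Complex Filter Topology Set MeasureTheory
open scoped InnerProductSpace

variable {H : Type*} [NormedAddCommGroup H] [InnerProductSpace ℂ H] [CompleteSpace H]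

/-- The inverse Fourier-Laplace transform of `R(λ)` along the line `Im λ = s`, given by its explicit
value; see `SpectralData.integral_line_eq`. The subtraction of `max t 0` undoes the action of
`wavePlus` on the eigenspaces. -/
noncomputable def lineTransform (P : H →ₗ.[ℂ] H) {N : ℕ} (E : Fin N → ℝ) (s t : ℝ) : H →L[ℂ] H :=
  wavePlus P (max t 0) +
    ∑ l, ((greenFn (√(-E l)) s t - max t 0 : ℝ) : ℂ) • eigenProjection P (E l)

theorem integrable_and_integral_exp_mul_max {l : ℂ} (hl : 0 < l.im) :
    Integrable (fun t : ℝ => exp (I * l * t) * ((max t 0 : ℝ) : ℂ)) ∧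
      ∫ t : ℝ, exp (I * l * t) * ((max t 0 : ℝ) : ℂ) = -(l ^ 2)⁻¹ := by
  have e : EqOn (fun t : ℝ => exp (I * l * t) * ((t * Real.sinc (t * 0) : ℝ) : ℂ))
      (fun t : ℝ => exp (I * l * t) * ((max t 0 : ℝ) : ℂ)) (Ioi 0) := by
    intro t ht
    simp [max_eq_left (mem_Ioi.1 ht).le]
  have e0 : ∀ t : ℝ, t ∉ Ioi (0 : ℝ) → exp (I * l * t) * ((max t 0 : ℝ) : ℂ) = 0 := by
    intro t ht
    simp [max_eq_right (not_lt.1 (mt mem_Ioi.2 ht))]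
  have i := (integrableOn_exp_mul_sinc hl 0).congr_fun e measurableSet_Ioi
  refine ⟨(integrableOn_iff_integrable_of_support_subset fun t ht => ?_).1 i, ?_⟩
  · by_contra h; exact ht (e0 t h)
  · rw [← setIntegral_eq_integral_of_forall_compl_eq_zero e0,
      ← setIntegral_congr_fun measurableSet_Ioi e, integral_exp_mul_sinc hl]
    simp [inv_neg]

namespace SpectralData

variable {P : H →ₗ.[ℂ] H} {N : ℕ} {E : Fin N → ℝ} (D : SpectralData P E)
include D

theorem continuous_lineTransform (s : ℝ) : Continuous (lineTransform P E s) := by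
  have h1 := D.continuous_wavePlus
  have h2 := fun l => continuous_greenFn (√(-E l)) s
  unfold lineTransform
  refine (h1.comp (by fun_prop)).add (continuous_finsetSum _ fun l _ => ?_)
  have := h2 l
  exact (Complex.continuous_ofReal.comp (by fun_prop)).smul continuous_const

theorem sqrt_neg_pos (l : Fin N) : 0 < √(-E l) := Real.sqrt_pos.2 (by linarith [D.neg l])

theorem integrable_and_integral_exp_smul_lineTransform {l : ℂ} (hl : 0 < l.im)
    (hne : ∀ j, l.im ≠ √(-E j)) (hspec : l ^ 2 ∉ unboundedSpectrum P) :
    Integrable (fun t : ℝ => exp (I * l * t) • lineTransform P E l.im t) ∧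
      ∫ t : ℝ, exp (I * l * t) • lineTransform P E l.im t = resolventOp P (l ^ 2) := by
  have e : EqOn (fun t : ℝ => exp (I * l * t) • wavePlus P t)
      (fun t : ℝ => exp (I * l * t) • wavePlus P (max t 0)) (Ioi 0) := by
    intro t ht
    simp [max_eq_left (mem_Ioi.1 ht).le]
  have e0 : ∀ t : ℝ, t ∉ Ioi (0 : ℝ) → exp (I * l * t) • wavePlus P (max t 0) = 0 := by
    intro t ht
    rw [max_eq_right (not_lt.1 (mt mem_Ioi.2 ht)), wavePlus_zero, smul_zero]
  have i := (D.integrableOn_exp_smul_wavePlus hl).congr_fun e measurableSet_Ioi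
  have i1 : Integrable (fun t : ℝ => exp (I * l * t) • wavePlus P (max t 0)) :=
    (integrableOn_iff_integrable_of_support_subset fun t ht => by
      by_contra h; exact ht (e0 t h)).1 i
  have v1 : ∫ t : ℝ, exp (I * l * t) • wavePlus P (max t 0) =
      ∫ t in Ioi (0 : ℝ), exp (I * l * t) • wavePlus P t := by
    rw [← setIntegral_eq_integral_of_forall_compl_eq_zero e0,
      ← setIntegral_congr_fun measurableSet_Ioi e]
  have im := integrable_and_integral_exp_mul_max hl
  have ig := fun j => integrable_and_integral_exp_mul_greenFn (D.sqrt_neg_pos j) hl (hne j)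
  have hsplit : (fun t : ℝ => exp (I * l * t) • lineTransform P E l.im t) = fun t : ℝ =>
      exp (I * l * t) • wavePlus P (max t 0) + ∑ j,
        (exp (I * l * t) * (greenFn (√(-E j)) l.im t : ℂ) -
          exp (I * l * t) * ((max t 0 : ℝ) : ℂ)) • eigenProjection P (E j) := by
    funext t
    rw [lineTransform, smul_add, Finset.smul_sum]
    congr 1
    refine Finset.sum_congr rfl fun j _ => ?_
    rw [smul_smul]
    congr 1; push_cast; ring
  have is : ∀ j ∈ Finset.univ, Integrable (fun t : ℝ =>
        (exp (I * l * t) * (greenFn (√(-E j)) l.im t : ℂ) -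
          exp (I * l * t) * ((max t 0 : ℝ) : ℂ)) • eigenProjection P (E j)) :=
    fun j _ => ((ig j).1.sub im.1).smul_const _
  rw [hsplit]
  refine ⟨i1.add (integrable_finsetSum _ is), ?_⟩
  rw [integral_add i1 (integrable_finsetSum _ is), integral_finsetSum _ is, v1,
    D.resolventOp_sq_eq hl hspec]
  congr 1
  refine Finset.sum_congr rfl fun j _ => ?_
  rw [integral_smul_const, integral_sub (ig j).1 im.1, (ig j).2, im.2, sub_neg_eq_add,
    ← ofReal_pow, Real.sq_sqrt (by linarith [D.neg j])]
  simp

theorem sq_notMem {l : ℂ} (hre : l.re ≠ 0) (him : l.im ≠ 0) : l ^ 2 ∉ unboundedSpectrum P := by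
  refine D.notMem_of_im_ne_zero ?_
  rw [pow_two, mul_im]
  have := mul_ne_zero hre him
  intro h
  apply this
  linarith

/-- The Laplace inversion formula for the resolvent, tested against a continuous functional. -/
theorem integral_line_eq (Λ : (H →L[ℂ] H) →L[ℂ] ℂ) {s : ℝ} (hs : 0 < s)
    (hne : ∀ j, s ≠ √(-E j)) {h : ℝ → ℂ} (hi : Integrable h)
    (hh : ∀ y : ℝ, y ≠ 0 → h y = Λ (waveResolvent P (y + s * I))) (t : ℝ) :
    ∫ y : ℝ, exp (-I * t * (y + s * I)) * h y = 2 * Real.pi * Λ (lineTransform P E s t) := by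
  have key : ∀ y : ℝ, y ≠ 0 → Integrable (fun t : ℝ => exp (I * (y + s * I) * t) *
      Λ (lineTransform P E s t)) ∧ ∫ t : ℝ, exp (I * (y + s * I) * t) *
      Λ (lineTransform P E s t) = Λ (waveResolvent P (y + s * I)) := by
    intro y hy
    have him : ((y : ℂ) + s * I).im = s := by simp
    have hre : ((y : ℂ) + s * I).re = y := by simp
    have h := D.integrable_and_integral_exp_smul_lineTransform (l := y + s * I) (by rwa [him])
      (by rwa [him]) (D.sq_notMem (by rwa [hre]) (by rw [him]; exact hs.ne'))
    rw [him] at h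
    have h1 := Λ.integrable_comp h.1
    have h2 := Λ.integral_comp_comm h.1
    simp only [map_smul, smul_eq_mul] at h1 h2
    exact ⟨h1, by rw [h2, h.2, waveResolvent]⟩
  have hexp : ∀ y t : ℝ, exp (I * y * t) * (exp (-s * t) * Λ (lineTransform P E s t)) =
      exp (I * (y + s * I) * t) * Λ (lineTransform P E s t) := by
    intro y t
    rw [← mul_assoc, ← exp_add]
    congr 2
    linear_combination (-s * t) * I_sq
  have hcont : Continuous fun t : ℝ => exp (-s * t) * Λ (lineTransform P E s t) :=
    Continuous.mul (by fun_prop) (Λ.continuous.comp (D.continuous_lineTransform s))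
  have hg := eq_integral_of_fourier (g := fun t : ℝ => exp (-s * t) * Λ (lineTransform P E s t))
    (h := h) hcont ?_ hi ?_ t
  · have e : (fun y : ℝ => exp (-I * t * (y + s * I)) * h y) =
        fun y : ℝ => exp (s * t) * (exp (-I * t * y) * h y) := by
      funext y
      rw [← mul_assoc, ← exp_add]
      congr 2
      linear_combination (-s * t) * I_sq
    rw [e, integral_const_mul, hg]
    have : exp (s * t : ℂ) * exp (-s * t) = 1 := by rw [← exp_add]; simp
    linear_combination (2 * Real.pi * Λ (lineTransform P E s t)) * this
  -- `e^{-st} Λ(lineTransform)` is integrable: its modulus is that of the integrand for `y = 1`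
  · have h1 := (key 1 one_ne_zero).1
    refine (integrable_norm_iff hcont.aestronglyMeasurable).1 ?_
    refine h1.norm.congr (Eventually.of_forall fun t => ?_)
    simp only
    rw [← hexp, norm_mul, norm_exp]
    simp
  · have : ∀ᵐ y : ℝ, y ≠ 0 := by simp [ae_iff]
    filter_upwards [this] with y hy
    rw [hh y hy, ← (key y hy).2]
    congr 1; funext t
    exact hexp y t

/-- For `t ≥ 0` the wave propagator differs from the line transform by the growing exponentials of
the eigenvalues above the line. -/
theorem wavePropagator_eq_lineTransform (s : ℝ) {t : ℝ} (ht : 0 ≤ t) :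
    wavePropagator P t = lineTransform P E s t +
      ∑ l, ((if s < √(-E l) then Real.exp (√(-E l) * t) / (2 * √(-E l)) else 0 : ℝ) : ℂ) •
        eigenProjection P (E l) := by
  rw [D.wavePropagator_eq, lineTransform, max_eq_left ht, add_assoc, ← Finset.sum_add_distrib]
  congr 1
  refine Finset.sum_congr rfl fun l _ => ?_
  rw [← add_smul, ← ofReal_add]
  congr 2
  have := D.sqrt_neg_pos l
  rw [greenFn]
  split_ifs
  · rw [abs_of_nonneg ht, Real.sinh_eq]
    field_simp
    ring_nf
  · rw [max_eq_left ht]; ring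

omit D in
/-- At negative times only the eigenvalues above the line contribute to the line transform. -/
theorem lineTransform_neg (s : ℝ) {t : ℝ} (ht : 0 ≤ t) :
    lineTransform P E s (-t) =
      ∑ l, ((if s < √(-E l) then -(Real.exp (-√(-E l) * t) / (2 * √(-E l))) else 0 : ℝ) : ℂ) •
        eigenProjection P (E l) := by
  rw [lineTransform, max_eq_right (by linarith), wavePlus_zero, zero_add]
  refine Finset.sum_congr rfl fun l _ => ?_
  congr 2
  rw [greenFn, abs_neg, abs_of_nonneg ht, max_eq_right (by linarith)]
  simp

end SpectralData
end Spectral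

/-! ### Integrals around the cut -/

section Paths
open Complex MeasureTheory Filter Topology Set

/-- The rectangle `|Re λ| < η`, `-d < Im λ < η` without the cut `-i[0,∞)`. -/
def slitRegion (η d : ℝ) : Set ℂ :=
  {l | |l.re| < η ∧ -d < l.im ∧ l.im < η ∧ ¬ (l.re = 0 ∧ l.im ≤ 0)}

theorem integral_comp_path_eq_sub {U : Set ℂ} {g G : ℂ → ℂ} (hG : ∀ z ∈ U, HasDerivAt G (g z) z)
    (hg : ContinuousOn g U) {γ γ' : ℝ → ℂ} {a b : ℝ} (hγ : ∀ t, HasDerivAt γ (γ' t) t)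
    (hγ' : Continuous γ') (hU : ∀ t ∈ uIcc a b, γ t ∈ U) :
    ∫ t in a..b, g (γ t) * γ' t = G (γ b) - G (γ a) := by
  have hc : Continuous γ := continuous_iff_continuousAt.2 fun t => (hγ t).continuousAt
  refine intervalIntegral.integral_eq_sub_of_hasDerivAt (f := fun t => G (γ t)) (fun t ht => ?_) ?_
  · exact (hG _ (hU t ht)).comp t (hγ t)
  · exact ((hg.comp hc.continuousOn hU).mul hγ'.continuousOn).intervalIntegrable

theorem hasDerivAt_arc (δ t : ℝ) : HasDerivAt (fun θ : ℝ => (δ : ℂ) * exp (θ * I))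
    (I * (δ * exp (t * I))) t := by
  have h := ((Complex.ofRealCLM.hasDerivAt (x := t)).mul_const I).cexp.const_mul (δ : ℂ)
  simp only [ofRealCLM_apply, ofReal_one, one_mul] at h
  exact h.congr_deriv (by ring)

theorem hasDerivAt_vertical (z : ℂ) (t : ℝ) : HasDerivAt (fun y : ℝ => z + (y : ℂ) * I) I t := by
  have h := ((Complex.ofRealCLM.hasDerivAt (x := t)).mul_const I).const_add z
  simpa using h

theorem hasDerivAt_horizontal (z : ℂ) (t : ℝ) : HasDerivAt (fun x : ℝ => (x : ℂ) + z) 1 t := by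
  have h := ((Complex.ofRealCLM.hasDerivAt (x := t)).add_const z)
  simpa using h

/-- The disk with centre `σδ + iδ`, `σ = ± 1`, which passes through `0`, `2σδ`, `2iδ`
and `2σδ + 2iδ`. -/
theorem mem_ball_corner {δ : ℝ} (hδ : 0 < δ) {σ : ℝ} (hσ : σ ^ 2 = 1) {z : ℂ} :
    z ∈ Metric.ball (δ * (σ + I) : ℂ) (√2 * δ) ↔
      z.re ^ 2 + z.im ^ 2 < 2 * δ * (σ * z.re + z.im) := by
  rw [Metric.mem_ball, Complex.dist_eq, ← sq_lt_sq₀ (norm_nonneg _) (by positivity),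
    ← Complex.normSq_eq_norm_sq, Complex.normSq_apply, mul_pow, Real.sq_sqrt (by norm_num)]
  simp only [sub_re, mul_re, ofReal_re, add_re, I_re, add_zero, ofReal_im, add_im, I_im, zero_mul,
    sub_zero, sub_im, mul_im, zero_add, mul_one, add_zero]
  constructor <;> intro h <;> nlinarith [h, hσ]

/-- The disks through `0` around the corners `± δ + iδ` avoid the cut, as `0` lies on their
boundary. -/
theorem ball_corner_subset {δ η d : ℝ} (hδ : 0 < δ) (hη : 3 * δ < η) (hd : δ < d) {σ : ℝ}
    (hσ : σ ^ 2 = 1) :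
    Metric.ball (δ * (σ + I) : ℂ) (√2 * δ) ⊆ slitRegion η d := by
  intro z hz
  rw [mem_ball_corner hδ hσ] at hz
  have h1 : (z.re - σ * δ) ^ 2 + (z.im - δ) ^ 2 < 2 * δ ^ 2 := by nlinarith
  have hs : |σ| = 1 := by
    rcases (by simpa using hσ : σ = 1 ∨ σ = -1) with rfl | rfl <;> simp
  have h2 : |z.re - σ * δ| < 2 * δ := abs_lt_of_sq_lt_sq (by nlinarith) (by positivity)
  have h3 : |z.im - δ| < 2 * δ := abs_lt_of_sq_lt_sq (by nlinarith) (by positivity)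
  have h4 : |z.re| ≤ |z.re - σ * δ| + |σ * δ| := by
    simpa using abs_add_le (z.re - σ * δ) (σ * δ)
  rw [abs_mul, hs, abs_of_pos hδ, one_mul] at h4
  rw [abs_lt] at h3
  refine ⟨by linarith, by nlinarith, by linarith, ?_⟩
  rintro ⟨h5, h6⟩
  rw [h5] at hz
  nlinarith

/-- The half circle may be replaced by three sides of a rectangle. Each quarter circle and the two
segments which replace it lie in a disk on which `g` has a primitive. -/
theorem arc_eq_corner {g : ℂ → ℂ} {δ η d : ℝ} (hδ : 0 < δ) (hη : 3 * δ < η) (hd : δ < d)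
    (hg : DifferentiableOn ℂ g (slitRegion η d)) :
    (∫ θ in Real.pi..0, g (δ * exp (θ * I)) * (I * (δ * exp (θ * I)))) =
      (∫ y in (0 : ℝ)..δ, g (-(δ : ℂ) + y * I) * I) + (∫ x in (-δ)..δ, g (x + δ * I)) +
      ∫ y in δ..0, g ((δ : ℂ) + y * I) * I := by
  have hpi := Real.pi_pos
  have hcorner : ∀ σ : ℝ, σ ^ 2 = 1 → ∃ G : ℂ → ℂ,
      ∀ z ∈ Metric.ball (δ * (σ + I) : ℂ) (√2 * δ), HasDerivAt G (g z) z := fun σ hσ =>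
    (hg.mono (ball_corner_subset hδ hη hd hσ)).isExactOn_ball
  have hcont : ∀ σ : ℝ, σ ^ 2 = 1 → ContinuousOn g (Metric.ball (δ * (σ + I) : ℂ) (√2 * δ)) :=
    fun σ hσ => (hg.mono (ball_corner_subset hδ hη hd hσ)).continuousOn
  obtain ⟨G₁, hG₁⟩ := hcorner 1 (by norm_num)
  obtain ⟨G₂, hG₂⟩ := hcorner (-1) (by norm_num)
  have hc₁ := hcont 1 (by norm_num)
  have hc₂ := hcont (-1) (by norm_num)
  have hcosarc : Continuous fun t : ℝ => I * (δ * exp (t * I)) := by fun_prop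
  have marc : ∀ (σ θ : ℝ), σ ^ 2 = 1 → 0 ≤ Real.sin θ → 0 ≤ σ * Real.cos θ →
      (δ : ℂ) * exp (θ * I) ∈ Metric.ball (δ * (σ + I) : ℂ) (√2 * δ) := by
    intro σ θ hσ hs hc
    rw [mem_ball_corner hδ hσ]
    have e1 : ((δ : ℂ) * exp (θ * I)).re = δ * Real.cos θ := by
      simp [Complex.exp_mul_I, Complex.cos_ofReal_re, Complex.sin_ofReal_im]
    have e2 : ((δ : ℂ) * exp (θ * I)).im = δ * Real.sin θ := by
      simp [Complex.exp_mul_I, Complex.cos_ofReal_im, Complex.sin_ofReal_re]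
    rw [e1, e2]
    have := Real.sin_sq_add_cos_sq θ
    have h5 : 1 ≤ (σ * Real.cos θ + Real.sin θ) ^ 2 := by nlinarith [mul_nonneg hc hs]
    have h6 : 1 ≤ σ * Real.cos θ + Real.sin θ := by nlinarith
    have h7 : 0 < δ ^ 2 := by positivity
    nlinarith
  have a1 := integral_comp_path_eq_sub hG₁ hc₁ (γ := fun θ : ℝ => (δ : ℂ) * exp (θ * I))
    (a := Real.pi / 2) (b := 0) (hasDerivAt_arc δ) hcosarc (fun t ht => by
      rw [uIcc_of_ge (by linarith)] at ht
      exact marc 1 t (by norm_num) (Real.sin_nonneg_of_nonneg_of_le_pi ht.1 (by linarith [ht.2]))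
        (by rw [one_mul]; exact Real.cos_nonneg_of_neg_pi_div_two_le_of_le (by linarith [ht.1]) ht.2))
  have a2 := integral_comp_path_eq_sub hG₂ hc₂ (γ := fun θ : ℝ => (δ : ℂ) * exp (θ * I))
    (a := Real.pi) (b := Real.pi / 2) (hasDerivAt_arc δ) hcosarc (fun t ht => by
      rw [uIcc_of_ge (by linarith)] at ht
      exact marc (-1) t (by norm_num)
        (Real.sin_nonneg_of_nonneg_of_le_pi (by linarith [ht.1]) (by linarith [ht.2]))
        (by linarith [Real.cos_nonpos_of_pi_div_two_le_of_le ht.1 (by linarith [ht.2])]))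
  have v1 := integral_comp_path_eq_sub hG₁ hc₁ (γ := fun y : ℝ => (δ : ℂ) + y * I)
    (a := δ) (b := 0) (hasDerivAt_vertical _) continuous_const (fun t ht => by
      rw [uIcc_of_ge hδ.le] at ht
      rw [mem_ball_corner hδ (by norm_num)]
      simp
      nlinarith [ht.1, ht.2, mul_nonneg ht.1 (sub_nonneg.2 ht.2), sq_pos_of_pos hδ])
  have v2 := integral_comp_path_eq_sub hG₂ hc₂ (γ := fun y : ℝ => -(δ : ℂ) + y * I)
    (a := 0) (b := δ) (hasDerivAt_vertical _) continuous_const (fun t ht => by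
      rw [uIcc_of_le hδ.le] at ht
      rw [mem_ball_corner hδ (by norm_num)]
      simp
      nlinarith [ht.1, ht.2, mul_nonneg ht.1 (sub_nonneg.2 ht.2), sq_pos_of_pos hδ])
  have k1 := integral_comp_path_eq_sub hG₁ hc₁ (γ := fun x : ℝ => (x : ℂ) + δ * I)
    (a := 0) (b := δ) (hasDerivAt_horizontal _) continuous_const (fun t ht => by
      rw [uIcc_of_le hδ.le] at ht
      rw [mem_ball_corner hδ (by norm_num)]
      simp
      nlinarith [ht.1, ht.2, mul_nonneg ht.1 (sub_nonneg.2 ht.2), sq_pos_of_pos hδ])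
  have k2 := integral_comp_path_eq_sub hG₂ hc₂ (γ := fun x : ℝ => (x : ℂ) + δ * I)
    (a := -δ) (b := 0) (hasDerivAt_horizontal _) continuous_const (fun t ht => by
      rw [uIcc_of_le (by linarith)] at ht
      rw [mem_ball_corner hδ (by norm_num)]
      simp
      nlinarith [ht.1, ht.2, mul_nonneg (neg_nonneg.2 ht.2) (sub_nonneg.2 ht.1), sq_pos_of_pos hδ])
  simp only [mul_one] at k1 k2
  have hd' : 0 < d := by linarith
  have iarc : ∀ a b : ℝ, a ∈ Icc 0 Real.pi → b ∈ Icc 0 Real.pi → IntervalIntegrable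
      (fun θ : ℝ => g (δ * exp (θ * I)) * (I * (δ * exp (θ * I)))) volume a b := by
    intro a b ha hb
    refine ContinuousOn.intervalIntegrable ?_
    refine ContinuousOn.mul (hg.continuousOn.comp (by fun_prop) fun t ht => ?_) (by fun_prop)
    have ht' : t ∈ Icc 0 Real.pi := uIcc_subset_Icc ha hb ht
    rcases le_total 0 (Real.cos t) with h | h
    · exact ball_corner_subset hδ hη hd (σ := 1) (by norm_num) (marc 1 t (by norm_num)
        (Real.sin_nonneg_of_nonneg_of_le_pi ht'.1 ht'.2) (by linarith))
    · exact ball_corner_subset hδ hη hd (σ := -1) (by norm_num) (marc (-1) t (by norm_num)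
        (Real.sin_nonneg_of_nonneg_of_le_pi ht'.1 ht'.2) (by linarith))
  have itop : ∀ a b : ℝ, a ∈ Icc (-δ) δ → b ∈ Icc (-δ) δ → IntervalIntegrable
      (fun x : ℝ => g (x + δ * I)) volume a b := by
    intro a b ha hb
    refine ContinuousOn.intervalIntegrable ?_
    refine hg.continuousOn.comp (by fun_prop) fun t ht => ?_
    have ht' : t ∈ Icc (-δ) δ := uIcc_subset_Icc ha hb ht
    have := abs_le.2 ⟨ht'.1, ht'.2⟩
    refine ⟨by simp; linarith, by simp; linarith, by simp; linarith, by simp; intros; linarith⟩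
  rw [← intervalIntegral.integral_add_adjacent_intervals
      (iarc Real.pi (Real.pi / 2) ⟨hpi.le, le_rfl⟩ ⟨by positivity, by linarith⟩)
      (iarc (Real.pi / 2) 0 ⟨by positivity, by linarith⟩ ⟨le_rfl, hpi.le⟩),
    ← intervalIntegral.integral_add_adjacent_intervals
      (itop (-δ) 0 ⟨le_rfl, by linarith⟩ ⟨by linarith, hδ.le⟩)
      (itop 0 δ ⟨by linarith, hδ.le⟩ ⟨by linarith, le_rfl⟩), a1, a2, v1, v2, k1, k2]
  simp
  ring

/-- The contour `γ(δ, c)` may be replaced by three sides of a rectangle. -/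
theorem contourIntegral_eq_rect {g : ℂ → ℂ} {δ η d c : ℝ} (hδ : 0 < δ) (hη : 3 * δ < η)
    (hc : 0 < c) (hd : c < d) (hδd : δ < d) (hg : DifferentiableOn ℂ g (slitRegion η d)) :
    contourIntegral δ c g =
      (∫ y in (-c)..δ, g (-(δ : ℂ) + y * I) * I) + (∫ x in (-δ)..δ, g (x + δ * I)) +
      ∫ y in δ..(-c), g ((δ : ℂ) + y * I) * I := by
  have iv : ∀ σ : ℝ, |σ| = 1 → ∀ a b : ℝ, a ∈ Icc (-c) δ → b ∈ Icc (-c) δ → IntervalIntegrable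
      (fun y : ℝ => g ((σ * δ : ℝ) + y * I) * I) volume a b := by
    intro σ hσ a b ha hb
    refine ContinuousOn.intervalIntegrable ?_
    refine (hg.continuousOn.comp (by fun_prop) fun t ht => ?_).mul continuousOn_const
    have ht' : t ∈ Icc (-c) δ := uIcc_subset_Icc ha hb ht
    have hab : |σ * δ| = δ := by rw [abs_mul, hσ, abs_of_pos hδ, one_mul]
    refine ⟨by simp [-ofReal_mul, hab]; linarith, by simp; linarith [ht'.1],
      by simp; linarith [ht'.2], ?_⟩
    rintro ⟨h1, -⟩
    rw [show ((((σ * δ : ℝ) : ℂ) + t * I)).re = σ * δ by simp] at h1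
    rw [h1] at hab; simp at hab; linarith
  have i1 := iv 1 (by norm_num)
  have i2 := iv (-1) (by norm_num)
  simp only [one_mul, neg_mul, ofReal_neg] at i1 i2
  have m0 : (0 : ℝ) ∈ Icc (-c) δ := ⟨by linarith, hδ.le⟩
  have m1 : -c ∈ Icc (-c) δ := ⟨le_rfl, by linarith⟩
  have m2 : δ ∈ Icc (-c) δ := ⟨by linarith, le_rfl⟩
  rw [contourIntegral, arc_eq_corner hδ hη hδd hg,
    ← intervalIntegral.integral_add_adjacent_intervals (i2 (-c) 0 m1 m0) (i2 0 δ m0 m2),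
    ← intervalIntegral.integral_add_adjacent_intervals (i1 δ 0 m2 m0) (i1 0 (-c) m0 m1)]
  ring

/-- Cauchy's theorem on the half strip `Re λ ≥ δ`, `a ≤ Im λ ≤ b`. -/
theorem halfStrip_right {g : ℂ → ℂ} {δ a b : ℝ} (hab : a ≤ b)
    (hg : DifferentiableOn ℂ g {l | δ ≤ l.re ∧ a ≤ l.im ∧ l.im ≤ b})
    (hdec : ∀ ε : ℝ, 0 < ε → ∃ M : ℝ, ∀ l : ℂ, M ≤ l.re → a ≤ l.im → l.im ≤ b → ‖g l‖ ≤ ε)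
    (ha : IntegrableOn (fun x : ℝ => g (x + a * I)) (Ioi δ))
    (hb : IntegrableOn (fun x : ℝ => g (x + b * I)) (Ioi δ)) :
    (∫ x in Ioi δ, g (x + a * I)) - (∫ x in Ioi δ, g (x + b * I)) =
      ∫ y in a..b, g ((δ : ℂ) + y * I) * I := by
  have hrect : ∀ M : ℝ, δ ≤ M → (∫ x in δ..M, g (x + a * I)) - (∫ x in δ..M, g (x + b * I)) +
      I • (∫ y in a..b, g ((M : ℂ) + y * I)) = I • ∫ y in a..b, g ((δ : ℂ) + y * I) := by
    intro M hM
    have h := Complex.integral_boundary_rect_eq_zero_of_differentiableOn g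
      ((δ : ℂ) + a * I) ((M : ℂ) + b * I) (hg.mono fun z hz => by
        have h1 := hz.1
        have h2 := hz.2
        simp only [mem_preimage, add_re, ofReal_re, mul_re, I_re, mul_zero, ofReal_im, I_im,
          mul_one, sub_self, add_zero, add_im, mul_im, zero_add] at h1 h2
        rw [uIcc_of_le hM] at h1
        rw [uIcc_of_le hab] at h2
        exact ⟨h1.1, h2.1, h2.2⟩)
    simp only [add_re, ofReal_re, mul_re, I_re, mul_zero, ofReal_im, I_im,
          mul_one, sub_self, add_zero, add_im, mul_im, zero_add] at h
    exact sub_eq_zero.1 h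
  have hlim : Tendsto (fun M : ℝ => I • ∫ y in a..b, g ((M : ℂ) + y * I)) atTop (𝓝 0) := by
    rw [← smul_zero I]
    refine Tendsto.const_smul ?_ I
    rw [Metric.tendsto_atTop]
    intro ε hε
    obtain ⟨M, hM⟩ := hdec (ε / (2 * (b - a + 1))) (by
      have : 0 ≤ b - a := by linarith
      positivity)
    refine ⟨M, fun x hx => ?_⟩
    have h0 : 0 ≤ b - a := by linarith
    have := intervalIntegral.norm_integral_le_of_norm_le_const (a := a) (b := b)
      (f := fun y : ℝ => g ((x : ℂ) + y * I)) (C := ε / (2 * (b - a + 1))) (fun y hy => by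
        rw [uIoc_of_le hab] at hy
        exact hM _ (by simpa using hx) (by simpa using hy.1.le) (by simpa using hy.2))
    rw [dist_zero_right]
    refine this.trans_lt ?_
    rw [abs_of_nonneg h0, div_mul_eq_mul_div, div_lt_iff₀ (by positivity)]
    nlinarith
  have h1 := intervalIntegral_tendsto_integral_Ioi δ ha tendsto_id
  have h2 := intervalIntegral_tendsto_integral_Ioi δ hb tendsto_id
  have h3 := (h1.sub h2).add hlim
  have h4 : Tendsto (fun M : ℝ => (∫ x in δ..id M, g (x + a * I)) -
      (∫ x in δ..id M, g (x + b * I)) + I • (∫ y in a..b, g ((M : ℂ) + y * I))) atTop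
      (𝓝 (I • ∫ y in a..b, g ((δ : ℂ) + y * I))) := by
    refine tendsto_const_nhds.congr' ?_
    filter_upwards [eventually_ge_atTop δ] with M hM
    exact (hrect M hM).symm
  have h5 := tendsto_nhds_unique h3 h4
  rw [add_zero] at h5
  rw [h5, intervalIntegral.integral_mul_const, smul_eq_mul, mul_comm]

/-- Cauchy's theorem on the half strip `Re λ ≤ -δ`, `a ≤ Im λ ≤ b`. -/
theorem halfStrip_left {g : ℂ → ℂ} {δ a b : ℝ} (hab : a ≤ b)
    (hg : DifferentiableOn ℂ g {l | l.re ≤ -δ ∧ a ≤ l.im ∧ l.im ≤ b})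
    (hdec : ∀ ε : ℝ, 0 < ε → ∃ M : ℝ, ∀ l : ℂ, M ≤ -l.re → a ≤ l.im → l.im ≤ b → ‖g l‖ ≤ ε)
    (ha : IntegrableOn (fun x : ℝ => g (x + a * I)) (Iio (-δ)))
    (hb : IntegrableOn (fun x : ℝ => g (x + b * I)) (Iio (-δ))) :
    (∫ x in Iio (-δ), g (x + b * I)) - (∫ x in Iio (-δ), g (x + a * I)) =
      ∫ y in a..b, g (-(δ : ℂ) + y * I) * I := by
  have hint : ∀ s : ℝ, IntegrableOn (fun x : ℝ => g (x + s * I)) (Iio (-δ)) →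
      IntegrableOn (fun x : ℝ => g (-((x : ℂ) + (-s : ℝ) * I))) (Ioi δ) := by
    intro s hs
    have h := ((Measure.measurePreserving_neg (volume : Measure ℝ)).integrableOn_comp_preimage
      (Homeomorph.neg ℝ).measurableEmbedding).2 hs
    have hpre : Neg.neg ⁻¹' Iio (-δ) = Ioi δ := by ext x; simp
    rw [hpre] at h
    refine h.congr_fun (fun x _ => ?_) measurableSet_Ioi
    simp only [Function.comp]
    congr 1; push_cast; ring
  have hval : ∀ s : ℝ, ∫ x in Ioi δ, g (-((x : ℂ) + (-s : ℝ) * I)) =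
      ∫ x in Iio (-δ), g (x + s * I) := by
    intro s
    rw [← integral_Iic_eq_integral_Iio, ← integral_comp_neg_Ioi]
    congr 1; ext x
    congr 1; push_cast; ring
  have h := halfStrip_right (g := fun l => g (-l)) (δ := δ) (neg_le_neg hab)
    (hg.comp differentiable_neg.differentiableOn fun z hz => by
      simp only [mem_ofPred_eq, neg_re, neg_im] at hz ⊢
      exact ⟨by linarith [hz.1], by linarith [hz.2.2], by linarith [hz.2.1]⟩)
    (fun ε hε => by
      obtain ⟨M, hM⟩ := hdec ε hε
      exact ⟨M, fun l h1 h2 h3 => hM (-l) (by simpa using h1) (by simp; linarith)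
        (by simp; linarith)⟩)
    (hint b hb) (hint a ha)
  rw [hval, hval] at h
  rw [h, ← intervalIntegral.integral_comp_neg]
  congr 1; ext y
  congr 2; push_cast; ring

/-- Cauchy's theorem on a rectangle. -/
theorem integral_rect_eq {g : ℂ → ℂ} {x₁ x₂ y₁ y₂ : ℝ}
    (hg : DifferentiableOn ℂ g {l | l.re ∈ uIcc x₁ x₂ ∧ l.im ∈ uIcc y₁ y₂}) :
    (∫ x in x₁..x₂, g (x + y₁ * I)) + (∫ y in y₁..y₂, g ((x₂ : ℂ) + y * I) * I) =
      (∫ y in y₁..y₂, g ((x₁ : ℂ) + y * I) * I) + ∫ x in x₁..x₂, g (x + y₂ * I) := by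
  have h := Complex.integral_boundary_rect_eq_zero_of_differentiableOn g
    ((x₁ : ℂ) + y₁ * I) ((x₂ : ℂ) + y₂ * I) (hg.mono fun z hz => by
      simpa [mem_reProdIm] using hz)
  simp only [add_re, ofReal_re, mul_re, I_re, mul_zero, ofReal_im, I_im,
    mul_one, sub_self, add_zero, add_im, mul_im, zero_add, smul_eq_mul] at h
  simp only [intervalIntegral.integral_mul_const]
  linear_combination h

/-- The contour integrals converge if `g` is holomorphic off the cut and integrable up to the cut on
`Im λ = -c`. Nothing is assumed about `g` near `0`: up to two segments of `Im λ = -c` which end at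
`± δ - ic`, the contour `γ(δ, c)` is equivalent to a fixed one. -/
theorem exists_tendsto_contourIntegral {g : ℂ → ℂ} {c η d h : ℝ} (hc : 0 < c) (hη : 0 < η)
    (hd : c < d) (hh : 0 < h) (hg : DifferentiableOn ℂ g (slitRegion η d))
    (hr : IntervalIntegrable (fun x : ℝ => g (x + (-c : ℝ) * I)) volume 0 h)
    (hl : IntervalIntegrable (fun x : ℝ => g (x + (-c : ℝ) * I)) volume (-h) 0) :
    ∃ J : ℂ, Tendsto (fun δ : ℝ => contourIntegral δ c g) (𝓝[>] 0) (𝓝 J) := by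
  set m := min (min (η / 4) (d / 2)) h with hm
  have hm0 : 0 < m := by simp only [hm, lt_min_iff]; exact ⟨⟨by linarith, by linarith⟩, hh⟩
  have hmη : m ≤ η / 4 := (min_le_left _ _).trans (min_le_left _ _)
  have hmd : m ≤ d / 2 := (min_le_left _ _).trans (min_le_right _ _)
  have hmh : m ≤ h := min_le_right _ _
  have hr' : IntervalIntegrable (fun x : ℝ => g (x + (-c : ℝ) * I)) volume 0 m :=
    hr.mono_set (by rw [uIcc_of_le hm0.le, uIcc_of_le hh.le]; exact Icc_subset_Icc le_rfl hmh)
  have hl' : IntervalIntegrable (fun x : ℝ => g (x + (-c : ℝ) * I)) volume (-m) 0 :=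
    hl.mono_set (by
      rw [uIcc_of_le (by linarith), uIcc_of_le (by linarith)]
      exact Icc_subset_Icc (by linarith) le_rfl)
  have key : ∀ δ ∈ Ioo 0 m, contourIntegral δ c g =
      (∫ y in (-c)..m, g (((-m : ℝ) : ℂ) + y * I) * I) + (∫ x in (-m)..m, g (x + m * I))
      - (∫ y in (-c)..m, g ((m : ℂ) + y * I) * I)
      - (∫ x in δ..m, g (x + (-c : ℝ) * I)) - ∫ x in (-m)..(-δ), g (x + (-c : ℝ) * I) := by
    rintro δ ⟨hδ, hδm⟩
    -- three rectangles fill the region between the contours with parameters `δ` and `m`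
    have r1 := integral_rect_eq (g := g) (x₁ := δ) (x₂ := m) (y₁ := -c) (y₂ := m)
      (hg.mono fun z hz => by
        rw [mem_ofPred_eq, uIcc_of_le hδm.le, uIcc_of_le (by linarith)] at hz
        obtain ⟨⟨a1, a2⟩, a3, a4⟩ := hz
        exact ⟨abs_lt.2 ⟨by linarith, by linarith⟩, by linarith, by linarith,
          fun h => by linarith [h.1]⟩)
    have r2 := integral_rect_eq (g := g) (x₁ := -m) (x₂ := -δ) (y₁ := -c) (y₂ := m)
      (hg.mono fun z hz => by
        rw [mem_ofPred_eq, uIcc_of_le (by linarith), uIcc_of_le (by linarith)] at hz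
        obtain ⟨⟨a1, a2⟩, a3, a4⟩ := hz
        exact ⟨abs_lt.2 ⟨by linarith, by linarith⟩, by linarith, by linarith,
          fun h => by linarith [h.1]⟩)
    have r3 := integral_rect_eq (g := g) (x₁ := -δ) (x₂ := δ) (y₁ := δ) (y₂ := m)
      (hg.mono fun z hz => by
        rw [mem_ofPred_eq, uIcc_of_le (by linarith), uIcc_of_le (by linarith)] at hz
        obtain ⟨⟨a1, a2⟩, a3, a4⟩ := hz
        exact ⟨abs_lt.2 ⟨by linarith, by linarith⟩, by linarith, by linarith,
          fun h => by linarith [h.2]⟩)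
    have hcont : ∀ s : Set ℝ, ∀ f : ℝ → ℂ, Continuous f → (∀ x ∈ s, f x ∈ slitRegion η d) →
        ContinuousOn (fun x => g (f x)) s := fun s f hf hs =>
      hg.continuousOn.comp hf.continuousOn hs
    have iv : ∀ x₀ : ℝ, |x₀| = δ → ∀ a b : ℝ, a ∈ Icc (-c) m → b ∈ Icc (-c) m →
        IntervalIntegrable (fun y : ℝ => g ((x₀ : ℂ) + y * I) * I) volume a b := by
      intro x₀ hx a b ha hb
      refine ContinuousOn.intervalIntegrable ((hcont _ _ (by fun_prop) fun y hy => ?_).mul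
        continuousOn_const)
      have hy' := uIcc_subset_Icc ha hb hy
      refine ⟨by simp [hx]; linarith, by simp; linarith [hy'.1], by simp; linarith [hy'.2], ?_⟩
      rintro ⟨h1, -⟩
      rw [show ((x₀ : ℂ) + y * I).re = x₀ by simp] at h1
      rw [h1] at hx; simp at hx; linarith
    have it : ∀ a b : ℝ, a ∈ Icc (-m) m → b ∈ Icc (-m) m →
        IntervalIntegrable (fun x : ℝ => g (x + m * I)) volume a b := by
      intro a b ha hb
      refine ContinuousOn.intervalIntegrable (hcont _ _ (by fun_prop) fun x hx => ?_)
      have hx' := uIcc_subset_Icc ha hb hx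
      refine ⟨by simp; exact abs_lt.2 ⟨by linarith [hx'.1], by linarith [hx'.2]⟩,
        by simp; linarith, by simp; linarith, by simp; intros; linarith⟩
    have s1 := intervalIntegral.integral_add_adjacent_intervals
      (iv δ (abs_of_pos hδ) (-c) δ ⟨le_rfl, by linarith⟩ ⟨by linarith, by linarith⟩)
      (iv δ (abs_of_pos hδ) δ m ⟨by linarith, by linarith⟩ ⟨by linarith, by linarith⟩)
    have s2 := intervalIntegral.integral_add_adjacent_intervals
      (iv (-δ) (by rw [abs_neg, abs_of_pos hδ]) (-c) δ ⟨le_rfl, by linarith⟩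
        ⟨by linarith, by linarith⟩)
      (iv (-δ) (by rw [abs_neg, abs_of_pos hδ]) δ m ⟨by linarith, by linarith⟩
        ⟨by linarith, by linarith⟩)
    have s3 := intervalIntegral.integral_add_adjacent_intervals
      (it (-m) (-δ) ⟨by linarith, by linarith⟩ ⟨by linarith, by linarith⟩)
      (it (-δ) δ ⟨by linarith, by linarith⟩ ⟨by linarith, by linarith⟩)
    have s4 := intervalIntegral.integral_add_adjacent_intervals
      (it (-m) δ ⟨by linarith, by linarith⟩ ⟨by linarith, by linarith⟩)
      (it δ m ⟨by linarith, by linarith⟩ ⟨by linarith, by linarith⟩)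
    rw [contourIntegral_eq_rect hδ (by linarith) hc hd (by linarith) hg,
      intervalIntegral.integral_symm (-c) δ, ← s4, ← s3]
    rw [ofReal_neg δ] at s2 r2 r3
    linear_combination r1 + r2 + r3 + s2 - s1
  have l1 : Tendsto (fun δ : ℝ => ∫ x in δ..m, g (x + (-c : ℝ) * I)) (𝓝[>] 0)
      (𝓝 (∫ x in (0 : ℝ)..m, g (x + (-c : ℝ) * I))) := by
    have h1 := intervalIntegral.continuousOn_primitive_interval_left
      (a := 0) (b := m) (μ := volume) (f := fun x : ℝ => g (x + (-c : ℝ) * I)) (by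
        rw [uIcc_of_le hm0.le, integrableOn_Icc_iff_integrableOn_Ioc]
        exact (intervalIntegrable_iff_integrableOn_Ioc_of_le hm0.le).1 hr')
    have h2 := (h1 0 left_mem_uIcc).tendsto
    refine h2.mono_left ?_
    rw [← nhdsWithin_Ioo_eq_nhdsGT hm0]
    exact nhdsWithin_mono _ (by rw [uIcc_of_le hm0.le]; exact Ioo_subset_Icc_self)
  have l2 : Tendsto (fun δ : ℝ => ∫ x in (-m)..(-δ), g (x + (-c : ℝ) * I)) (𝓝[>] 0)
      (𝓝 (∫ x in (-m)..0, g (x + (-c : ℝ) * I))) := by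
    have h1 := intervalIntegral.continuousOn_primitive_interval
      (a := -m) (b := 0) (μ := volume) (f := fun x : ℝ => g (x + (-c : ℝ) * I)) (by
        rw [uIcc_of_le (by linarith), integrableOn_Icc_iff_integrableOn_Ioc]
        exact (intervalIntegrable_iff_integrableOn_Ioc_of_le (by linarith)).1 hl')
    have h2 := (h1 0 right_mem_uIcc).tendsto
    refine h2.comp ?_
    rw [tendsto_nhdsWithin_iff]
    refine ⟨?_, ?_⟩
    · have : Tendsto (fun δ : ℝ => -δ) (𝓝 0) (𝓝 (-0)) := tendsto_id.neg
      rw [neg_zero] at this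
      exact this.mono_left nhdsWithin_le_nhds
    · filter_upwards [Ioo_mem_nhdsGT hm0] with δ hδ
      rw [uIcc_of_le (by linarith)]
      exact ⟨by linarith [hδ.2], by linarith [hδ.1]⟩
  refine ⟨_, (((tendsto_const_nhds (x := (∫ y in (-c)..m, g (((-m : ℝ) : ℂ) + y * I) * I) +
    (∫ x in (-m)..m, g (x + m * I)) - (∫ y in (-c)..m, g ((m : ℂ) + y * I) * I))).sub l1).sub
    l2).congr' ?_⟩
  filter_upwards [Ioo_mem_nhdsGT hm0] with δ hδ
  exact (key δ hδ).symm

theorem differentiableAt_logCutDown {l : ℂ} (hl : ¬ (l.re = 0 ∧ l.im ≤ 0)) :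
    DifferentiableAt ℂ logCutDown l := by
  have : -I * l ∈ slitPlane := by
    rw [mem_slitPlane_iff]
    simp
    by_contra! h
    exact hl ⟨h.2, h.1⟩
  unfold logCutDown
  exact ((differentiableAt_id.const_mul (-I)).clog this).add_const _

theorem logCutDown_of_re_pos {l : ℂ} (hl : 0 < l.re) : logCutDown l = log l := by
  have h := abs_lt.1 (abs_arg_lt_pi_div_two_iff.2 (Or.inl hl))
  have hl0 : l ≠ 0 := by rintro rfl; simp at hl
  rw [logCutDown, (log_mul_eq_add_log_iff (by simp) hl0).2, log_neg_I]
  · push_cast; ring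
  · rw [arg_neg_I]; exact ⟨by linarith, by linarith [Real.pi_pos]⟩

theorem logCutDown_of_re_neg {l : ℂ} (hl : l.re < 0) : logCutDown l = log (-l) + Real.pi * I := by
  have h := abs_lt.1 ((abs_arg_lt_pi_div_two_iff (z := -l)).2 (Or.inl (by simpa using hl)))
  have hl0 : -l ≠ 0 := by rw [neg_ne_zero]; rintro rfl; simp at hl
  rw [logCutDown, show -I * l = I * -l by ring, (log_mul_eq_add_log_iff (by simp) hl0).2, log_I]
  · push_cast; ring
  · rw [arg_I]; exact ⟨by linarith [Real.pi_pos], by linarith⟩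

theorem exp_logCutDown {l : ℂ} (hl : l ≠ 0) : exp (logCutDown l) = l := by
  rw [logCutDown, exp_add, exp_log (by simp [hl])]
  push_cast
  rw [exp_pi_div_two_mul_I]
  linear_combination (-l) * I_mul_I

theorem exp_logCutUp {b : ℂ} (hb : b ≠ 0) : exp (logCutUp b) = b := by
  rw [logCutUp, exp_sub, exp_log (by simp [hb])]
  push_cast
  rw [exp_pi_div_two_mul_I]
  field_simp

/-- The only possible zero of `log (bλ)` is `1 / b`. -/
theorem eq_inv_of_logProd_eq_zero {b l : ℂ} (hb : b ≠ 0) (hl : l ≠ 0) (h : logProd b l = 0) :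
    l = b⁻¹ := by
  have h1 : exp (logProd b l) = b * l := by
    rw [logProd, exp_add, exp_logCutUp hb, exp_logCutDown hl]
  rw [h, exp_zero] at h1
  exact eq_inv_of_mul_eq_one_right h1.symm

theorem differentiableAt_powLog {ν : ℝ} {b l : ℂ} {k : ℤ} (hl : ¬ (l.re = 0 ∧ l.im ≤ 0))
    (h : logProd b l ≠ 0 ∨ 0 ≤ k) : DifferentiableAt ℂ (powLog ν b k) l := by
  unfold powLog logProd
  have h1 := differentiableAt_logCutDown hl
  exact (h1.const_mul _).cexp.mul ((h1.const_add _).zpow h)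

/-- Since `1 / b` is not on the cut, some region around the cut does not contain it. -/
theorem exists_differentiableOn_powLog {b : ℂ} (hb : ∀ r : ℝ, 0 ≤ r → b ≠ r * I) (ν : ℝ) (k : ℤ)
    (d : ℝ) : ∃ η : ℝ, 0 < η ∧ DifferentiableOn ℂ (powLog ν b k) (slitRegion η d) := by
  have hb0 : b ≠ 0 := by simpa using hb 0 le_rfl
  have hcut : ¬ ((b⁻¹).re = 0 ∧ (b⁻¹).im ≤ 0) := by
    rintro ⟨h1, h2⟩
    have hn : 0 < normSq b := normSq_pos.2 hb0
    rw [inv_re, div_eq_zero_iff] at h1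
    rw [inv_im, div_le_iff₀ hn, zero_mul] at h2
    refine hb b.im (by linarith) ?_
    apply Complex.ext
    · simpa using h1.resolve_right hn.ne'
    · simp
  obtain ⟨η, hη, hout⟩ : ∃ η : ℝ, 0 < η ∧ b⁻¹ ∉ slitRegion η d := by
    by_cases h : (b⁻¹).re = 0
    · exact ⟨(b⁻¹).im, not_le.1 fun h' => hcut ⟨h, h'⟩, fun h' => lt_irrefl _ h'.2.2.1⟩
    · exact ⟨|(b⁻¹).re|, abs_pos.2 h, fun h' => lt_irrefl _ h'.1⟩
  refine ⟨η, hη, fun l hl => (differentiableAt_powLog hl.2.2.2 (Or.inl fun h0 => ?_)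
    ).differentiableWithinAt⟩
  have hl0 : l ≠ 0 := by rintro rfl; exact hl.2.2.2 (by simp)
  exact hout (eq_inv_of_logProd_eq_zero hb0 hl0 h0 ▸ hl)

theorem intervalIntegrable_zpow_near_zero {L : ℝ → ℂ} (hL : Continuous L) (β : ℂ)
    (h0 : β + L 0 ≠ 0) (ν : ℝ) (k : ℤ) {e : ℝ → ℂ} (he : Continuous e) :
    ∃ h : ℝ, 0 < h ∧ ∀ a b : ℝ, a ∈ Icc (-h) h → b ∈ Icc (-h) h → IntervalIntegrable
      (fun x => e x * (exp (ν * L x) * (β + L x) ^ k)) volume a b := by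
  have hne : ∀ᶠ x in 𝓝 (0 : ℝ), β + L x ≠ 0 :=
    (continuous_const.add hL).continuousAt.eventually_ne h0
  obtain ⟨h, hh, hx⟩ := Metric.eventually_nhds_iff.1 hne
  refine ⟨h / 2, by linarith, fun a b ha hb => ContinuousOn.intervalIntegrable ?_⟩
  refine he.continuousOn.mul ((by fun_prop : Continuous fun x => exp (ν * L x)).continuousOn.mul ?_)
  refine ContinuousOn.zpow₀ (by fun_prop) k fun x hx' => Or.inl (hx ?_)
  have := uIcc_subset_Icc ha hb hx'
  rw [dist_zero_right, Real.norm_eq_abs, abs_lt]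
  exact ⟨by linarith [this.1], by linarith [this.2]⟩

/-- The limits `J_{j,k}(t)` exist. On `Im λ = -c` the two boundary values of `log (bλ)` at the cut
do not vanish, because `b` is not in `i[0,∞)`. -/
theorem exists_tendsto_contourIntegral_powLog {b : ℂ} (hb : ∀ r : ℝ, 0 ≤ r → b ≠ r * I) (ν : ℝ)
    (k : ℤ) {c : ℝ} (hc : 0 < c) (t : ℝ) :
    ∃ J : ℂ, Tendsto (fun δ : ℝ => contourIntegral δ c
      (fun l => exp (-I * t * l) * powLog ν b k l)) (𝓝[>] 0) (𝓝 J) := by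
  obtain ⟨η, hη, hdiff⟩ := exists_differentiableOn_powLog hb ν k (c + 1)
  have hexp : Differentiable ℂ fun l : ℂ => exp (-I * t * l) := by fun_prop
  have he : Continuous fun x : ℝ => exp (-I * t * ((x : ℂ) + (-c : ℝ) * I)) := by fun_prop
  have hb0 : b ≠ 0 := by simpa using hb 0 le_rfl
  have harg : arg (I * b) ≠ Real.pi := by
    rw [Ne, arg_eq_pi_iff]
    rintro ⟨h1, h2⟩
    simp at h1 h2
    exact hb b.im h1.le (Complex.ext (by simpa using h2) (by simp))
  have hL₁ : Continuous fun x : ℝ => log ((x : ℂ) + (-c : ℝ) * I) := by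
    refine Continuous.clog (by fun_prop) fun x => ?_
    rw [mem_slitPlane_iff]; right; simp [hc.ne']
  have hL₂ : Continuous fun x : ℝ => log (-((x : ℂ) + (-c : ℝ) * I)) + Real.pi * I := by
    refine Continuous.add (Continuous.clog (by fun_prop) fun x => ?_) continuous_const
    rw [mem_slitPlane_iff]; right; simp [hc.ne']
  have him : (logCutUp b).im = arg (I * b) - Real.pi / 2 := by
    simp [logCutUp, log_im]
  -- imaginary parts show that `log b + log λ` does not vanish at `λ = -ic`, from either side
  obtain ⟨h₁, hh₁, i₁⟩ := intervalIntegrable_zpow_near_zero hL₁ (logCutUp b) (fun h => by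
    have h2 := congrArg Complex.im h
    rw [add_im, him, log_im] at h2
    have h3 : arg (((0 : ℝ) : ℂ) + (-c : ℝ) * I) = -(Real.pi / 2) := by
      rw [ofReal_zero, zero_add, ofReal_neg, neg_mul, ← mul_neg, arg_real_mul _ hc, arg_neg_I]
    rw [h3, zero_im] at h2
    exact harg (by linarith)) ν k he
  obtain ⟨h₂, hh₂, i₂⟩ := intervalIntegrable_zpow_near_zero hL₂ (logCutUp b) (fun h => by
    have h2 := congrArg Complex.im h
    rw [add_im, him, add_im, log_im] at h2
    have h3 : arg (-(((0 : ℝ) : ℂ) + (-c : ℝ) * I)) = Real.pi / 2 := by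
      rw [ofReal_zero, zero_add, ofReal_neg, neg_mul, neg_neg, arg_real_mul _ hc, arg_I]
    rw [h3, zero_im] at h2
    simp at h2
    linarith [neg_pi_lt_arg (I * b)]) ν k he
  have hm : 0 < min h₁ h₂ := lt_min hh₁ hh₂
  refine exists_tendsto_contourIntegral hc hη (lt_add_one c) hm
    (hexp.differentiableOn.mul hdiff) ?_ ?_
  · refine (i₁ 0 (min h₁ h₂) ⟨by linarith, hh₁.le⟩ ⟨by linarith, min_le_left _ _⟩).congr ?_
    intro x hx
    rw [uIoc_of_le hm.le] at hx
    simp only [powLog, logProd]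
    rw [logCutDown_of_re_pos (by simpa using hx.1)]
  · refine ((i₂ (-min h₁ h₂) 0 ⟨by linarith [min_le_right h₁ h₂], by linarith⟩
      ⟨by linarith, hh₂.le⟩).congr_uIoo ?_)
    intro x hx
    rw [uIoo_of_le (by linarith)] at hx
    simp only [powLog, logProd]
    rw [logCutDown_of_re_neg (by simpa using hx.2)]

end Paths

/-! ### From lines to contours -/

section Contours
open Complex MeasureTheory Filter Topology Set

/-- If the integrals of `g` along the lines `Im λ = δ` all agree, its integrals along `γ(δ, c)`
converge. -/
theorem tendsto_contourIntegral_of_lines {g : ℂ → ℂ} {c d η : ℝ} (hc : 0 < c) (hd : c < d)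
    (hη : 0 < η)
    (hg : DifferentiableOn ℂ g {l | -d < l.im ∧ l.im < η ∧ ¬ (l.re = 0 ∧ l.im ≤ 0)})
    (hdec : ∀ ε : ℝ, 0 < ε → ∃ M : ℝ, ∀ l : ℂ, M ≤ |l.re| → -c ≤ l.im → l.im < η → ‖g l‖ ≤ ε)
    (hbot : Integrable fun x : ℝ => g (x + (-c : ℝ) * I))
    (htop : ∀ δ ∈ Ioo 0 η, Integrable fun x : ℝ => g (x + δ * I)) {v : ℂ}
    (hv : ∀ δ ∈ Ioo 0 η, ∫ x : ℝ, g (x + δ * I) = v) :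
    Tendsto (fun δ : ℝ => contourIntegral δ c g) (𝓝[>] 0)
      (𝓝 (v - ∫ x : ℝ, g (x + (-c : ℝ) * I))) := by
  set m := min (η / 4) (d / 2) with hm
  have hm0 : 0 < m := lt_min (by linarith) (by linarith)
  have key : ∀ δ ∈ Ioo 0 m, contourIntegral δ c g = v - (∫ x : ℝ, g (x + (-c : ℝ) * I)) +
      ∫ x in (-δ)..δ, g (x + (-c : ℝ) * I) := by
    rintro δ ⟨hδ, hδm⟩
    have hδη : δ < η / 4 := hδm.trans_le (min_le_left _ _)
    have hδd : δ < d / 2 := hδm.trans_le (min_le_right _ _)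
    have hmem : δ ∈ Ioo 0 η := ⟨hδ, by linarith⟩
    have h1 := halfStrip_right (g := g) (δ := δ) (a := -c) (b := δ) (by linarith)
      (hg.mono fun l hl => ⟨by linarith [hl.2.1], by linarith [hl.2.2],
        fun h => by linarith [h.1, hl.1]⟩)
      (fun ε hε => by
        obtain ⟨M, hM⟩ := hdec ε hε
        exact ⟨M, fun l h1 h2 h3 => hM l (h1.trans (le_abs_self _)) h2 (by linarith)⟩)
      hbot.integrableOn (htop δ hmem).integrableOn
    have h2 := halfStrip_left (g := g) (δ := δ) (a := -c) (b := δ) (by linarith)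
      (hg.mono fun l hl => ⟨by linarith [hl.2.1], by linarith [hl.2.2],
        fun h => by linarith [h.1, hl.1]⟩)
      (fun ε hε => by
        obtain ⟨M, hM⟩ := hdec ε hε
        exact ⟨M, fun l h1 h2 h3 => hM l (h1.trans (neg_le_abs _)) h2 (by linarith)⟩)
      hbot.integrableOn (htop δ hmem).integrableOn
    have h3 := contourIntegral_eq_rect (g := g) hδ (η := η) (by linarith) hc hd (by linarith)
      (hg.mono fun l hl => ⟨hl.2.1, hl.2.2.1, hl.2.2.2⟩)
    have hsplit : ∀ φ : ℝ → ℂ, Integrable φ →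
        ∫ x, φ x = (∫ x in Iio (-δ), φ x) + (∫ x in (-δ)..δ, φ x) + ∫ x in Ioi δ, φ x := by
      intro φ hφ
      rw [← integral_Iic_eq_integral_Iio, ← intervalIntegral.integral_Iic_sub_Iic
        hφ.integrableOn hφ.integrableOn, add_sub_cancel, intervalIntegral.integral_Iic_add_Ioi
        hφ.integrableOn hφ.integrableOn]
    have s1 := hsplit _ hbot
    have s2 := hsplit _ (htop δ hmem)
    rw [hv δ hmem] at s2
    rw [h3, intervalIntegral.integral_symm (-c) δ]
    linear_combination (-1 : ℂ) * h2 - s2 + s1 + h1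
  have hlim : Tendsto (fun δ : ℝ => ∫ x in (-δ)..δ, g (x + (-c : ℝ) * I)) (𝓝[>] 0) (𝓝 0) := by
    have hp := intervalIntegral.continuous_primitive
      (fun a b => hbot.intervalIntegrable (a := a) (b := b)) 0
    have hq : Continuous fun δ : ℝ => (∫ x in (0 : ℝ)..δ, g (x + (-c : ℝ) * I)) -
        ∫ x in (0 : ℝ)..(-δ), g (x + (-c : ℝ) * I) := hp.sub (hp.comp continuous_neg)
    have := hq.tendsto 0
    simp only [neg_zero, intervalIntegral.integral_same, sub_self] at this
    refine (this.mono_left nhdsWithin_le_nhds).congr fun δ => ?_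
    rw [intervalIntegral.integral_interval_sub_left hbot.intervalIntegrable
      hbot.intervalIntegrable]
  have h := (tendsto_const_nhds (x := v - ∫ x : ℝ, g (x + (-c : ℝ) * I))
    (f := 𝓝[>] (0 : ℝ))).add hlim
  rw [add_zero] at h
  refine h.congr' ?_
  filter_upwards [Ioo_mem_nhdsGT hm0] with δ hδ
  exact (key δ hδ).symm

theorem intervalIntegrable_contour {g : ℂ → ℂ} {δ η c d : ℝ} (hδ : 0 < δ) (hη : δ < η) (hc : 0 < c)
    (hd : c < d) (hg : ContinuousOn g (slitRegion η d)) :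
    IntervalIntegrable (fun y : ℝ => g (-(δ : ℂ) + y * I) * I) volume (-c) 0 ∧
    IntervalIntegrable (fun θ : ℝ => g (δ * exp (θ * I)) * (I * (δ * exp (θ * I)))) volume
      Real.pi 0 ∧
    IntervalIntegrable (fun y : ℝ => g ((δ : ℂ) + y * I) * I) volume 0 (-c) := by
  have habs : |δ| = δ := abs_of_pos hδ
  refine ⟨?_, ?_, ?_⟩
  · refine ContinuousOn.intervalIntegrable ((hg.comp (by fun_prop) fun y hy => ?_).mul
      continuousOn_const)
    rw [uIcc_of_le (by linarith)] at hy
    refine ⟨by simpa [habs] using hη, by simp; linarith [hy.1], by simp; linarith [hy.2], ?_⟩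
    rintro ⟨h, -⟩
    simp at h; linarith
  · refine ContinuousOn.intervalIntegrable ((hg.comp (by fun_prop) fun θ hθ => ?_).mul
      (by fun_prop))
    rw [uIcc_of_ge Real.pi_pos.le] at hθ
    have e1 : ((δ : ℂ) * exp (θ * I)).re = δ * Real.cos θ := by
      simp [Complex.exp_mul_I, Complex.cos_ofReal_re, Complex.sin_ofReal_im]
    have e2 : ((δ : ℂ) * exp (θ * I)).im = δ * Real.sin θ := by
      simp [Complex.exp_mul_I, Complex.cos_ofReal_im, Complex.sin_ofReal_re]
    have hs := Real.sin_nonneg_of_nonneg_of_le_pi hθ.1 hθ.2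
    have h1 := Real.sin_le_one θ
    have h2 := Real.abs_cos_le_one θ
    refine ⟨?_, ?_, ?_, ?_⟩
    · rw [e1, abs_mul, habs]; nlinarith
    · rw [e2]; nlinarith
    · rw [e2]; nlinarith
    · rintro ⟨h3, h4⟩
      rw [e1] at h3
      rw [e2] at h4
      have h5 : Real.cos θ = 0 := by simpa [hδ.ne'] using h3
      have h6 : Real.sin θ = 0 := le_antisymm (by
        by_contra h; rw [not_le] at h; nlinarith) hs
      have := Real.sin_sq_add_cos_sq θ
      rw [h5, h6] at this; norm_num at this
  · refine ContinuousOn.intervalIntegrable ((hg.comp (by fun_prop) fun y hy => ?_).mul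
      continuousOn_const)
    rw [uIcc_of_ge (by linarith)] at hy
    refine ⟨by simpa [habs] using hη, by simp; linarith [hy.1], by simp; linarith [hy.2], ?_⟩
    rintro ⟨h, -⟩
    simp at h; linarith

theorem contourIntegral_sub {g₁ g₂ : ℂ → ℂ} {δ η c d : ℝ} (hδ : 0 < δ) (hη : δ < η) (hc : 0 < c)
    (hd : c < d) (h₁ : ContinuousOn g₁ (slitRegion η d)) (h₂ : ContinuousOn g₂ (slitRegion η d)) :
    contourIntegral δ c (fun l => g₁ l - g₂ l) = contourIntegral δ c g₁ - contourIntegral δ c g₂ := by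
  obtain ⟨a1, a2, a3⟩ := intervalIntegrable_contour hδ hη hc hd h₁
  obtain ⟨b1, b2, b3⟩ := intervalIntegrable_contour hδ hη hc hd h₂
  simp only [contourIntegral, sub_mul]
  rw [intervalIntegral.integral_sub a1 b1, intervalIntegral.integral_sub a2 b2,
    intervalIntegral.integral_sub a3 b3]
  ring

theorem contourIntegral_const_mul (a : ℂ) (g : ℂ → ℂ) (δ c : ℝ) :
    contourIntegral δ c (fun l => a * g l) = a * contourIntegral δ c g := by
  simp only [contourIntegral, mul_assoc, intervalIntegral.integral_const_mul]
  ring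

theorem contourIntegral_sum {ι : Type*} (S : Finset ι) {g : ι → ℂ → ℂ} {δ η c d : ℝ} (hδ : 0 < δ)
    (hη : δ < η) (hc : 0 < c) (hd : c < d) (h : ∀ i ∈ S, ContinuousOn (g i) (slitRegion η d)) :
    contourIntegral δ c (fun l => ∑ i ∈ S, g i l) = ∑ i ∈ S, contourIntegral δ c (g i) := by
  have hi := fun i hi => intervalIntegrable_contour hδ hη hc hd (h i hi)
  simp only [contourIntegral, Finset.sum_mul]
  rw [intervalIntegral.integral_finsetSum fun i h => (hi i h).1,
    intervalIntegral.integral_finsetSum fun i h => (hi i h).2.1,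
    intervalIntegral.integral_finsetSum fun i h => (hi i h).2.2, ← Finset.sum_add_distrib,
    ← Finset.sum_add_distrib]

/-- A bound off the imaginary axis suffices: the contour meets the axis only at `iδ`. -/
theorem norm_contourIntegral_le {g : ℂ → ℂ} {δ c K : ℝ} (hδ : 0 < δ) (hc : 0 < c)
    (hg : ∀ l : ℂ, l.re ≠ 0 → |l.re| ≤ δ → -c ≤ l.im → l.im ≤ δ → ‖g l‖ ≤ K) :
    ‖contourIntegral δ c g‖ ≤ (2 * c + Real.pi * δ) * K := by
  have habs : |δ| = δ := abs_of_pos hδ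
  have b1 : ‖∫ y in (-c)..0, g (-(δ : ℂ) + y * I) * I‖ ≤ K * |0 - -c| := by
    refine intervalIntegral.norm_integral_le_of_norm_le_const fun y hy => ?_
    rw [uIoc_of_le (by linarith)] at hy
    rw [norm_mul, norm_I, mul_one]
    exact hg _ (by simp [hδ.ne']) (by simp [habs]) (by simp; linarith [hy.1])
      (by simp; linarith [hy.2])
  have b3 : ‖∫ y in (0 : ℝ)..(-c), g ((δ : ℂ) + y * I) * I‖ ≤ K * |-c - 0| := by
    refine intervalIntegral.norm_integral_le_of_norm_le_const fun y hy => ?_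
    rw [uIoc_of_ge (by linarith)] at hy
    rw [norm_mul, norm_I, mul_one]
    exact hg _ (by simp [hδ.ne']) (by simp [habs]) (by simp; linarith [hy.1])
      (by simp; linarith [hy.2])
  have b2 : ‖∫ θ in Real.pi..0, g (δ * exp (θ * I)) * (I * (δ * exp (θ * I)))‖ ≤
      (K * δ) * |0 - Real.pi| := by
    refine intervalIntegral.norm_integral_le_of_norm_le_const_ae ?_
    have : ∀ᵐ θ : ℝ, θ ≠ Real.pi / 2 := by simp [ae_iff]
    filter_upwards [this] with θ hne hθ
    rw [uIoc_of_ge Real.pi_pos.le] at hθ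
    have e1 : ((δ : ℂ) * exp (θ * I)).re = δ * Real.cos θ := by
      simp [Complex.exp_mul_I, Complex.cos_ofReal_re, Complex.sin_ofReal_im]
    have e2 : ((δ : ℂ) * exp (θ * I)).im = δ * Real.sin θ := by
      simp [Complex.exp_mul_I, Complex.cos_ofReal_im, Complex.sin_ofReal_re]
    have hs := Real.sin_nonneg_of_nonneg_of_le_pi hθ.1.le hθ.2
    have h1 := Real.sin_le_one θ
    have h2 := Real.abs_cos_le_one θ
    have hcos : Real.cos θ ≠ 0 := by
      rcases lt_or_gt_of_ne hne with h | h
      · exact (Real.cos_pos_of_mem_Ioo ⟨by linarith [hθ.1, Real.pi_pos], h⟩).ne'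
      · exact (Real.cos_neg_of_pi_div_two_lt_of_lt h (by linarith [hθ.2, Real.pi_pos])).ne
    rw [norm_mul, norm_mul, norm_mul, norm_I, one_mul, norm_exp_ofReal_mul_I, mul_one, norm_real,
      Real.norm_of_nonneg hδ.le]
    gcongr
    refine hg _ ?_ ?_ ?_ ?_
    · rw [e1]; exact mul_ne_zero hδ.ne' hcos
    · rw [e1, abs_mul, habs]; nlinarith
    · rw [e2]; nlinarith
    · rw [e2]; nlinarith
  rw [contourIntegral]
  refine (norm_add₃_le).trans ((add_le_add (add_le_add b1 b2) b3).trans_eq ?_)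
  rw [zero_sub, zero_sub, sub_zero, neg_neg, abs_neg, abs_neg, abs_of_pos hc,
    abs_of_pos Real.pi_pos]
  ring

end Contours


/-! ### Analyticity and residues of the resolvent -/

section Resolvent
open Complex Filter Topology Set MeasureTheory

variable {H : Type*} [NormedAddCommGroup H] [InnerProductSpace ℂ H] [CompleteSpace H]

namespace SpectralData

variable {P : H →ₗ.[ℂ] H} {N : ℕ} {E : Fin N → ℝ} (D : SpectralData P E)
include D

theorem isClosed_unboundedSpectrum : IsClosed (unboundedSpectrum P) := by
  rw [D.spec]
  refine Complex.isometry_ofReal.isClosedEmbedding.isClosedMap _ ?_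
  exact isClosed_Ici.union (Set.finite_range E).isClosed

/-- Near `z`, the resolvent is `(P + i)⁻¹` times the inverse of `1 - (z + i)(P + i)⁻¹`. -/
theorem differentiableAt_resolventOp {z : ℂ} (hz : z ∉ unboundedSpectrum P) :
    DifferentiableAt ℂ (resolventOp P) z := by
  have hT := D.isResolventAt_neg_I
  have hunit : ∀ w, w ∉ unboundedSpectrum P →
      ∃ u : (H →L[ℂ] H)ˣ, (u : H →L[ℂ] H) = 1 - (w + I) • resolventOp P (-I) := by
    intro w hw
    obtain ⟨h1, h2⟩ := one_sub_mul_one_add (resolventOp_spec hw) hT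
    exact ⟨⟨_, _, h1, h2⟩, rfl⟩
  have heq : ∀ w, w ∉ unboundedSpectrum P → resolventOp P w =
      resolventOp P (-I) * Ring.inverse (1 - (w + I) • resolventOp P (-I)) := by
    intro w hw
    obtain ⟨u, hu⟩ := hunit w hw
    have h := mul_one_sub_eq (resolventOp_spec hw) hT
    rw [← hu] at h ⊢
    rw [Ring.inverse_unit, ← h, Units.mul_inv_cancel_right]
  have hd : DifferentiableAt ℂ (fun w => resolventOp P (-I) *
      Ring.inverse (1 - (w + I) • resolventOp P (-I))) z := by
    obtain ⟨u, hu⟩ := hunit z hz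
    refine DifferentiableAt.const_mul ?_ _
    have h1 : DifferentiableAt ℂ (Ring.inverse : (H →L[ℂ] H) → _)
        (1 - (z + I) • resolventOp P (-I)) := by
      rw [← hu]
      exact differentiableAt_inverse u.isUnit
    exact DifferentiableAt.comp (𝕜 := ℂ) (f := fun w : ℂ => 1 - (w + I) • resolventOp P (-I)) z h1
      (by fun_prop)
  refine hd.congr_of_eventuallyEq ?_
  filter_upwards [D.isClosed_unboundedSpectrum.isOpen_compl.mem_nhds hz] with w hw
  exact heq w hw

theorem sq_notMem_of_im_lt {l : ℂ} (hre : l.re = 0) (him : 0 < l.im)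
    (hlt : ∀ j, l.im < √(-E j)) : l ^ 2 ∉ unboundedSpectrum P := by
  rw [D.spec]
  rintro ⟨x, hx, hxl⟩
  have h1 : x = -l.im ^ 2 := by
    have := congrArg Complex.re hxl
    simp [pow_two, hre] at this
    rw [this]; ring
  rcases hx with hx | ⟨j, rfl⟩
  · rw [mem_Ici, h1] at hx
    nlinarith
  · have h2 := hlt j
    rw [h1, neg_neg, Real.sqrt_sq him.le] at h2
    exact lt_irrefl _ h2

/-- The residue of the resolvent at an eigenvalue is the spectral projection. The limit is taken
from the right along `Im λ = √(-E_j)`, where the cut-off resolvent is given. -/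
theorem tendsto_smul_waveResolvent (j : Fin N) :
    Tendsto (fun τ : ℝ => ((E j : ℂ) - ((τ : ℂ) + √(-E j) * I) ^ 2) •
      waveResolvent P ((τ : ℂ) + √(-E j) * I)) (𝓝[>] 0) (𝓝 (eigenProjection P (E j))) := by
  set κ := √(-E j) with hκ
  have hκ0 : 0 < κ := D.sqrt_neg_pos j
  have hκ2 : κ ^ 2 = -E j := Real.sq_sqrt (by linarith [D.neg j])
  have hz : Tendsto (fun τ : ℝ => ((τ : ℂ) + κ * I) ^ 2) (𝓝[>] 0) (𝓝 (E j)) := by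
    have : Continuous fun τ : ℝ => ((τ : ℂ) + κ * I) ^ 2 := by fun_prop
    have h := this.tendsto 0
    have e : (((0 : ℝ) : ℂ) + κ * I) ^ 2 = E j := by
      rw [ofReal_zero, zero_add, mul_pow, I_sq, ← ofReal_pow, hκ2]; simp
    rw [e] at h
    exact h.mono_left nhdsWithin_le_nhds
  have hlin : Tendsto (fun τ : ℝ => (E j : ℂ) - ((τ : ℂ) + κ * I) ^ 2) (𝓝[>] 0) (𝓝 0) := by
    simpa using hz.const_sub (E j : ℂ)
  have hformula : ∀ τ : ℝ, 0 < τ → ((E j : ℂ) - ((τ : ℂ) + κ * I) ^ 2) •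
      waveResolvent P ((τ : ℂ) + κ * I) = ((E j : ℂ) - ((τ : ℂ) + κ * I) ^ 2) •
        (∫ t in Ioi (0 : ℝ), exp (I * ((τ : ℂ) + κ * I) * t) • wavePlus P t) +
      ∑ i, (((E j : ℂ) - ((τ : ℂ) + κ * I) ^ 2) * ((E i : ℂ) - ((τ : ℂ) + κ * I) ^ 2)⁻¹ +
        ((E j : ℂ) - ((τ : ℂ) + κ * I) ^ 2) * (((τ : ℂ) + κ * I) ^ 2)⁻¹) •
          eigenProjection P (E i) := by
    intro τ hτ
    have him : ((τ : ℂ) + κ * I).im = κ := by simp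
    have hre : ((τ : ℂ) + κ * I).re = τ := by simp
    rw [waveResolvent, D.resolventOp_sq_eq (by rw [him]; exact hκ0)
      (D.sq_notMem (by rw [hre]; exact hτ.ne') (by rw [him]; exact hκ0.ne')), smul_add,
      Finset.smul_sum]
    congr 1
    refine Finset.sum_congr rfl fun i _ => ?_
    rw [smul_smul, mul_add]
  have hA : Tendsto (fun τ : ℝ => ((E j : ℂ) - ((τ : ℂ) + κ * I) ^ 2) •
      (∫ t in Ioi (0 : ℝ), exp (I * ((τ : ℂ) + κ * I) * t) • wavePlus P t)) (𝓝[>] 0) (𝓝 0) := by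
    refine squeeze_zero_norm (a := fun τ : ℝ => ‖(E j : ℂ) - ((τ : ℂ) + κ * I) ^ 2‖ *
      ∫ t in Ioi (0 : ℝ), t * Real.exp (-κ * t)) (fun τ => ?_) ?_
    · rw [norm_smul]
      gcongr
      refine norm_integral_le_of_norm_le (integrableOn_mul_exp_neg hκ0) ?_
      refine ae_restrict_of_forall_mem measurableSet_Ioi fun t ht => ?_
      have him : ((τ : ℂ) + κ * I).im = κ := by simp
      rw [norm_smul, norm_exp_I_mul, mul_comm, him]
      gcongr
      have := D.norm_wavePlus_sub_le t 0
      rwa [wavePlus_zero, sub_zero, sub_zero, abs_of_pos ht] at this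
    · simpa using hlin.norm.mul_const (∫ t in Ioi (0 : ℝ), t * Real.exp (-κ * t))
  have hEj : (E j : ℂ) ≠ 0 := by exact_mod_cast (D.neg j).ne
  have hB : Tendsto (fun τ : ℝ => ∑ i, (((E j : ℂ) - ((τ : ℂ) + κ * I) ^ 2) *
      ((E i : ℂ) - ((τ : ℂ) + κ * I) ^ 2)⁻¹ +
        ((E j : ℂ) - ((τ : ℂ) + κ * I) ^ 2) * (((τ : ℂ) + κ * I) ^ 2)⁻¹) •
          eigenProjection P (E i)) (𝓝[>] 0)
      (𝓝 (∑ i, ((if i = j then 1 else 0 : ℂ) + 0 * (E j : ℂ)⁻¹) • eigenProjection P (E i))) := by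
    refine tendsto_finsetSum _ fun i _ => ?_
    refine Tendsto.smul_const (Tendsto.add ?_ (hlin.mul (hz.inv₀ hEj))) _
    split_ifs with hij
    · subst hij
      refine tendsto_const_nhds.congr' ?_
      filter_upwards [self_mem_nhdsWithin] with τ hτ
      have him : ((τ : ℂ) + κ * I).im = κ := by simp
      have hre : ((τ : ℂ) + κ * I).re = τ := by simp
      have hns := D.sq_notMem (l := (τ : ℂ) + κ * I) (by rw [hre]; exact (mem_Ioi.1 hτ).ne')
        (by rw [him]; exact hκ0.ne')
      refine (mul_inv_cancel₀ (sub_ne_zero.2 fun h => hns ?_)).symm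
      rw [← h, D.spec]
      exact ⟨E i, Or.inr ⟨i, rfl⟩, rfl⟩
    · have hne : (E i : ℂ) - E j ≠ 0 := by
        rw [sub_ne_zero]
        exact fun h => hij (D.injective (by exact_mod_cast h))
      have := hlin.mul ((hz.const_sub (E i : ℂ)).inv₀ hne)
      rwa [zero_mul] at this
  have h := hA.add hB
  simp only [zero_mul, add_zero, ite_smul, one_smul, zero_smul, Finset.sum_ite_eq',
    Finset.mem_univ, if_true, zero_add] at h
  refine h.congr' ?_
  filter_upwards [self_mem_nhdsWithin] with τ hτ
  exact (hformula τ hτ).symm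

end SpectralData
end Resolvent

/-! ### The cut-off resolvent on horizontal lines -/

section Lines
open Complex MeasureTheory Filter Topology Set
open scoped InnerProductSpace

variable {H : Type*} [NormedAddCommGroup H] [InnerProductSpace ℂ H] [CompleteSpace H]

theorem norm_exp_neg_I_mul (t : ℝ) (l : ℂ) : ‖exp (-I * t * l)‖ = Real.exp (t * l.im) := by
  rw [norm_exp]; simp

/-- The norm of `F`, as a function with values in the operators `𝒟ᵖ → 𝒟^q`, in `L¹` of the
line `Im λ = s`. The point on the imaginary axis, where `F` is not specified, is cut out. -/
noncomputable def lineNorm (P : H →ₗ.[ℂ] H) (p q : ℝ) (F : ℂ → H →L[ℂ] H) (s : ℝ) : ℝ≥0∞ :=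
  ⨆ (ε : ℝ) (_ : 0 < ε), ∫⁻ x in {x : ℝ | ε < |x|},
    domOpNorm P p q (restrictDom P p (F (x + s * I)))

/-- The vector `(2π)⁻¹ ∫ e^{-itλ} F(λ) f dλ`, where `λ` runs over the line `Im λ = s`. -/
noncomputable def lineVec (F : ℂ → H →L[ℂ] H) (f : H) (s t : ℝ) : H :=
  ∫ x : ℝ, ((1 / (2 * Real.pi) : ℂ) * exp (-I * t * (x + s * I))) • F (x + s * I) f

/-- The operators `F(λ)` continue `χ R(λ) χ` to `Im λ > -c₀`, `Re λ ≠ 0`, and decay at high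
energy. -/
structure CutoffResolvent (P : H →ₗ.[ℂ] H) (χ : H →L[ℂ] H) (c₀ p q : ℝ)
    (F : ℂ → H →L[ℂ] H) : Prop where
  hol : DifferentiableOn ℂ F {l : ℂ | -c₀ < l.im ∧ l.re ≠ 0}
  res : ∀ l : ℂ, 0 < l.im → l.re ≠ 0 → F l = χ ∘L waveResolvent P l ∘L χ
  decay : ∀ ε : ℝ, 0 < ε → ∃ M : ℝ, ∀ l : ℂ, M ≤ |l.re| → -c₀ < l.im → l.im ≤ c₀ →
    domOpNorm P p q (restrictDom P p (F l)) ≤ ENNReal.ofReal ε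

theorem lintegral_domNorm_le (P : H →ₗ.[ℂ] H) (p q : ℝ) (F : ℂ → H →L[ℂ] H) (s : ℝ)
    (f : domPow P p) : ∫⁻ x : ℝ, domNorm P q (F (x + s * I) f) ≤
      lineNorm P p q F s * domNorm P p (f : H) := by
  refine (lintegral_mono fun x : ℝ =>
    domNorm_apply_le P p q (restrictDom P p (F (x + s * I))) f).trans ?_
  rw [lintegral_mul_const' _ _ (domNorm_ne_top_of_mem f)]
  gcongr
  exact lintegral_le_iSup_setLIntegral _

theorem norm_apply_le_of_domOpNorm_le {P : H →ₗ.[ℂ] H} {p q : ℝ} {F : ℂ → H →L[ℂ] H}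
    (f : domPow P p) {l : ℂ} {ε : ℝ} (hε : 0 ≤ ε)
    (h : domOpNorm P p q (restrictDom P p (F l)) ≤ ENNReal.ofReal ε) :
    ‖F l f‖ ≤ ‖negPow P q‖ * (ε * (domNorm P p (f : H)).toReal) := by
  refine norm_le_of_domNorm (P := P) (s := q) (by positivity) ?_
  refine (domNorm_apply_le P p q (restrictDom P p (F l)) f).trans ?_
  rw [ENNReal.ofReal_mul hε, ENNReal.ofReal_toReal (domNorm_ne_top_of_mem f)]
  gcongr

theorem isOpen_slitStrip (c₀ : ℝ) : IsOpen {l : ℂ | -c₀ < l.im ∧ l.re ≠ 0} :=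
  (isOpen_lt continuous_const Complex.continuous_im).inter
    (isOpen_ne_fun Complex.continuous_re continuous_const)

namespace CutoffResolvent

variable {P : H →ₗ.[ℂ] H} {χ : H →L[ℂ] H} {c₀ p q : ℝ} {F : ℂ → H →L[ℂ] H}
  (R : CutoffResolvent P χ c₀ p q F)
include R

theorem aestronglyMeasurable_line {s : ℝ} (hs : -c₀ < s) (f : H) :
    AEStronglyMeasurable (fun x : ℝ => F (x + s * I) f) := by
  have h1 : ContinuousOn (fun x : ℝ => F (x + s * I) f) ({0}ᶜ : Set ℝ) := by
    have h2 : ContinuousOn (fun x : ℝ => F (x + s * I)) ({0}ᶜ : Set ℝ) :=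
      R.hol.continuousOn.comp (by fun_prop) fun x hx => ⟨by simpa using hs, by simpa using hx⟩
    exact h2.clm_apply continuousOn_const
  have h3 := h1.aestronglyMeasurable (μ := volume) (measurableSet_singleton (0 : ℝ)).compl
  rwa [restrict_compl_singleton] at h3

theorem integrable_line {s : ℝ} (hs : -c₀ < s) (hfin : lineNorm P p q F s < ⊤) (f : domPow P p) :
    Integrable (fun x : ℝ => F (x + s * I) f) := by
  refine ⟨R.aestronglyMeasurable_line hs f, ?_⟩
  rw [HasFiniteIntegral]
  refine (lintegral_mono fun x : ℝ => enorm_le_domNorm P q (F (x + s * I) f)).trans_lt ?_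
  rw [lintegral_const_mul' _ _ (by simp)]
  refine ENNReal.mul_lt_top (by simp) ((lintegral_domNorm_le P p q F s f).trans_lt ?_)
  exact ENNReal.mul_lt_top hfin (domNorm_ne_top_of_mem f).lt_top

theorem integrable_exp_line {s : ℝ} (hs : -c₀ < s) (hfin : lineNorm P p q F s < ⊤)
    (f : domPow P p) (a : ℂ) (t : ℝ) :
    Integrable (fun x : ℝ => (a * exp (-I * t * (x + s * I))) • F (x + s * I) f) := by
  refine ((R.integrable_line hs hfin f).norm.const_mul (‖a‖ * Real.exp (t * s))).mono' ?_ ?_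
  · exact (Continuous.aestronglyMeasurable (by fun_prop)).smul (R.aestronglyMeasurable_line hs f)
  · refine Eventually.of_forall fun x => ?_
    rw [norm_smul, norm_mul, norm_exp_neg_I_mul]
    simp

theorem domNorm_lineVec_le {s : ℝ} (hs : -c₀ < s) (hfin : lineNorm P p q F s < ⊤)
    (f : domPow P p) (t : ℝ) : domNorm P q (lineVec F f s t) ≤ ENNReal.ofReal
      (1 / (2 * Real.pi) * Real.exp (t * s) * (lineNorm P p q F s).toReal *
        (domNorm P p (f : H)).toReal) := by
  have hpi := Real.pi_pos
  refine domNorm_integral_le (R.integrable_exp_line hs hfin f _ t) (by positivity) ?_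
  have hne : ∀ x : ℝ, (1 / (2 * Real.pi) : ℂ) * exp (-I * t * (x + s * I)) ≠ 0 := fun x => by
    have : (Real.pi : ℂ) ≠ 0 := by exact_mod_cast hpi.ne'
    exact mul_ne_zero (by simp [hpi.ne']) (exp_ne_zero _)
  refine (lintegral_mono fun x : ℝ => domNorm_smul_le P q (hne x) (F (x + s * I) f)).trans ?_
  have hnorm : ∀ x : ℝ, ‖(1 / (2 * Real.pi) : ℂ) * exp (-I * t * (x + s * I))‖ₑ =
      ENNReal.ofReal (1 / (2 * Real.pi) * Real.exp (t * s)) := fun x => by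
    rw [← ofReal_norm, norm_mul, norm_exp_neg_I_mul]
    congr 2
    · simp [abs_of_pos hpi]
    · simp
  simp only [hnorm]
  rw [lintegral_const_mul' _ _ (by simp), mul_assoc (1 / (2 * Real.pi) * Real.exp (t * s)),
    ENNReal.ofReal_mul (p := 1 / (2 * Real.pi) * Real.exp (t * s)) (by positivity),
    ENNReal.ofReal_mul ENNReal.toReal_nonneg, ENNReal.ofReal_toReal hfin.ne,
    ENNReal.ofReal_toReal (domNorm_ne_top_of_mem f)]
  gcongr
  exact lintegral_domNorm_le P p q F s f

theorem integral_exp_mul_inner {s : ℝ} (hs : -c₀ < s) (hfin : lineNorm P p q F s < ⊤)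
    (f : domPow P p) (t : ℝ) (w : H) :
    ∫ x : ℝ, exp (-I * t * (x + s * I)) * ⟪w, F (x + s * I) f⟫_ℂ =
      2 * Real.pi * ⟪w, lineVec F f s t⟫_ℂ := by
  have hpi : (Real.pi : ℂ) ≠ 0 := by exact_mod_cast Real.pi_ne_zero
  rw [lineVec, ← integral_inner (R.integrable_exp_line hs hfin f _ t), ← integral_const_mul]
  congr 1; funext x
  rw [inner_smul_right]
  field_simp

/-- The inversion formula for the cut-off resolvent. -/
theorem lineVec_eq {N : ℕ} {E : Fin N → ℝ} (D : SpectralData P E) {s : ℝ} (hs : 0 < s)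
    (hc₀ : 0 < c₀) (hne : ∀ j, s ≠ √(-E j)) (hfin : lineNorm P p q F s < ⊤) (f : domPow P p)
    (hf : χ (f : H) = f) (t : ℝ) : lineVec F f s t = χ (lineTransform P E s t f) := by
  refine ext_inner_left ℂ fun w => ?_
  have hs' : -c₀ < s := by linarith
  let Λ : (H →L[ℂ] H) →L[ℂ] ℂ :=
    (innerSL ℂ w) ∘L χ ∘L (ContinuousLinearMap.apply ℂ H (f : H))
  have hi : Integrable fun x : ℝ => ⟪w, F (x + s * I) f⟫_ℂ :=
    (R.integrable_line hs' hfin f).const_inner w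
  have h := D.integral_line_eq Λ hs hne hi (fun y hy => by
    rw [R.res _ (by simpa using hs) (by simpa using hy)]
    change ⟪w, χ (waveResolvent P (y + s * I) (χ f))⟫_ℂ = ⟪w, χ (waveResolvent P (y + s * I) f)⟫_ℂ
    rw [hf]) t
  rw [R.integral_exp_mul_inner hs' hfin f t w] at h
  have hpi : (2 * Real.pi : ℂ) ≠ 0 := by
    have : (Real.pi : ℂ) ≠ 0 := by exact_mod_cast Real.pi_ne_zero
    simp
  exact mul_left_cancel₀ hpi h

end CutoffResolvent

open Classical in
/-- The matrix element `⟪w, F(λ) f⟫`, with the values of `χ R(λ) χ` instead of `F(λ)` in the upper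
half plane; this fills the gap at the imaginary axis. -/
noncomputable def matrixElement (P : H →ₗ.[ℂ] H) (χ : H →L[ℂ] H) (F : ℂ → H →L[ℂ] H) (w f : H)
    (l : ℂ) : ℂ :=
  if 0 < l.im then ⟪w, χ (waveResolvent P l (χ f))⟫_ℂ else ⟪w, F l f⟫_ℂ

namespace CutoffResolvent

variable {P : H →ₗ.[ℂ] H} {χ : H →L[ℂ] H} {c₀ p q : ℝ} {F : ℂ → H →L[ℂ] H}
  (R : CutoffResolvent P χ c₀ p q F)
include R

theorem matrixElement_eq (w f : H) {l : ℂ} (hl : l.re ≠ 0) :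
    matrixElement P χ F w f l = ⟪w, F l f⟫_ℂ := by
  unfold matrixElement
  split_ifs with h
  · rw [R.res l h hl]; rfl
  · rfl

theorem differentiableOn_matrixElement {N : ℕ} {E : Fin N → ℝ} (D : SpectralData P E) {η : ℝ}
    (hη : ∀ j, η ≤ √(-E j)) (w f : H) : DifferentiableOn ℂ (matrixElement P χ F w f)
      {l | -c₀ < l.im ∧ l.im < η ∧ ¬ (l.re = 0 ∧ l.im ≤ 0)} := by
  rintro l ⟨h1, h2, h3⟩
  refine DifferentiableAt.differentiableWithinAt ?_
  by_cases hre : l.re = 0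
  · have him : 0 < l.im := not_le.1 fun h => h3 ⟨hre, h⟩
    have hns := D.sq_notMem_of_im_lt hre him fun j => h2.trans_le (hη j)
    have hd : DifferentiableAt ℂ (fun l => waveResolvent P l) l := by
      have h4 := D.differentiableAt_resolventOp hns
      exact DifferentiableAt.comp (𝕜 := ℂ) (f := fun l : ℂ => l ^ 2) l h4 (by fun_prop)
    have hd2 : DifferentiableAt ℂ (fun l => innerSL ℂ w (χ (waveResolvent P l (χ f)))) l :=
      (innerSL ℂ w).differentiableAt.comp l (χ.differentiableAt.comp l
        (hd.clm_apply (differentiableAt_const _)))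
    refine hd2.congr_of_eventuallyEq ?_
    filter_upwards [(isOpen_lt continuous_const Complex.continuous_im).mem_nhds him] with z hz
    rw [matrixElement, if_pos hz]; rfl
  · have hopen := (isOpen_slitStrip c₀).mem_nhds (show l ∈ _ from ⟨h1, hre⟩)
    have hd := R.hol.differentiableAt hopen
    have hd2 : DifferentiableAt ℂ (fun l => innerSL ℂ w (F l f)) l :=
      (innerSL ℂ w).differentiableAt.comp l (hd.clm_apply (differentiableAt_const _))
    refine hd2.congr_of_eventuallyEq ?_
    filter_upwards [hopen] with z hz
    rw [R.matrixElement_eq w f hz.2]; rfl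

/-- The contour integrals of `e^{-itλ} F(λ) f` converge weakly to the difference of the integrals
over a line in the upper half plane and over `Im λ = -c`. -/
theorem tendsto_contourIntegral_matrixElement {N : ℕ} {E : Fin N → ℝ} (D : SpectralData P E)
    {c η : ℝ} (hc : 0 < c) (hcc₀ : c < c₀) (hη0 : 0 < η) (hηc : η ≤ c₀)
    (hη : ∀ j, η ≤ √(-E j)) (f : domPow P p) {t : ℝ} (ht : 0 ≤ t)
    (hbot : lineNorm P p q F (-c) < ⊤) (htop : ∀ δ ∈ Ioo 0 η, lineNorm P p q F δ < ⊤) {U : H}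
    (hU : ∀ δ ∈ Ioo 0 η, lineVec F f δ t = U) (w : H) :
    Tendsto (fun δ : ℝ => contourIntegral δ c
      (fun l => exp (-I * t * l) * matrixElement P χ F w f l)) (𝓝[>] 0)
      (𝓝 (2 * Real.pi * ⟪w, U - lineVec F f (-c) t⟫_ℂ)) := by
  have hne : ∀ᵐ x : ℝ, x ≠ 0 := by simp [ae_iff]
  have hae : ∀ s : ℝ, (fun x : ℝ => exp (-I * t * (x + s * I)) *
      matrixElement P χ F w f (x + s * I)) =ᵐ[volume]
      fun x : ℝ => exp (-I * t * (x + s * I)) * ⟪w, F (x + s * I) f⟫_ℂ := by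
    intro s
    filter_upwards [hne] with x hx
    rw [R.matrixElement_eq w f (by simpa using hx)]
  have hi : ∀ s : ℝ, -c₀ < s → lineNorm P p q F s < ⊤ →
      Integrable (fun x : ℝ => exp (-I * t * (x + s * I)) *
        matrixElement P χ F w f (x + s * I)) := by
    intro s hs hfin
    have := (R.integrable_exp_line hs hfin f 1 t).const_inner (𝕜 := ℂ) w
    refine this.congr ?_
    refine EventuallyEq.trans (Eventually.of_forall fun x => ?_) (hae s).symm
    simp only
    rw [inner_smul_right, one_mul]
  have h := tendsto_contourIntegral_of_lines
    (g := fun l => exp (-I * t * l) * matrixElement P χ F w f l) hc hcc₀ hη0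
    (DifferentiableOn.mul (by fun_prop) (R.differentiableOn_matrixElement D hη w f))
    ?_ (hi _ (by linarith) hbot) (fun δ hδ => hi δ (by linarith [hδ.1]) (htop δ hδ))
    (v := 2 * Real.pi * ⟪w, U⟫_ℂ) (fun δ hδ => ?_)
  · rw [integral_congr_ae (hae (-c)), R.integral_exp_mul_inner (by linarith) hbot, ← mul_sub,
      ← inner_sub_right] at h
    exact h
  · intro ε hε
    set K := Real.exp (t * η) * (‖w‖ * (‖negPow P q‖ * (domNorm P p (f : H)).toReal)) with hK
    have hK0 : 0 ≤ K := by positivity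
    obtain ⟨M, hM⟩ := R.decay (ε / (K + 1)) (by positivity)
    refine ⟨max M 1, fun l h1 h2 h3 => ?_⟩
    have hre : l.re ≠ 0 := abs_pos.1 (one_pos.trans_le ((le_max_right _ _).trans h1))
    have h4 := norm_apply_le_of_domOpNorm_le f (by positivity)
      (hM l ((le_max_left _ _).trans h1) (by linarith) (by linarith))
    rw [R.matrixElement_eq w f hre, norm_mul, norm_exp_neg_I_mul]
    have h5 : ‖⟪w, F l f⟫_ℂ‖ ≤
        ‖w‖ * (‖negPow P q‖ * (ε / (K + 1) * (domNorm P p (f : H)).toReal)) :=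
      (norm_inner_le_norm _ _).trans (by gcongr)
    have h6 : Real.exp (t * l.im) ≤ Real.exp (t * η) := by gcongr
    calc _ ≤ Real.exp (t * η) *
        (‖w‖ * (‖negPow P q‖ * (ε / (K + 1) * (domNorm P p (f : H)).toReal))) := by gcongr
      _ = K * (ε / (K + 1)) := by rw [hK]; ring
      _ ≤ ε := by rw [mul_div_assoc', div_le_iff₀ (by positivity)]; nlinarith
  · rw [integral_congr_ae (hae δ), R.integral_exp_mul_inner (by linarith [hδ.1]) (htop δ hδ),
      hU δ hδ]

/-- If `F(λ) f` stays bounded as `λ` approaches `i √(-E)`, then the eigenvalue `E` is not seen by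
the cut-off resolvent. -/
theorem apply_eigenProjection_eq_zero {N : ℕ} {E : Fin N → ℝ} (D : SpectralData P E) (j : Fin N)
    {f : H} (hf : χ f = f) {C : ℝ}
    (hC : ∀ᶠ τ : ℝ in 𝓝[>] 0, ‖F ((τ : ℂ) + √(-E j) * I) f‖ ≤ C) :
    χ (eigenProjection P (E j) f) = 0 := by
  have hκ0 := D.sqrt_neg_pos j
  set κ := √(-E j) with hκ
  have hκ2 : κ ^ 2 = -E j := Real.sq_sqrt (by linarith [D.neg j])
  have h1 := D.tendsto_smul_waveResolvent j
  rw [← hκ] at h1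
  have h2 : Tendsto (fun τ : ℝ => ((E j : ℂ) - ((τ : ℂ) + κ * I) ^ 2) •
      F ((τ : ℂ) + κ * I) f) (𝓝[>] 0) (𝓝 (χ (eigenProjection P (E j) f))) := by
    have h3 := ((χ ∘L (ContinuousLinearMap.apply ℂ H f)).continuous.tendsto _).comp h1
    refine h3.congr' ?_
    filter_upwards [self_mem_nhdsWithin] with τ hτ
    rw [R.res _ (by simpa using hκ0) (by simpa using (mem_Ioi.1 hτ).ne')]
    simp [hf]
  have h4 : Tendsto (fun τ : ℝ => ‖(E j : ℂ) - ((τ : ℂ) + κ * I) ^ 2‖ * C) (𝓝[>] 0) (𝓝 0) := by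
    have : Continuous fun τ : ℝ => ‖(E j : ℂ) - ((τ : ℂ) + κ * I) ^ 2‖ * C := by fun_prop
    have h := this.tendsto 0
    have e : (E j : ℂ) - (((0 : ℝ) : ℂ) + κ * I) ^ 2 = 0 := by
      rw [ofReal_zero, zero_add, mul_pow, I_sq, ← ofReal_pow, hκ2]; simp
    rw [e, norm_zero, zero_mul] at h
    exact h.mono_left nhdsWithin_le_nhds
  have h5 : Tendsto (fun τ : ℝ => ((E j : ℂ) - ((τ : ℂ) + κ * I) ^ 2) •
      F ((τ : ℂ) + κ * I) f) (𝓝[>] 0) (𝓝 0) := by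
    refine squeeze_zero_norm' ?_ h4
    filter_upwards [hC] with τ hτ
    rw [norm_smul]
    gcongr
  exact tendsto_nhds_unique h2 h5

end CutoffResolvent
end Lines

/-! ### The decomposition of the wave -/

section Assembly
open Complex MeasureTheory Filter Topology Set
open scoped InnerProductSpace

variable {H : Type*} [NormedAddCommGroup H] [InnerProductSpace ℂ H] [CompleteSpace H]

/-- An approximation of `F(λ)` by a finite sum, in the norm of operators `𝒟ᵖ → 𝒟^q`, applied to a
vector. -/
theorem domNorm_apply_sub_sum_le {P : H →ₗ.[ℂ] H} {p q : ℝ} {ι : Type*} {A : H →L[ℂ] H}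
    {S : Finset ι} {a : ι → ℂ} {B : ι → domPow P p →ₗ[ℂ] H} {ε : ℝ} (hε : 0 ≤ ε)
    (h : domOpNorm P p q (restrictDom P p A - ∑ i ∈ S, a i • B i) ≤ ENNReal.ofReal ε)
    (f : domPow P p) : domNorm P q (A f - ∑ i ∈ S, a i • B i f) ≤
      ENNReal.ofReal (ε * (domNorm P p (f : H)).toReal) := by
  have h1 := domNorm_apply_le P p q (restrictDom P p A - ∑ i ∈ S, a i • B i) f
  have h2 : (restrictDom P p A - ∑ i ∈ S, a i • B i) f = A f - ∑ i ∈ S, a i • B i f := by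
    simp [LinearMap.sub_apply, LinearMap.sum_apply, restrictDom]
  rw [h2] at h1
  refine h1.trans ?_
  rw [ENNReal.ofReal_mul hε, ENNReal.ofReal_toReal (domNorm_ne_top_of_mem f)]
  gcongr

/-- A finite partial sum of the expansion bounds `F(λ) f` as `λ → i κ`, `0 < κ < c₀`. -/
theorem exists_eventually_norm_le {P : H →ₗ.[ℂ] H} {p q c₀ κ : ℝ} (hκ : 0 < κ) (hκc : κ < c₀)
    {F : ℂ → H →L[ℂ] H} {B : ℕ → ℤ → domPow P p →ₗ[ℂ] H} {ν : ℕ → ℝ} {b : ℕ → ℤ → ℂ}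
    (hdefined : ∀ j k, k < 0 → B j k ≠ 0 → ∀ l ∈ cutSquare c₀, logProd (b j k) l ≠ 0)
    (hunif : ∀ ε : ℝ, 0 < ε → ∃ S₀ : Finset (ℕ × ℤ), ∀ S, S₀ ⊆ S →
      ∀ l : ℂ, l.re ≠ 0 → |l.re| ≤ κ → |l.im| ≤ κ →
        domOpNorm P p q (restrictDom P p (F l) -
          ∑ jk ∈ S, powLog (ν jk.1) (b jk.1 jk.2) jk.2 l • B jk.1 jk.2) ≤ ENNReal.ofReal ε)
    (f : domPow P p) : ∃ C : ℝ, ∀ᶠ τ : ℝ in 𝓝[>] 0, ‖F ((τ : ℂ) + κ * I) f‖ ≤ C := by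
  obtain ⟨S, hS⟩ := hunif 1 one_pos
  set G : ℂ → H := fun l => ∑ jk ∈ S, powLog (ν jk.1) (b jk.1 jk.2) jk.2 l • B jk.1 jk.2 f with hG
  have hmem : (κ * I : ℂ) ∈ cutSquare c₀ := by
    refine ⟨by simpa using hκ.trans hκc, by simpa [abs_of_pos hκ] using hκc, ?_⟩
    simp [hκ]
  have hcont : ContinuousAt G (κ * I) := by
    refine tendsto_finsetSum _ fun jk _ => ?_
    by_cases hB : B jk.1 jk.2 = 0
    · simp [hB]
    · refine Tendsto.smul_const (DifferentiableAt.continuousAt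
        (differentiableAt_powLog hmem.2.2 ?_)).tendsto _
      rcases lt_or_ge jk.2 0 with hk | hk
      · exact Or.inl (hdefined _ _ hk hB _ hmem)
      · exact Or.inr hk
  have htend : Tendsto (fun τ : ℝ => G ((τ : ℂ) + κ * I)) (𝓝[>] 0) (𝓝 (G (κ * I))) := by
    have h1 : Continuous fun τ : ℝ => (τ : ℂ) + κ * I := by fun_prop
    have h2 := h1.tendsto 0
    rw [ofReal_zero, zero_add] at h2
    exact hcont.tendsto.comp (h2.mono_left nhdsWithin_le_nhds)
  refine ⟨‖negPow P q‖ * (1 * (domNorm P p (f : H)).toReal) + (‖G (κ * I)‖ + 1), ?_⟩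
  filter_upwards [htend.norm.eventually (eventually_le_nhds (lt_add_one _)),
    Ioo_mem_nhdsGT hκ] with τ h1 h2
  have h3 := domNorm_apply_sub_sum_le zero_le_one (hS S subset_rfl ((τ : ℂ) + κ * I)
    (by simpa using h2.1.ne') (by simpa [abs_of_pos h2.1] using h2.2.le)
    (by simp [abs_of_pos hκ])) f
  have h4 := norm_le_of_domNorm (by positivity) h3
  calc _ = ‖(F ((τ : ℂ) + κ * I) f - G ((τ : ℂ) + κ * I)) + G ((τ : ℂ) + κ * I)‖ := by
        rw [sub_add_cancel]
    _ ≤ _ := (norm_add_le _ _).trans (add_le_add h4 h1)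

/-- The cut-off wave is `χ u_d`, plus the line integral over `Im λ = δ` close to the real axis, minus
the line integral over `Im λ = s` at time `-t`. The latter accounts for the decaying exponential in
`sinh (κt) = (e^{κt} - e^{-κt}) / 2`. -/
theorem CutoffResolvent.apply_wavePropagator_eq {P : H →ₗ.[ℂ] H} {χ : H →L[ℂ] H} {c₀ p q : ℝ}
    {F : ℂ → H →L[ℂ] H} (R : CutoffResolvent P χ c₀ p q F) {N : ℕ} {E : Fin N → ℝ}
    (D : SpectralData P E) {f : domPow P p} (hf : χ (f : H) = f) {δ s : ℝ} (hδ : 0 < δ)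
    (hδE : ∀ l, δ < √(-E l)) (hδfin : lineNorm P p q F δ < ⊤) (hs : 0 < s) (hsc : s < c₀)
    (hsE : ∀ l, s ≠ √(-E l)) (hsfin : lineNorm P p q F s < ⊤)
    (hvanish : ∀ l, √(-E l) < c₀ → χ (eigenProjection P (E l) f) = 0) {t : ℝ} (ht : 0 ≤ t) :
    χ (wavePropagator P t f) =
      χ (discretePart P E t f) + (lineVec F f δ t - lineVec F f s (-t)) := by
  have hc₀ : 0 < c₀ := hs.trans hsc
  rw [R.lineVec_eq D hδ hc₀ (fun l => (hδE l).ne) hδfin f hf,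
    R.lineVec_eq D hs hc₀ hsE hsfin f hf, D.wavePropagator_eq_lineTransform δ ht,
    SpectralData.lineTransform_neg s ht, discretePart]
  simp only [add_apply, sum_apply, smul_apply, map_add, map_sum, map_smul]
  rw [add_comm, ← add_sub_assoc, add_sub_right_comm, ← Finset.sum_sub_distrib]
  congr 1
  refine Finset.sum_congr rfl fun l _ => ?_
  rw [if_pos (hδE l), ← sub_smul, ← ofReal_sub]
  have hκ := D.sqrt_neg_pos l
  by_cases hl : s < √(-E l)
  · rw [if_pos hl, Real.sinh_eq]
    congr 2
    field_simp
    ring_nf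
  · rw [hvanish l ((not_lt.1 hl).trans_lt hsc), smul_zero, smul_zero]

end Assembly
end WaveExpansion

theorem theorem2p1 {H : Type*} [NormedAddCommGroup H] [InnerProductSpace ℂ H] [CompleteSpace H]
    (P : H →ₗ.[ℂ] H) (hP : IsSelfAdjoint P)
    -- the spectrum
    (N : ℕ) (E : Fin N → ℝ) (hEmono : StrictMono E) (hEneg : ∀ l, E l < 0)
    (hEeig : ∀ l, eigenspaceOf P (E l) ≠ ⊥)
    (hspec : unboundedSpectrum P = (fun x : ℝ => (x : ℂ)) '' (Set.Ici 0 ∪ Set.range E))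
    -- `F` is the holomorphic continuation of `χ R(λ) χ`
    (χ : H →L[ℂ] H) (c₀ : ℝ) (hc₀ : 0 < c₀) (F : ℂ → H →L[ℂ] H)
    (hFhol : DifferentiableOn ℂ F {l : ℂ | -c₀ < l.im ∧ l.re ≠ 0})
    (hFres : ∀ l : ℂ, 0 < l.im → l.re ≠ 0 → F l = χ ∘L waveResolvent P l ∘L χ)
    -- behaviour at high energy
    (p q : ℝ) (hp : 0 ≤ p) (hq : 0 ≤ q)
    (hdecay : ∀ ε : ℝ, 0 < ε → ∃ M : ℝ, ∀ l : ℂ, M ≤ |l.re| → -c₀ < l.im → l.im ≤ c₀ →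
      domOpNorm P p q (restrictDom P p (F l)) ≤ ENNReal.ofReal ε)
    (hint : ∀ s : ℝ, -c₀ < s → s ≠ 0 → (∀ l, s ≠ √(-E l)) →
      (⨆ (ε : ℝ) (_ : 0 < ε), ∫⁻ x in {x : ℝ | ε < |x|},
        domOpNorm P p q (restrictDom P p (F (x + s * Complex.I)))) < ⊤)
    -- expansion at low energy; `B j k` is the operator `χ A_{j,k} χ`
    (B : ℕ → ℤ → domPow P p →ₗ[ℂ] H) (ν : ℕ → ℝ) (b : ℕ → ℤ → ℂ)
    (hB : ∀ j k, domOpNorm P p q (B j k) < ⊤)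
    (hb : ∀ j k, ∀ r : ℝ, 0 ≤ r → b j k ≠ r * Complex.I)
    (hdefined : ∀ j k, k < 0 → B j k ≠ 0 → ∀ l ∈ cutSquare c₀, logProd (b j k) l ≠ 0)
    (habs : ∀ l ∈ cutSquare c₀, l.re ≠ 0 →
      ∑' jk : ℕ × ℤ, domOpNorm P p q
        (powLog (ν jk.1) (b jk.1 jk.2) jk.2 l • B jk.1 jk.2) < ⊤)
    (hunif : ∀ c' : ℝ, c' < c₀ → ∀ ε : ℝ, 0 < ε → ∃ S₀ : Finset (ℕ × ℤ), ∀ S, S₀ ⊆ S →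
      ∀ l : ℂ, l.re ≠ 0 → |l.re| ≤ c' → |l.im| ≤ c' →
        domOpNorm P p q (restrictDom P p (F l) -
          ∑ jk ∈ S, powLog (ν jk.1) (b jk.1 jk.2) jk.2 l • B jk.1 jk.2) ≤ ENNReal.ofReal ε)
    (c : ℝ) (hc : 0 < c) (hcc₀ : c < c₀) :
    -- the contour integrals have limits as `δ → 0⁺`
    ∃ J : ℕ → ℤ → ℝ → ℂ,
      (∀ j k, ∀ t : ℝ, 0 ≤ t → Filter.Tendsto
        (fun δ : ℝ => contourIntegral δ c
          (fun l => Complex.exp (-Complex.I * t * l) * powLog (ν j) (b j k) k l))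
        (nhdsWithin 0 (Set.Ioi 0)) (nhds (J j k t))) ∧
      ∃ C : ℝ, ∀ f : domPow P p, χ (f : H) = f →
        -- `wz` and `wr` are the cut-off parts `χ u_z` and `χ u_r`
        ∃ wz wr : ℝ → H,
          (∀ t : ℝ, 0 ≤ t →
            χ (wavePropagator P t f) = χ (discretePart P E t f) + wz t + wr t) ∧
          (∀ ε : ℝ, 0 < ε → ∃ S₀ : Finset (ℕ × ℤ), ∀ S, S₀ ⊆ S → ∀ t : ℝ, 0 ≤ t →
            domNorm P q (wz t - (1 / (2 * Real.pi) : ℂ) •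
              ∑ jk ∈ S, J jk.1 jk.2 t • B jk.1 jk.2 f) ≤ ENNReal.ofReal ε) ∧
          (∀ t : ℝ, 0 ≤ t →
            domNorm P q (wr t) ≤ ENNReal.ofReal (C * Real.exp (-c * t)) * domNorm P p f) := by
  have D : SpectralData P E := ⟨hP, hEmono.injective, hEneg, hspec⟩
  have R : CutoffResolvent P χ c₀ p q F := ⟨hFhol, hFres, hdecay⟩
  have hfin : ∀ s : ℝ, -c₀ < s → s ≠ 0 → (∀ l, s ≠ √(-E l)) → lineNorm P p q F s < ⊤ := hint
  have hpi := Real.pi_pos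
  choose J hJ using fun (j : ℕ) (k : ℤ) (t : ℝ) =>
    exists_tendsto_contourIntegral_powLog (hb j k) (ν j) k hc t
  refine ⟨J, fun j k t _ => hJ j k t, ?_⟩
  -- a line above `Im λ = c` which avoids the eigenvalues; it controls the decaying exponentials
  obtain ⟨s, ⟨hcs, hsc⟩, hsE⟩ : ∃ s ∈ Set.Ioo c c₀, ∀ l, s ≠ √(-E l) := by
    obtain ⟨s, hs, hs'⟩ := ((Set.Ioo_infinite hcc₀).sdiff
      (Set.finite_range fun l => √(-E l))).nonempty
    exact ⟨s, hs, fun l h => hs' ⟨l, h.symm⟩⟩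
  obtain ⟨η, hη0, hηc, hηE⟩ : ∃ η : ℝ, 0 < η ∧ η ≤ c₀ ∧ ∀ l, η ≤ √(-E l) := by
    have h1 : ∀ᶠ x in nhdsWithin (0 : ℝ) (Set.Ioi 0), ∀ l, x < √(-E l) :=
      Filter.eventually_all.2 fun l => Filter.mem_of_superset (Ioo_mem_nhdsGT (D.sqrt_neg_pos l))
        fun x hx => hx.2
    obtain ⟨η, h2, h3⟩ := (h1.and (Ioo_mem_nhdsGT hc₀)).exists
    exact ⟨η, h3.1, h3.2.le, fun l => (h2 l).le⟩
  have hs0 : 0 < s := hc.trans hcs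
  have hsfin := hfin s (by linarith) hs0.ne' hsE
  have hcE : ∀ l, -c ≠ √(-E l) := fun l h => by linarith [D.sqrt_neg_pos l]
  have hcfin := hfin (-c) (by linarith) (by linarith) hcE
  have hδfin : ∀ δ ∈ Set.Ioo 0 η, lineNorm P p q F δ < ⊤ := fun δ hδ =>
    hfin δ (by linarith [hδ.1]) hδ.1.ne' fun l => (hδ.2.trans_le (hηE l)).ne
  refine ⟨1 / (2 * Real.pi) * ((lineNorm P p q F (-c)).toReal + (lineNorm P p q F s).toReal),
    fun f hf => ?_⟩
  set K := (domNorm P p (f : H)).toReal with hK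
  have hK0 : 0 ≤ K := ENNReal.toReal_nonneg
  -- eigenvalues in the region of the low energy expansion would be poles of `χ R(λ) f`
  have hvanish : ∀ l, √(-E l) < c₀ → χ (eigenProjection P (E l) f) = 0 := fun l hl => by
    obtain ⟨C, hC⟩ := exists_eventually_norm_le (D.sqrt_neg_pos l) hl hdefined
      (hunif _ hl) f
    exact R.apply_eigenProjection_eq_zero D l hf hC
  -- `wz` is defined as what remains; it is identified with the sum of the `J_{j,k} B_{j,k}` weakly
  refine ⟨fun t => χ (wavePropagator P t f) - χ (discretePart P E t f) -
    (lineVec F f (-c) t - lineVec F f s (-t)),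
    fun t => lineVec F f (-c) t - lineVec F f s (-t),
    fun t _ => by rw [add_assoc, sub_add_cancel, add_sub_cancel], ?_, ?_⟩
  · intro ε hε
    -- the length of the contour tends to `2c` as `δ → 0`, and `c / π * ε' * K ≤ ε`
    set ε' := ε / (c * (K + 1)) with hε'
    have hε'0 : 0 < ε' := by positivity
    obtain ⟨S₀, hS₀⟩ := hunif c hcc₀ ε' hε'0
    refine ⟨S₀, fun S hS t ht => ?_⟩
    -- the line integrals over `Im λ = δ` do not depend on `δ`
    have hU : ∀ δ ∈ Set.Ioo 0 η, lineVec F f δ t = χ (wavePropagator P t f) -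
        χ (discretePart P E t f) + lineVec F f s (-t) := fun δ hδ => by
      rw [R.apply_wavePropagator_eq D hf hδ.1 (fun l => hδ.2.trans_le (hηE l)) (hδfin δ hδ) hs0 hsc
        hsE hsfin hvanish ht]
      abel
    set wz := χ (wavePropagator P t f) - χ (discretePart P E t f) -
      (lineVec F f (-c) t - lineVec F f s (-t)) with hwz
    have hle : domNorm P q (wz - (1 / (2 * Real.pi) : ℂ) •
        ∑ jk ∈ S, J jk.1 jk.2 t • B jk.1 jk.2 f) ≤ ENNReal.ofReal (c / Real.pi * (ε' * K)) := by
      refine domNorm_le_of_inner_le (by positivity) fun w => ?_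
      set A := ‖ContinuousLinearMap.adjoint (negPow P q) w‖ with hA
      have hlim := R.tendsto_contourIntegral_matrixElement D hc hcc₀ hη0 hηc hηE f ht hcfin hδfin
        hU w
      have hUw : χ (wavePropagator P t f) - χ (discretePart P E t f) + lineVec F f s (-t) -
          lineVec F f (-c) t = wz := by rw [hwz]; abel
      rw [hUw] at hlim
      have hlimS : Filter.Tendsto (fun δ : ℝ => ∑ jk ∈ S, inner ℂ w (B jk.1 jk.2 f) *
          contourIntegral δ c (fun l => Complex.exp (-Complex.I * t * l) *
            powLog (ν jk.1) (b jk.1 jk.2) jk.2 l)) (nhdsWithin 0 (Set.Ioi 0))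
          (nhds (∑ jk ∈ S, inner ℂ w (B jk.1 jk.2 f) * J jk.1 jk.2 t)) :=
        tendsto_finsetSum _ fun jk _ => (hJ jk.1 jk.2 t).const_mul _
      have hlim2 := (hlim.sub hlimS).norm
      have hbound : Filter.Tendsto (fun δ : ℝ => (2 * c + Real.pi * δ) *
          (Real.exp (t * δ) * (ε' * K * A))) (nhdsWithin 0 (Set.Ioi 0))
          (nhds (2 * c * (ε' * K * A))) := by
        have h1 : Continuous fun δ : ℝ => (2 * c + Real.pi * δ) *
          (Real.exp (t * δ) * (ε' * K * A)) := by fun_prop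
        have h2 := h1.tendsto 0
        simp only [mul_zero, add_zero, Real.exp_zero, one_mul] at h2
        exact h2.mono_left nhdsWithin_le_nhds
      choose η' hη'0 hη' using fun jk : ℕ × ℤ =>
        exists_differentiableOn_powLog (hb jk.1 jk.2) (ν jk.1) jk.2 c₀
      have hev : ∀ᶠ δ in nhdsWithin (0 : ℝ) (Set.Ioi 0), ∀ jk ∈ S, δ < η' jk :=
        (Filter.eventually_all_finset S).2 fun jk _ =>
          Filter.mem_of_superset (Ioo_mem_nhdsGT (hη'0 jk)) fun x hx => hx.2
      have hcmp := le_of_tendsto_of_tendsto hlim2 hbound (by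
        filter_upwards [hev, Ioo_mem_nhdsGT hη0, Ioo_mem_nhdsGT hc] with δ h1 h2 h3
        -- a common region on which all the integrands are continuous
        obtain ⟨η₁, hη₁, hη₁η, hη₁S⟩ : ∃ η₁, δ < η₁ ∧ η₁ ≤ η ∧ ∀ jk ∈ S, η₁ ≤ η' jk := by
          by_cases hSe : S.Nonempty
          · refine ⟨min η (S.inf' hSe η'), lt_min h2.2 ((Finset.lt_inf'_iff _).2 h1),
              min_le_left _ _, fun jk hjk => (min_le_right _ _).trans (Finset.inf'_le _ hjk)⟩
          · exact ⟨η, h2.2, le_rfl, fun jk hjk => absurd ⟨jk, hjk⟩ hSe⟩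
        have hexp : Continuous fun l : ℂ => Complex.exp (-Complex.I * t * l) := by fun_prop
        have hc1 : ContinuousOn (fun l => Complex.exp (-Complex.I * t * l) *
            matrixElement P χ F w f l) (slitRegion η₁ c₀) :=
          hexp.continuousOn.mul ((R.differentiableOn_matrixElement D hηE w f).continuousOn.mono
            fun l hl => ⟨hl.2.1, hl.2.2.1.trans_le hη₁η, hl.2.2.2⟩)
        have hc2 : ∀ jk ∈ S, ContinuousOn (fun l => inner ℂ w (B jk.1 jk.2 f) *
            (Complex.exp (-Complex.I * t * l) * powLog (ν jk.1) (b jk.1 jk.2) jk.2 l))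
            (slitRegion η₁ c₀) := fun jk hjk =>
          continuousOn_const.mul (hexp.continuousOn.mul ((hη' jk).continuousOn.mono
            fun l hl => ⟨hl.1.trans_le (hη₁S jk hjk), hl.2.1, hl.2.2.1.trans_le (hη₁S jk hjk),
              hl.2.2.2⟩))
        simp only [← contourIntegral_const_mul]
        rw [← contourIntegral_sum S h2.1 hη₁ hc hcc₀ hc2, ← contourIntegral_sub h2.1 hη₁ hc hcc₀ hc1
          (continuousOn_finsetSum _ hc2)]
        refine norm_contourIntegral_le h2.1 hc fun l hre h4 h5 h6 => ?_
        have h7 := domNorm_apply_sub_sum_le hε'0.le (hS₀ S hS l hre (h4.trans h3.2.le)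
          (abs_le.2 ⟨h5, h6.trans h3.2.le⟩)) f
        have h8 := norm_inner_le_of_domNorm h7 w (by positivity)
        have h9 : Complex.exp (-Complex.I * t * l) * matrixElement P χ F w f l -
            ∑ jk ∈ S, inner ℂ w (B jk.1 jk.2 f) *
              (Complex.exp (-Complex.I * t * l) * powLog (ν jk.1) (b jk.1 jk.2) jk.2 l) =
            Complex.exp (-Complex.I * t * l) * inner ℂ w (F l f -
              ∑ jk ∈ S, powLog (ν jk.1) (b jk.1 jk.2) jk.2 l • B jk.1 jk.2 f) := by
          rw [R.matrixElement_eq w f hre, inner_sub_right, inner_sum, mul_sub, Finset.mul_sum]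
          congr 1
          refine Finset.sum_congr rfl fun jk _ => ?_
          rw [inner_smul_right]; ring
        rw [h9, norm_mul, norm_exp_neg_I_mul]
        gcongr)
      have hinner : inner ℂ w (wz - (1 / (2 * Real.pi) : ℂ) •
          ∑ jk ∈ S, J jk.1 jk.2 t • B jk.1 jk.2 f) = (1 / (2 * Real.pi) : ℂ) *
          (2 * Real.pi * inner ℂ w wz - ∑ jk ∈ S, inner ℂ w (B jk.1 jk.2 f) * J jk.1 jk.2 t) := by
        have hpi' : (Real.pi : ℂ) ≠ 0 := by exact_mod_cast hpi.ne'
        have hsum : ∑ jk ∈ S, inner ℂ w (J jk.1 jk.2 t • B jk.1 jk.2 f) =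
            ∑ jk ∈ S, inner ℂ w (B jk.1 jk.2 f) * J jk.1 jk.2 t :=
          Finset.sum_congr rfl fun jk _ => by rw [inner_smul_right, mul_comm]
        rw [inner_sub_right, inner_smul_right, inner_sum, hsum]
        field_simp
      rw [hinner, norm_mul]
      have hn : ‖(1 / (2 * Real.pi) : ℂ)‖ = 1 / (2 * Real.pi) := by
        simp [abs_of_pos hpi]
      rw [hn]
      calc _ ≤ 1 / (2 * Real.pi) * (2 * c * (ε' * K * A)) := by gcongr
        _ = _ := by field_simp
    refine hle.trans (ENNReal.ofReal_le_ofReal ?_)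
    have h1 : c / Real.pi * (ε' * K) = ε * (K / ((K + 1) * Real.pi)) := by
      rw [hε']; field_simp
    rw [h1]
    refine mul_le_of_le_one_right hε.le ?_
    rw [div_le_one (by positivity)]
    nlinarith [Real.pi_gt_three]
  · intro t ht
    have hKf : domNorm P p (f : H) = ENNReal.ofReal K :=
      (ENNReal.ofReal_toReal (domNorm_ne_top_of_mem f)).symm
    have h1 := R.domNorm_lineVec_le (by linarith) hcfin f t
    have h2 := R.domNorm_lineVec_le (by linarith) hsfin f (-t)
    rw [hKf, ← ENNReal.ofReal_mul (by positivity)]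
    refine domNorm_le_of_inner_le (by positivity) fun w => ?_
    have h3 := norm_inner_le_of_domNorm h1 w (by positivity)
    have h4 := norm_inner_le_of_domNorm h2 w (by positivity)
    -- `s > c` makes the second line integral decay at least as fast as the first
    have he : Real.exp (-t * s) ≤ Real.exp (-c * t) := Real.exp_le_exp.2 (by nlinarith)
    rw [← hK] at h3 h4
    set A := ‖ContinuousLinearMap.adjoint (negPow P q) w‖ with hA
    rw [inner_sub_right]
    calc _ ≤ 1 / (2 * Real.pi) * Real.exp (t * -c) * (lineNorm P p q F (-c)).toReal * K * A +
          1 / (2 * Real.pi) * Real.exp (-t * s) * (lineNorm P p q F s).toReal * K * A :=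
          (norm_sub_le _ _).trans (add_le_add h3 h4)
      _ ≤ 1 / (2 * Real.pi) * Real.exp (-c * t) * (lineNorm P p q F (-c)).toReal * K * A +
          1 / (2 * Real.pi) * Real.exp (-c * t) * (lineNorm P p q F s).toReal * K * A := by
          rw [show t * -c = -c * t by ring]
          gcongr
      _ = _ := by ring
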